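/- **Setting.** A bond is an unordered pair of nearest neighbours of $\mathbb{Z}^2$, also viewed as an open unit segment in the plane; $\mathcal{B}(\mathbb{Z}^2)$ is the set of all bonds. For a set $\mathcal{D}$ of bonds, $V(\mathcal{D})$ is the set of endpoints of bonds in $\mathcal{D}$ and $\mathcal{G}_{\mathcal{D}}$ is the $\sigma$-algebra generated by $(\omega_e)_{e\in\mathcal{D}}$, $\omega\in\{0,1\}^{\mathcal{B}(\mathbb{Z}^2)}$ ($1$ = open). For $R\subset\mathbb{R}^2$, $\mathcal{B}(R)$ is the set of bonds whose segment lies in $R$; for $\Lambda\subset\mathbb{Z}^2$, $\mathcal{B}(\Lambda)$ is the set of bonds with both endpoints in $\Lambda$. $|\cdot|$ is the Euclidean norm or the cardinality, and $d(\mathcal{C},\mathcal{E})$ is the infimum of Euclidean distances between points of the segments in $\mathcal{C}$ and in $\mathcal{E}$ ($+\infty$ if one of them is empty). The dual bond $e^*$ of $e$ is its perpendicular bisector, an edge of $(\mathbb{Z}^2)^*=\mathbb{Z}^2+(\frac12,\frac12)$, and is open iff $e$ is closed; $x^*=x+(\frac12,\frac12)$. $C_{x^*}=C_{x^*}(\omega)$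 is the connected component of $x^*$ in the graph of open dual bonds, and $u^*\leftrightarrow v^*$ means that $u^*,v^*$ lie in the same component. An event is *increasing* if it is preserved by opening bonds; a measure has the *FKG property* if increasing events are positively correlated under it. $P_{\mathcal{D},\rho}$ is the conditional distribution of $P$ given $\omega_e=\rho_e$ for all $e\notin\mathcal{D}$ (statements about it are for $P$-almost all $\rho$). A *circuit* $\gamma$ is a closed lattice path with distinct bonds that does not cross itself (it may touch itself); $|\gamma|$ is its number of bonds, $\mathrm{Int}(\gamma)$ is the union of the bounded components of $\mathbb{R}^2\setminus\gamma$, $\mathrm{Ext}(\gamma)$ is the unbounded component, and $\mathrm{Open}(\gamma)$ is the event that all bonds of $\gamma$ are open. Let $P$ be a probability measure on $\{0,1\}^{\mathcal{B}(\mathbb{Z}^2)}$. The *standing assumptions* are: $P$ is invariant under translations and under rotation by $90^\circ$; $P$ has the FKG property; $P$ has bounded energy, i.e. for some $p_0>0$, $p_0<P(\omega_e=1\mid\omega_b,b\ne e)<1-p_0$ almost surely for every bond $e$; dual connectivity decays exponentially, i.e. $P(0^*\leftrightarrow x^*)\le Ce^{-c|x|}$ for some $C,c>0$ and all $x\in\mathbb{Z}^2$;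 and $P_{\mathcal{B}(\Lambda),\rho}$ has the FKG property for all finite $\Lambda\subset\mathbb{Z}^2$ and all $\rho$. Write $S_\lambda(\mathcal{D},\mathcal{F})=\sum_{x\in V(\mathcal{D}),\,y\in V(\mathcal{F})}e^{-\lambda|x-y|}\in[0,\infty]$. * $P$ is *weak mixing* if for some $C,\lambda>0$ and all $\mathcal{D},\mathcal{F}\subset\mathcal{B}(\mathbb{Z}^2)$: $|P(E\mid F)-P(E)|\le C\,S_\lambda(\mathcal{D},\mathcal{F})$ for all $E\in\mathcal{G}_{\mathcal{D}}$, $F\in\mathcal{G}_{\mathcal{F}}$ with $P(F)>0$. * $P$ is *ratio weak mixing* if for some $C,\lambda>0$ and all $\mathcal{D},\mathcal{F}\subset\mathcal{B}(\mathbb{Z}^2)$ with $C\,S_\lambda(\mathcal{D},\mathcal{F})<1$: $\left|\frac{P(E\cap F)}{P(E)P(F)}-1\right|\le C\,S_\lambda(\mathcal{D},\mathcal{F})$ for all $E\in\mathcal{G}_{\mathcal{D}}$, $F\in\mathcal{G}_{\mathcal{F}}$ with $P(E)P(F)>0$. * $P$ has the *near-Markov property for open circuits* if for some $C,a>0$ and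 every circuit $\gamma$: $\left|\frac{P(A\mid \mathrm{Open}(\gamma)\cap B)}{P(A\mid\mathrm{Open}(\gamma))}-1\right|\le Ce^{-a|\gamma|}$ for all $A\in\mathcal{G}_{\mathcal{B}(\mathrm{Int}(\gamma))}$, $B\in\mathcal{G}_{\mathcal{B}(\mathrm{Ext}(\gamma))}$ for which the ratio is defined. An event $A$ *occurs on* a set $\mathcal{C}$ of bonds in $\omega$ if $\omega'\in A$ for every $\omega'$ that agrees with $\omega$ on $\mathcal{C}$. $A$ *occurs only on* $C_{x^*}$ if, for every $\omega\in A$, $A$ occurs in $\omega$ on the set of bonds whose duals belong to $C_{x^*}(\omega)$. For events $A,B$ and $r\in\mathbb{R}$, $A\circ_r B$ is the set of all $\omega$ for which there are $\mathcal{C},\mathcal{E}\subset\mathcal{B}(\mathbb{Z}^2)$ with $d(\mathcal{C},\mathcal{E})\ge r$ such that, in $\omega$, $A$ occurs on $\mathcal{C}$ and $B$ occurs on $\mathcal{E}$. **Lemma 3.2.** Let $P$ satisfy the standing assumptions and either (i) the ratio weak mixing property or (ii) both the weak mixing property and the near-Markov property for open circuits. Then there are constants $K_1,K_2,\varepsilon>0$,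 depending only on $P$, such that for every finite set $\mathcal{D}$ of bonds, every $x^*\in(\mathbb{Z}^2)^*$, every real $r>K_1\log|\mathcal{D}|$ (with $r>0$ if $\mathcal{D}=\emptyset$), and all events $A,B$ such that $A$ occurs only on $C_{x^*}$ and $B\in\mathcal{G}_{\mathcal{D}}$, $$P(A\circ_r B)\le\bigl(1+K_2e^{-\varepsilon r}\bigr)P(A)P(B).$$ -/

import Mathlib

open MeasureTheory ProbabilityTheory

namespace BondPerc

/-! ## The square lattice, its bonds, and the dual lattice -/

/-- Sites of the square lattice. The dual site `x + (1/2, 1/2)` is also named by `x`. -/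
abbrev Site : Type := ℤ × ℤ

/-- Nearest-neighbour bonds of the square lattice. `(x, false)` is the horizontal bond joining
`x` and `x + (1, 0)`; `(x, true)` is the vertical bond joining `x` and `x + (0, 1)`. Each unordered
pair of nearest neighbours is represented exactly once. -/
abbrev Bond : Type := Site × Bool

/-- First endpoint of a bond. -/
def Bond.src (e : Bond) : Site := e.1

/-- Second endpoint of a bond. -/
def Bond.tgt (e : Bond) : Site := if e.2 then (e.1.1, e.1.2 + 1) else (e.1.1 + 1, e.1.2)

/-- The bond `e` is the bond joining the sites `x` and `y`. -/
def Bond.Joins (e : Bond) (x y : Site) : Prop :=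
  (e.src = x ∧ e.tgt = y) ∨ (e.src = y ∧ e.tgt = x)

/-- The dual bond of `e` (its perpendicular bisector) joins the dual sites named `e.dualSrc` and
`e.dualTgt`: for the horizontal bond at `x` these are `(x - (0, 1))*` and `x*`, for the vertical
one `(x - (1, 0))*` and `x*`. -/
def Bond.dualSrc (e : Bond) : Site := if e.2 then (e.1.1 - 1, e.1.2) else (e.1.1, e.1.2 - 1)

/-- See `Bond.dualSrc`. -/
def Bond.dualTgt (e : Bond) : Site := e.1

/-- The Euclidean plane. -/
abbrev Plane : Type := EuclideanSpace ℝ (Fin 2)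

/-- A site as a point of the plane. -/
noncomputable def toPlane (x : Site) : Plane := !₂[(x.1 : ℝ), (x.2 : ℝ)]

/-- A bond as an open line segment in the plane. -/
def Bond.segment (e : Bond) : Set Plane := openSegment ℝ (toPlane e.src) (toPlane e.tgt)

/-- `V(𝒟)`: all endpoints of bonds of `𝒟`. -/
def endpoints (𝒟 : Set Bond) : Set Site := {x | ∃ e ∈ 𝒟, x = e.src ∨ x = e.tgt}

/-- `ℬ(R)` for a region `R` of the plane: the bonds whose open segment lies in `R`. -/
def bondsInRegion (R : Set Plane) : Set Bond := {e | e.segment ⊆ R}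

/-- `ℬ(Λ)` for a set `Λ` of sites: the bonds with both endpoints in `Λ`. -/
def bondsInSites (Λ : Set Site) : Set Bond := {e | e.src ∈ Λ ∧ e.tgt ∈ Λ}

/-- `d(𝒞, ℰ) ≥ r`, the distance being the infimum of the Euclidean distances between points of
the corresponding segments (so it is `+∞` if one of the sets is empty). -/
def DistGE (r : ℝ) (𝒞 ℰ : Set Bond) : Prop :=
  ∀ e ∈ 𝒞, ∀ f ∈ ℰ, ∀ p ∈ e.segment, ∀ q ∈ f.segment, r ≤ dist p q

/-! ## Configurations, dual clusters -/

/-- Bond configurations; `true` means open. The order is the coordinatewise one. -/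
abbrev Config : Type := Bond → Bool

/-- The dual sites `u*`, `v*` are joined by an open dual bond, i.e. by the dual of a closed bond. -/
def DualStep (ω : Config) (u v : Site) : Prop :=
  ∃ e : Bond, ω e = false ∧ ((e.dualSrc = u ∧ e.dualTgt = v) ∨ (e.dualSrc = v ∧ e.dualTgt = u))

/-- `u* ↔ v*`: there is a path of open dual bonds from `u*` to `v*`. -/
def DualConn (ω : Config) (u v : Site) : Prop := Relation.ReflTransGen (DualStep ω) u v

/-- The dual cluster of `x*`, as a set of bonds: the bonds whose duals are open and belong to the
connected component of `x*`. -/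
def dualCluster (x : Site) (ω : Config) : Set Bond :=
  {e | ω e = false ∧ DualConn ω x e.dualSrc}

/-- The event that all bonds of `𝒟` are open. -/
def allOpen (𝒟 : Set Bond) : Set Config := {ω | ∀ e ∈ 𝒟, ω e = true}

/-! ## Occurrence of events on bond sets -/

/-- `A` occurs on `𝒞` in `ω`. -/
def OccursOn (A : Set Config) (𝒞 : Set Bond) (ω : Config) : Prop :=
  ∀ ω' : Config, (∀ e ∈ 𝒞, ω' e = ω e) → ω' ∈ A

/-- `A` occurs only on the random set `ℱ`. -/
def OccursOnlyOn (A : Set Config) (ℱ : Config → Set Bond) : Prop :=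
  ∀ ω ∈ A, OccursOn A (ℱ ω) ω

/-- The event `A ∘ᵣ B` that `A` and `B` occur at separation `r`. -/
def atSeparation (r : ℝ) (A B : Set Config) : Set Config :=
  {ω | ∃ 𝒞 ℰ : Set Bond, DistGE r 𝒞 ℰ ∧ OccursOn A 𝒞 ω ∧ OccursOn B ℰ ω}

/-! ## Circuits -/

/-- A circuit: a closed path `site 0, bond 0, site 1, …, bond (len - 1), site len = site 0`, with
indices modulo its length, whose bonds are distinct and which does not cross itself. As the bonds
are distinct, two passages through the same site cross each other exactly when both of them go
straight through it (one horizontally, the other vertically). Touching is allowed. -/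
structure Circuit where
  len : ℕ
  len_pos : 0 < len
  site : ZMod len → Site
  bond : ZMod len → Bond
  joins : ∀ i, (bond i).Joins (site i) (site (i + 1))
  bond_injective : Function.Injective bond
  noncrossing : ∀ i j, i ≠ j → site i = site j →
    ¬ (site (i + 1) - site i = site i - site (i - 1) ∧
       site (j + 1) - site j = site j - site (j - 1))

/-- The set of bonds of a circuit. -/
def Circuit.bonds (γ : Circuit) : Set Bond := Set.range γ.bond

/-- The circuit as a closed curve in the plane. -/
def Circuit.trace (γ : Circuit) : Set Plane :=
  ⋃ i, _root_.segment ℝ (toPlane (γ.bond i).src) (toPlane (γ.bond i).tgt)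

/-- `Int(γ)`: the union of the bounded components of the complement of `γ` in the plane. -/
def Circuit.interior (γ : Circuit) : Set Plane :=
  {p | p ∈ γ.traceᶜ ∧ Bornology.IsBounded (connectedComponentIn γ.traceᶜ p)}

/-- `Ext(γ)`: the unbounded component of the complement of `γ` in the plane. -/
def Circuit.exterior (γ : Circuit) : Set Plane :=
  {p | p ∈ γ.traceᶜ ∧ ¬ Bornology.IsBounded (connectedComponentIn γ.traceᶜ p)}

/-! ## Properties of bond percolation models

`cylinderEvents 𝒟` is the σ-algebra `𝒢_𝒟` generated by the states of the bonds of `𝒟`. -/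

/-- The conditional distribution `P_{𝒟,ρ}`, given that the configuration off `𝒟` is that of `ρ`
(a regular conditional probability, hence determined for `P`-almost all `ρ`). -/
noncomputable def condDistr (P : Measure Config) [IsFiniteMeasure P] (𝒟 : Set Bond)
    (ρ : Config) : Measure Config :=
  condExpKernel P (cylinderEvents (X := fun _ : Bond => Bool) 𝒟ᶜ) ρ

/-- The FKG property: increasing events are positively correlated. -/
def FKG (μ : Measure Config) : Prop :=
  ∀ A B : Set Config, MeasurableSet A → MeasurableSet B → IsUpperSet A → IsUpperSet B →
    μ A * μ B ≤ μ (A ∩ B)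

/-- The translate of a bond by `a`. -/
def Bond.translate (a : Site) (e : Bond) : Bond := (e.1 + a, e.2)

/-- The image of a bond under the rotation by 90 degrees `(x₁, x₂) ↦ (-x₂, x₁)`. -/
def Bond.rotate (e : Bond) : Bond :=
  if e.2 then ((-e.1.2 - 1, e.1.1), false) else ((-e.1.2, e.1.1), true)

/-- Translation invariance. -/
def TranslationInvariant (P : Measure Config) : Prop :=
  ∀ a : Site, P.map (fun (ω : Config) (e : Bond) => ω (e.translate a)) = P

/-- Invariance under rotation by 90 degrees. -/
def RotationInvariant (P : Measure Config) : Prop :=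
  P.map (fun (ω : Config) (e : Bond) => ω e.rotate) = P

/-- Bounded energy: given all other bonds, the conditional probability that `e` is open is
bounded away from 0 and 1. -/
def BoundedEnergy (P : Measure Config) [IsFiniteMeasure P] : Prop :=
  ∃ p₀ : ℝ, 0 < p₀ ∧ ∀ e : Bond, ∀ᵐ ρ ∂P,
    p₀ < (condDistr P {e} ρ).real {ω | ω e = true} ∧
    (condDistr P {e} ρ).real {ω | ω e = true} < 1 - p₀

/-- Exponential decay of dual connectivity. -/
def DualExpDecay (P : Measure Config) : Prop :=
  ∃ C c : ℝ, 0 < C ∧ 0 < c ∧ ∀ x : Site,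
    P.real {ω | DualConn ω 0 x} ≤ C * Real.exp (-c * ‖toPlane x‖)

/-- The standing assumptions on a bond percolation model. -/
structure StandingAssumptions (P : Measure Config) [IsFiniteMeasure P] : Prop where
  translation : TranslationInvariant P
  rotation : RotationInvariant P
  fkg : FKG P
  boundedEnergy : BoundedEnergy P
  dualDecay : DualExpDecay P
  fkg_cond : ∀ Λ : Finset Site, ∀ᵐ ρ ∂P, FKG (condDistr P (bondsInSites Λ) ρ)

/-- `∑_{x ∈ V(𝒟), y ∈ V(ℱ)} e^{-λ|x - y|}`, possibly `+∞`. -/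
noncomputable def decaySum (lam : ℝ) (𝒟 ℱ : Set Bond) : ENNReal :=
  ∑' (x : endpoints 𝒟) (y : endpoints ℱ),
    ENNReal.ofReal (Real.exp (-lam * dist (toPlane x) (toPlane y)))

/-- The weak mixing property. -/
def WeakMixing (P : Measure Config) : Prop :=
  ∃ C lam : ℝ, 0 < C ∧ 0 < lam ∧ ∀ 𝒟 ℱ : Set Bond, ∀ E F : Set Config,
    MeasurableSet[cylinderEvents 𝒟] E → MeasurableSet[cylinderEvents ℱ] F → 0 < P F →
    ENNReal.ofReal |(P[|F]).real E - P.real E| ≤ ENNReal.ofReal C * decaySum lam 𝒟 ℱ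

/-- The ratio weak mixing property. -/
def RatioWeakMixing (P : Measure Config) : Prop :=
  ∃ C lam : ℝ, 0 < C ∧ 0 < lam ∧ ∀ 𝒟 ℱ : Set Bond,
    ENNReal.ofReal C * decaySum lam 𝒟 ℱ < 1 → ∀ E F : Set Config,
    MeasurableSet[cylinderEvents 𝒟] E → MeasurableSet[cylinderEvents ℱ] F → 0 < P E * P F →
    ENNReal.ofReal |P.real (E ∩ F) / (P.real E * P.real F) - 1| ≤
      ENNReal.ofReal C * decaySum lam 𝒟 ℱ

/-- The near-Markov property for open circuits: given that `γ` is open, the configurations inside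
and outside `γ` are nearly independent. (The positivity conditions say that the ratio and the
conditional probabilities in it are defined.) -/
def NearMarkov (P : Measure Config) : Prop :=
  ∃ C a : ℝ, 0 < C ∧ 0 < a ∧ ∀ γ : Circuit, ∀ A B : Set Config,
    MeasurableSet[cylinderEvents (bondsInRegion γ.interior)] A →
    MeasurableSet[cylinderEvents (bondsInRegion γ.exterior)] B →
    0 < P (allOpen γ.bonds ∩ A) → 0 < P (allOpen γ.bonds ∩ B) →
    |(P[|allOpen γ.bonds ∩ B]).real A / (P[|allOpen γ.bonds]).real A - 1| ≤
      C * Real.exp (-a * γ.len)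

end BondPerc

/-! Both mixing hypotheses enter only through `Decoupling`: for some κ > 0 and all large m, if D has
at most exp(κm) bonds and X is a finite set of bonds at distance at least m from D, then P(E ∩ F) ≤
(1 + exp(-κm)) P(E) P(F) for E determined by X and F by D.

From decoupling to the theorem. Suppose A and B occur on separated sets C and E. Opening every bond
off C keeps A, so the dual cluster c of x in the modified configuration lies in C, is closed in the
original one, and closing c alone forces A. Let U be the event that such separated c and E exist
(`witnessEvent`). Take m of order r. If the true dual cluster S of x stays farther than 2m from E,
then A holds with cluster S, an event on bonds touching S, while B occurs on bonds far from S;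
decoupling and summation over S give (1 + exp(-κm)) P(A) P(B). Otherwise the cluster passes through
some z at distance 3m from E, from which a dual path of length m starts. This path stays far from
both witnesses c and E, so decoupling bounds the contribution of z by 2 P(U) times an exponentially
small crossing probability. Summing over z gives P(U) ≤ (1 + exp(-κm)) P(A) P(B) + θ P(U) with θ
small, and the last term is absorbed on the left. For bounded r the set D is bounded, so bounded
energy bounds P(B) below and the inequality is trivial.

Decoupling is read off from ratio weak mixing. Under weak mixing and the near-Markov property,
surround a connected piece of D by a neighbourhood W and explore the dual clusters issuing from W.
The explored set k has an open boundary, and "the explored set is k" depends only on bonds in a ring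
around the piece, except when a cluster crosses the ring. Weak mixing makes all these events nearly
independent, in total variation, of the events near and far; averaging over k turns this, for one
well-chosen k, into a ratio estimate for the four events needed (`exists_forall_abs_sub_le`). Each
component of the complement of k is bounded by a long open circuit, across which near-Markov
separates inside and outside (`NearMarkovWith.swap_agreeOn`). Together these exchange an event on
the piece between two distant events (`swap_of_chainConnected`), and the pieces of D are peeled off
one by one. -/

namespace BondPerc

open Filter Topology

/-! ## Events determined by a set of bonds -/

/-- The event `E` is determined by the states of the bonds of `X`. -/
def DeterminedBy (E : Set Config) (X : Set Bond) : Prop :=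
  ∀ ω ω' : Config, (∀ e ∈ X, ω e = ω' e) → ω ∈ E → ω' ∈ E

namespace DeterminedBy

variable {E F : Set Config} {X Y : Set Bond}

lemma mono (h : DeterminedBy E X) (hXY : X ⊆ Y) : DeterminedBy E Y :=
  fun ω ω' hω => h ω ω' fun e he => hω e (hXY he)

lemma inter (hE : DeterminedBy E X) (hF : DeterminedBy F X) : DeterminedBy (E ∩ F) X :=
  fun ω ω' h hω => ⟨hE ω ω' h hω.1, hF ω ω' h hω.2⟩

lemma compl (hE : DeterminedBy E X) : DeterminedBy Eᶜ X :=
  fun ω ω' h hω hω' => hω (hE ω' ω (fun e he => (h e he).symm) hω')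

lemma iUnion {ι : Sort*} {E : ι → Set Config} (hE : ∀ i, DeterminedBy (E i) X) :
    DeterminedBy (⋃ i, E i) X := by
  intro ω ω' h hω
  obtain ⟨i, hi⟩ := Set.mem_iUnion.1 hω
  exact Set.mem_iUnion.2 ⟨i, hE i ω ω' h hi⟩

/-- The events determined by `X` form a σ-algebra containing the generators of `cylinderEvents X`.
-/
lemma of_measurableSet (hE : MeasurableSet[cylinderEvents X] E) : DeterminedBy E X := by
  let m : MeasurableSpace Config :=
    { MeasurableSet' := fun E => DeterminedBy E X
      measurableSet_empty := fun _ _ _ h => h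
      measurableSet_compl := fun _ h => h.compl
      measurableSet_iUnion := fun _ h => iUnion h }
  have hle : cylinderEvents (X := fun _ : Bond => Bool) X ≤ m := by
    refine iSup₂_le fun i hi => ?_
    rintro _ ⟨t, -, rfl⟩
    intro ω ω' h hω
    simpa [h i hi] using hω
  exact hle E hE

/-- The event is the preimage of its image under restriction to `X`, and every subset of the finite
space of configurations on `X` is measurable. -/
lemma measurableSet_cylinderEvents (hE : DeterminedBy E X) (hX : X.Finite) :
    MeasurableSet[cylinderEvents X] E := by
  have := hX.to_subtype
  have h : E = (X.domRestrict (π := fun _ : Bond => Bool)) ⁻¹'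
      ((X.domRestrict (π := fun _ : Bond => Bool)) '' E) := by
    refine Set.Subset.antisymm (Set.subset_preimage_image _ _) ?_
    rintro ω' ⟨ω, hω, hωω'⟩
    exact hE ω ω' (fun e he => congrFun hωω' ⟨e, he⟩) hω
  rw [h]
  exact measurable_restrict_cylinderEvents X (Set.toFinite _).measurableSet

lemma measurableSet (hE : DeterminedBy E X) (hX : X.Finite) : MeasurableSet E :=
  cylinderEvents_le_pi _ (hE.measurableSet_cylinderEvents hX)

end DeterminedBy

/-- The event that the configuration agrees with `η` on `X`. -/
def agreeOn (X : Set Bond) (η : Config) : Set Config := {ω | ∀ e ∈ X, ω e = η e}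

lemma determinedBy_agreeOn (X : Set Bond) (η : Config) : DeterminedBy (agreeOn X η) X :=
  fun ω ω' h hω e he => by rw [← h e he]; exact hω e he

lemma agreeOn_union (X Y : Set Bond) (η : Config) :
    agreeOn (X ∪ Y) η = agreeOn X η ∩ agreeOn Y η := by
  ext ω
  simp only [agreeOn, Set.mem_union, Set.mem_ofPred_eq, Set.mem_inter_iff]
  exact ⟨fun h => ⟨fun e he => h e (.inl he), fun e he => h e (.inr he)⟩,
    fun h e he => he.elim (h.1 e) (h.2 e)⟩

lemma determinedBy_allOpen (X : Set Bond) : DeterminedBy (allOpen X) X :=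
  fun ω ω' h hω e he => by rw [← h e he]; exact hω e he

/-- An inequality between two measures on all atoms of finitely many bonds extends to all events
determined by these bonds. -/
lemma measureReal_inter_le_of_atoms (P : Measure Config) [IsProbabilityMeasure P] {X : Set Bond}
    (hX : X.Finite) {U V : Set Config} {a b : ℝ}
    (h : ∀ η, a * P.real (U ∩ agreeOn X η) ≤ b * P.real (V ∩ agreeOn X η))
    {G : Set Config} (hG : DeterminedBy G X) :
    a * P.real (U ∩ G) ≤ b * P.real (V ∩ G) := by
  classical
  have := hX.to_subtype
  have := Fintype.ofFinite X
  let ext : (X → Bool) → Config := fun σ e => if h : e ∈ X then σ ⟨e, h⟩ else false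
  have hext : ∀ σ (e : Bond) (he : e ∈ X), ext σ e = σ ⟨e, he⟩ := fun σ e he => dif_pos he
  let I : Finset (X → Bool) := Finset.univ.filter fun σ => ext σ ∈ G
  have hdec : G = ⋃ σ ∈ I, agreeOn X (ext σ) := by
    ext ω
    simp only [Set.mem_iUnion, exists_prop]
    constructor
    · intro hω
      refine ⟨fun e => ω e, ?_, fun e he => (hext (fun e => ω e) e he).symm⟩
      rw [Finset.mem_filter]
      exact ⟨Finset.mem_univ _, hG ω _ (fun e he => (hext (fun e => ω e) e he).symm) hω⟩
    · rintro ⟨σ, hσ, hω⟩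
      rw [Finset.mem_filter] at hσ
      exact hG _ ω (fun e he => (hω e he).symm) hσ.2
  have hdisj : Set.PairwiseDisjoint (↑I) fun σ => agreeOn X (ext σ) := by
    intro σ _ τ _ hne
    refine Set.disjoint_left.2 fun ω h1 h2 => hne ?_
    funext e
    rw [← hext σ e e.2, ← hext τ e e.2, ← h1 e e.2, ← h2 e e.2]
  have hsum : ∀ U : Set Config, P.real (U ∩ G) = ∑ σ ∈ I, P.real (U ∩ agreeOn X (ext σ)) := by
    intro U
    have hm : ∀ σ ∈ I, MeasurableSet (agreeOn X (ext σ)) :=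
      fun σ _ => (determinedBy_agreeOn X _).measurableSet hX
    have h1 := measureReal_biUnion_finset (μ := P.restrict U) hdisj hm
    rw [← hdec] at h1
    have hGm : MeasurableSet G := hG.measurableSet hX
    rw [measureReal_restrict_apply hGm] at h1
    rw [Set.inter_comm, h1]
    exact Finset.sum_congr rfl fun σ hσ => by
      rw [measureReal_restrict_apply (hm σ hσ), Set.inter_comm]
  rw [hsum, hsum, Finset.mul_sum, Finset.mul_sum]
  exact Finset.sum_le_sum fun σ _ => h _

/-! ## Sup-norm distance of sites -/

/-- The sup-norm distance. -/
def supDist (u v : Site) : ℕ := max (u.1 - v.1).natAbs (u.2 - v.2).natAbs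

lemma supDist_comm (u v : Site) : supDist u v = supDist v u := by
  simp only [supDist]; omega

lemma supDist_triangle (u v w : Site) : supDist u w ≤ supDist u v + supDist v w := by
  simp only [supDist]; omega

@[simp] lemma supDist_self (u : Site) : supDist u u = 0 := by simp [supDist]

/-- The sites within sup-norm distance `n` of `u`. -/
noncomputable def box (u : Site) (n : ℕ) : Finset Site :=
  Finset.Icc (u.1 - n) (u.1 + n) ×ˢ Finset.Icc (u.2 - n) (u.2 + n)

@[simp] lemma mem_box {u v : Site} {n : ℕ} : v ∈ box u n ↔ supDist u v ≤ n := by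
  simp only [box, Finset.mem_product, Finset.mem_Icc, supDist]; omega

lemma card_box (u : Site) (n : ℕ) : (box u n).card = (2 * n + 1) ^ 2 := by
  rw [box, Finset.card_product, Int.card_Icc, Int.card_Icc, sq]
  congr 1 <;> omega

lemma supDist_le_dist (u v : Site) : (supDist u v : ℝ) ≤ dist (toPlane u) (toPlane v) := by
  have h1 : |(u.1 : ℝ) - v.1| ≤ dist (toPlane u) (toPlane v) := by
    have := PiLp.norm_apply_le (toPlane u - toPlane v) 0
    simpa [toPlane, dist_eq_norm] using this
  have h2 : |(u.2 : ℝ) - v.2| ≤ dist (toPlane u) (toPlane v) := by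
    have := PiLp.norm_apply_le (toPlane u - toPlane v) 1
    simpa [toPlane, dist_eq_norm] using this
  have e1 : (((u.1 - v.1).natAbs : ℕ) : ℝ) = |(u.1 : ℝ) - v.1| := by
    rw [Nat.cast_natAbs]; push_cast; rfl
  have e2 : (((u.2 - v.2).natAbs : ℕ) : ℝ) = |(u.2 : ℝ) - v.2| := by
    rw [Nat.cast_natAbs]; push_cast; rfl
  rw [supDist, Nat.cast_max, e1, e2]
  exact max_le h1 h2

/-! ## The dual lattice as a graph -/

/-- The dual bond of `e` joins the dual sites `u` and `v`. -/
def Bond.DualJoins (e : Bond) (u v : Site) : Prop :=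
  (e.dualSrc = u ∧ e.dualTgt = v) ∨ (e.dualSrc = v ∧ e.dualTgt = u)

lemma Bond.DualJoins.symm {e : Bond} {u v : Site} (h : e.DualJoins u v) : e.DualJoins v u :=
  Or.symm h

lemma Bond.dualJoins (e : Bond) : e.DualJoins e.dualSrc e.dualTgt := .inl ⟨rfl, rfl⟩

lemma Bond.supDist_dualSrc (e : Bond) : supDist e.1 e.dualSrc = 1 := by
  rcases e with ⟨⟨a, b⟩, _ | _⟩ <;> simp [supDist, dualSrc]

lemma Bond.supDist_src (e : Bond) : supDist e.1 e.src = 0 := by simp [src]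

lemma Bond.supDist_tgt (e : Bond) : supDist e.1 e.tgt = 1 := by
  rcases e with ⟨⟨a, b⟩, _ | _⟩ <;> simp [supDist, tgt]

lemma Bond.DualJoins.supDist_eq {e : Bond} {u v : Site} (h : e.DualJoins u v) :
    supDist u v = 1 := by
  rcases h with ⟨rfl, rfl⟩ | ⟨rfl, rfl⟩
  · rw [supDist_comm]; exact e.supDist_dualSrc
  · exact e.supDist_dualSrc

lemma Bond.DualJoins.supDist_left {e : Bond} {u v : Site} (h : e.DualJoins u v) :
    supDist e.1 u ≤ 1 := by
  rcases h with ⟨rfl, rfl⟩ | ⟨rfl, rfl⟩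
  · exact e.supDist_dualSrc.le
  · simp [Bond.dualTgt]

/-- `u` and `v` are neighbours in the dual lattice. -/
def DualAdj (u v : Site) : Prop := ∃ e : Bond, e.DualJoins u v

lemma DualAdj.symm {u v : Site} : DualAdj u v → DualAdj v u := fun ⟨e, he⟩ => ⟨e, he.symm⟩

lemma dualAdj_right (a b : ℤ) : DualAdj (a, b) (a + 1, b) :=
  ⟨((a + 1, b), true), .inl (by simp [Bond.dualSrc, Bond.dualTgt])⟩

lemma dualAdj_up (a b : ℤ) : DualAdj (a, b) (a, b + 1) :=
  ⟨((a, b + 1), false), .inl (by simp [Bond.dualSrc, Bond.dualTgt])⟩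

/-- `u` and `v` are joined by a closed bond of `Q`, crossed dually. -/
def StepOn (Q : Set Bond) (ω : Config) (u v : Site) : Prop :=
  ∃ e ∈ Q, ω e = false ∧ e.DualJoins u v

/-- `u` and `v` are joined by a dual path crossing closed bonds of `Q`. -/
def ConnOn (Q : Set Bond) (ω : Config) : Site → Site → Prop := Relation.ReflTransGen (StepOn Q ω)

lemma StepOn.symm {Q : Set Bond} {ω : Config} {u v : Site} :
    StepOn Q ω u v → StepOn Q ω v u := fun ⟨e, he, h, hj⟩ => ⟨e, he, h, hj.symm⟩

lemma ConnOn.symm {Q : Set Bond} {ω : Config} {u v : Site} (h : ConnOn Q ω u v) :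
    ConnOn Q ω v u := by
  induction h with
  | refl => exact .refl
  | tail _ hs ih => exact .head hs.symm ih

lemma StepOn.supDist_eq {Q : Set Bond} {ω : Config} {u v : Site} :
    StepOn Q ω u v → supDist u v = 1 := fun ⟨_, _, _, hj⟩ => hj.supDist_eq

lemma ConnOn.mono {Q Q' : Set Bond} {ω ω' : Config} (hQ : Q ⊆ Q')
    (hω : ∀ e ∈ Q, ω e = false → ω' e = false) {u v : Site} (h : ConnOn Q ω u v) :
    ConnOn Q' ω' u v :=
  Relation.ReflTransGen.mono (fun _ _ ⟨e, he, h, hj⟩ => ⟨e, hQ he, hω e he h, hj⟩) _ _ h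

lemma dualConn_iff {ω : Config} {u v : Site} : DualConn ω u v ↔ ConnOn Set.univ ω u v := by
  have : DualStep ω = StepOn Set.univ ω := by
    funext u v
    simp [DualStep, StepOn, Bond.DualJoins]
  rw [DualConn, ConnOn, this]

/-- `u` is joined to `v` by a path of the dual lattice whose later sites belong to `K`. -/
def ConnectedIn (K : Set Site) (u v : Site) : Prop :=
  Relation.ReflTransGen (fun a b => b ∈ K ∧ DualAdj a b) u v

lemma ConnectedIn.refl (K : Set Site) (u : Site) : ConnectedIn K u u := Relation.ReflTransGen.refl

lemma ConnectedIn.mem {K : Set Site} {u v : Site} (h : ConnectedIn K u v) (hu : u ∈ K) :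
    v ∈ K := by
  induction h with
  | refl => exact hu
  | tail _ hs _ => exact hs.1

lemma ConnectedIn.symm {K : Set Site} {u v : Site} (h : ConnectedIn K u v) (hu : u ∈ K) :
    ConnectedIn K v u := by
  induction h with
  | refl => exact ConnectedIn.refl K _
  | tail hab hs ih => exact .head ⟨ConnectedIn.mem hab hu, hs.2.symm⟩ ih

lemma ConnectedIn.trans {K : Set Site} {u v w : Site} (h : ConnectedIn K u v)
    (h' : ConnectedIn K v w) : ConnectedIn K u w := Relation.ReflTransGen.trans h h'

lemma ConnectedIn.mono {K L : Set Site} (hKL : K ⊆ L) {u v : Site} (h : ConnectedIn K u v) :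
    ConnectedIn L u v := Relation.ReflTransGen.mono (fun _ _ h => ⟨hKL h.1, h.2⟩) _ _ h

/-- The set `K` is connected in the dual lattice. -/
def DualConnected (K : Set Site) : Prop := ∀ u ∈ K, ∀ v ∈ K, ConnectedIn K u v

/-- An L-shaped path from the centre, horizontal and then vertical, stays in the box. -/
lemma connectedIn_of_box {K : Set Site} {u : Site} {n : ℕ} (hK : ∀ v ∈ box u n, v ∈ K)
    {v : Site} (hv : v ∈ box u n) : ConnectedIn K u v := by
  have hor : ∀ k : ℕ, ∀ s : ℤ, (s = 1 ∨ s = -1) → k ≤ n → ConnectedIn K u (u.1 + s * k, u.2) := by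
    intro k s hs
    induction k with
    | zero => intro _; simpa using ConnectedIn.refl K _
    | succ k ih =>
      intro hk
      refine .tail (ih (by omega)) ⟨hK _ ?_, ?_⟩
      · simp only [mem_box, supDist]; push_cast; rcases hs with rfl | rfl <;> omega
      · push_cast
        rcases hs with rfl | rfl
        · have := dualAdj_right (u.1 + k) u.2
          ring_nf at this ⊢; exact this
        · have := (dualAdj_right (u.1 - k - 1) u.2).symm
          ring_nf at this ⊢; exact this
  have hver : ∀ a : ℤ, (u.1 - a).natAbs ≤ n → ∀ k : ℕ, ∀ s : ℤ, (s = 1 ∨ s = -1) → k ≤ n →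
      ConnectedIn K (a, u.2) (a, u.2 + s * k) := by
    intro a ha k s hs
    induction k with
    | zero => intro _; simpa using ConnectedIn.refl K _
    | succ k ih =>
      intro hk
      refine .tail (ih (by omega)) ⟨hK _ ?_, ?_⟩
      · simp only [mem_box, supDist]; push_cast; rcases hs with rfl | rfl <;> omega
      · push_cast
        rcases hs with rfl | rfl
        · have := dualAdj_up a (u.2 + k)
          ring_nf at this ⊢; exact this
        · have := (dualAdj_up a (u.2 - k - 1)).symm
          ring_nf at this ⊢; exact this
  rw [mem_box, supDist] at hv
  have h1 : ConnectedIn K u (v.1, u.2) := by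
    rcases le_total u.1 v.1 with h | h
    · have := hor (v.1 - u.1).natAbs 1 (.inl rfl) (by omega)
      rwa [show u.1 + 1 * ((v.1 - u.1).natAbs : ℤ) = v.1 by omega] at this
    · have := hor (v.1 - u.1).natAbs (-1) (.inr rfl) (by omega)
      rwa [show u.1 + (-1) * ((v.1 - u.1).natAbs : ℤ) = v.1 by omega] at this
  have h2 : ConnectedIn K (v.1, u.2) (v.1, v.2) := by
    rcases le_total u.2 v.2 with h | h
    · have := hver v.1 (by omega) (v.2 - u.2).natAbs 1 (.inl rfl) (by omega)
      rwa [show u.2 + 1 * ((v.2 - u.2).natAbs : ℤ) = v.2 by omega] at this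
    · have := hver v.1 (by omega) (v.2 - u.2).natAbs (-1) (.inr rfl) (by omega)
      rwa [show u.2 + (-1) * ((v.2 - u.2).natAbs : ℤ) = v.2 by omega] at this
  exact h1.trans h2

/-! ## The boundary of a finite set of faces as a circuit

Dual sites are regarded as faces of the square lattice. -/

/-- The bonds separating `K` from its complement. -/
def edgeBoundary (K : Set Site) : Set Bond := {e | ¬ (e.dualSrc ∈ K ↔ e.dualTgt ∈ K)}

/-- The four lattice directions. -/
inductive Dir
  | east | north | west | south

namespace Dir

/-- The unit vector of a direction. -/
def vec : Dir → Site
  | east => (1, 0)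
  | north => (0, 1)
  | west => (-1, 0)
  | south => (0, -1)

/-- Turning left. -/
def left : Dir → Dir
  | east => north
  | north => west
  | west => south
  | south => east

/-- Turning right. -/
def right : Dir → Dir
  | east => south
  | north => east
  | west => north
  | south => west

lemma vec_injective : Function.Injective vec := by
  intro a b h
  cases a <;> cases b <;> simp [vec] at h ⊢

/-- The face to the left behind a site entered in the given direction. -/
def leftBehind : Dir → Site → Site
  | east, q => (q.1 - 1, q.2)
  | north, q => (q.1 - 1, q.2 - 1)
  | west, q => (q.1, q.2 - 1)
  | south, q => q

/-- The face to the right behind a site entered in the given direction. -/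
def rightBehind (d : Dir) (q : Site) : Site := d.left.leftBehind q

/-- The face to the right ahead of a site entered in the given direction. -/
def rightAhead (d : Dir) (q : Site) : Site := d.left.left.leftBehind q

/-- The face to the left ahead of a site entered in the given direction. -/
def leftAhead (d : Dir) (q : Site) : Site := d.right.leftBehind q

/-- The bond along which a site is entered in the given direction. -/
def inBond : Dir → Site → Bond
  | east, q => ((q.1 - 1, q.2), false)
  | north, q => ((q.1, q.2 - 1), true)
  | west, q => (q, false)
  | south, q => (q, true)

end Dir

/-- The directed edge entering the site `a.1` in the direction `a.2` has `K` on its left and the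
complement of `K` on its right. -/
def BoundaryEdge (K : Set Site) (a : Site × Dir) : Prop :=
  a.2.leftBehind a.1 ∈ K ∧ a.2.rightBehind a.1 ∉ K

open Classical in
/-- The direction in which the boundary of `K`, kept on the left, continues. -/
noncomputable def turn (K : Set Site) (a : Site × Dir) : Dir :=
  if a.2.rightAhead a.1 ∈ K then a.2.right
  else if a.2.leftAhead a.1 ∈ K then a.2 else a.2.left

/-- The next directed edge of the boundary of `K`. -/
noncomputable def nextEdge (K : Set Site) (a : Site × Dir) : Site × Dir :=
  (a.1 + (turn K a).vec, turn K a)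

lemma turn_cases (K : Set Site) (a : Site × Dir) :
    (a.2.rightAhead a.1 ∈ K ∧ turn K a = a.2.right) ∨
    (a.2.rightAhead a.1 ∉ K ∧ a.2.leftAhead a.1 ∈ K ∧ turn K a = a.2) ∨
    (a.2.rightAhead a.1 ∉ K ∧ a.2.leftAhead a.1 ∉ K ∧ turn K a = a.2.left) := by
  unfold turn
  split_ifs with h1 h2 <;> tauto

/-- In each of the three cases of `turn`, the faces beside the new edge are two of the four faces
around the site whose membership in `K` has just been decided. -/
lemma BoundaryEdge.nextEdge {K : Set Site} {a : Site × Dir} (h : BoundaryEdge K a) :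
    BoundaryEdge K (nextEdge K a) := by
  obtain ⟨⟨x, y⟩, d⟩ := a
  unfold BoundaryEdge at h
  unfold BoundaryEdge BondPerc.nextEdge
  rcases turn_cases K ((x, y), d) with ⟨h1, ht⟩ | ⟨h1, h2, ht⟩ | ⟨h1, h2, ht⟩ <;> rw [ht] <;>
    clear ht <;> cases d <;>
    simp_all [Dir.rightAhead, Dir.leftAhead, Dir.rightBehind, Dir.left, Dir.right,
      Dir.leftBehind, Dir.vec, sub_eq_add_neg]

/-- The outgoing direction and the four faces around the site determine the incoming direction:
where two diagonal faces of `K` meet, both passages turn right, so they touch without merging. -/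
lemma nextEdge_injOn (K : Set Site) {a b : Site × Dir} (ha : BoundaryEdge K a)
    (hb : BoundaryEdge K b) (h : nextEdge K a = nextEdge K b) : a = b := by
  obtain ⟨q, d⟩ := a
  obtain ⟨q', d'⟩ := b
  have h2 : turn K (q, d) = turn K (q', d') := congrArg Prod.snd h
  have h1 : q = q' := by
    have := congrArg Prod.fst h
    simp only [nextEdge, h2] at this
    exact add_right_cancel this
  subst h1
  unfold BoundaryEdge at ha hb
  unfold turn at h2
  cases d <;> cases d' <;> simp only [Dir.rightAhead, Dir.leftAhead, Dir.rightBehind, Dir.left,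
    Dir.right, Dir.leftBehind] at ha hb h2 ⊢ <;> split_ifs at h2 <;> simp_all

/-- A bond can be traversed in two directions, but only one of them has `K` on the left. -/
lemma inBond_injOn (K : Set Site) {a b : Site × Dir} (ha : BoundaryEdge K a)
    (hb : BoundaryEdge K b) (h : a.2.inBond a.1 = b.2.inBond b.1) : a = b := by
  obtain ⟨⟨x, y⟩, d⟩ := a
  obtain ⟨⟨x', y'⟩, d'⟩ := b
  unfold BoundaryEdge at ha hb
  cases d <;> cases d' <;> simp only [Dir.rightBehind, Dir.left, Dir.leftBehind, Dir.inBond,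
    Prod.mk.injEq] at ha hb h ⊢ <;> simp at h ⊢ <;> obtain ⟨rfl, rfl⟩ := h <;> simp_all

lemma BoundaryEdge.inBond_mem {K : Set Site} {a : Site × Dir} (h : BoundaryEdge K a) :
    a.2.inBond a.1 ∈ edgeBoundary K := by
  obtain ⟨⟨x, y⟩, d⟩ := a
  unfold BoundaryEdge at h
  unfold edgeBoundary
  cases d <;> simp_all [Dir.rightBehind, Dir.left, Dir.leftBehind, Dir.inBond, Bond.dualSrc,
    Bond.dualTgt]

lemma inBond_joins (a : Site × Dir) : (a.2.inBond a.1).Joins (a.1 - a.2.vec) a.1 := by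
  obtain ⟨⟨x, y⟩, d⟩ := a
  cases d <;> simp [Bond.Joins, Dir.inBond, Dir.vec, Bond.src, Bond.tgt]

lemma turn_eq_self {K : Set Site} {a : Site × Dir} (ha : BoundaryEdge K a)
    (h : turn K a = a.2) : a.2.rightAhead a.1 ∉ K ∧ a.2.leftAhead a.1 ∈ K := by
  obtain ⟨q, d⟩ := a
  unfold turn at h
  split_ifs at h with h1 h2
  · cases d <;> simp [Dir.right] at h
  · exact ⟨h1, h2⟩
  · cases d <;> simp [Dir.left] at h

lemma finite_boundaryEdge {K : Set Site} (hK : K.Finite) : Finite {a // BoundaryEdge K a} := by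
  have := hK.to_subtype
  have : Finite Dir := Finite.of_injective
    (fun d : Dir => match d with | .east => (0 : Fin 4) | .north => 1 | .west => 2 | .south => 3)
    (by intro a b h; cases a <;> cases b <;> simp at h ⊢)
  refine Finite.of_injective
    (fun a : {a // BoundaryEdge K a} => ((⟨_, a.2.1⟩ : K), a.1.2)) ?_
  rintro ⟨⟨⟨x, y⟩, d⟩, ha⟩ ⟨⟨⟨x', y'⟩, d'⟩, ha'⟩ h
  simp only [Prod.mk.injEq, Subtype.mk.injEq] at h
  obtain ⟨h, rfl⟩ := h
  cases d <;> simp [Dir.leftBehind] at h ⊢ <;> exact h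

lemma exists_boundaryEdge {K : Set Site} (hK : K.Finite) (hne : K.Nonempty) :
    ∃ a, BoundaryEdge K a := by
  obtain ⟨u, hu, hmax⟩ := Set.exists_max_image K (fun u => u.1) hK hne
  refine ⟨((u.1 + 1, u.2 + 1), Dir.north), ?_, fun h => ?_⟩
  · simpa [Dir.leftBehind] using hu
  · have := hmax _ h
    simp [Dir.rightBehind, Dir.left, Dir.leftBehind] at this

/-- The orbit of a point under an injective self-map of a finite type, as a cyclic sequence. -/
lemma exists_cyclic_orbit {α : Type*} [Finite α] {g : α → α} (hg : Function.Injective g) (a : α) :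
    ∃ n : ℕ, 0 < n ∧ ∃ f : ZMod n → α, Function.Injective f ∧ ∀ i, f (i + 1) = g (f i) := by
  have hper : a ∈ Function.periodicPts g := hg.mem_periodicPts a
  have hpos := Function.minimalPeriod_pos_of_mem_periodicPts hper
  refine ⟨Function.minimalPeriod g a, hpos, ?_⟩
  have : NeZero (Function.minimalPeriod g a) := ⟨hpos.ne'⟩
  refine ⟨fun i => g^[i.val] a, fun i j h => ?_, fun i => ?_⟩
  · exact ZMod.val_injective _ (Function.iterate_injOn_Iio_minimalPeriod
      (ZMod.val_lt i) (ZMod.val_lt j) h)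
  · change g^[(i + 1).val] a = g (g^[i.val] a)
    rw [← Function.iterate_succ_apply' g, ← Function.iterate_mod_minimalPeriod_eq (n := i.val + 1),
      ZMod.val_add, ZMod.val_one_eq_one_mod, Nat.add_mod_mod]

/-- The circuits traced by the boundary of a finite set of faces. -/
lemma exists_circuit_subset_edgeBoundary {K : Set Site} (hK : K.Finite) (hne : K.Nonempty) :
    ∃ γ : Circuit, γ.bonds ⊆ edgeBoundary K := by
  have := finite_boundaryEdge hK
  obtain ⟨a₀, ha₀⟩ := exists_boundaryEdge hK hne
  let g : {a // BoundaryEdge K a} → {a // BoundaryEdge K a} := fun a => ⟨nextEdge K a, a.2.nextEdge⟩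
  have hg : Function.Injective g := fun a b h =>
    Subtype.ext (nextEdge_injOn K a.2 b.2 (congrArg Subtype.val h))
  obtain ⟨n, hn, f, hf, hstep⟩ := exists_cyclic_orbit hg ⟨a₀, ha₀⟩
  have htail : ∀ i, (f (i + 1)).1.1 - (f (i + 1)).1.2.vec = (f i).1.1 := by
    intro i
    rw [hstep]
    simp [g, nextEdge]
  have hprev : ∀ i, (f i).1.1 - (f i).1.2.vec = (f (i - 1)).1.1 := by
    intro i
    have := htail (i - 1)
    rwa [sub_add_cancel] at this
  have hdir : ∀ i, (f i).1.2 = turn K (f (i - 1)).1 := by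
    intro i
    have := hstep (i - 1)
    rw [sub_add_cancel] at this
    rw [this]
    rfl
  refine ⟨⟨n, hn, fun i => (f i).1.1 - (f i).1.2.vec, fun i => (f i).1.2.inBond (f i).1.1,
    fun i => ?_, fun i j h => ?_, ?_⟩, ?_⟩
  · rw [htail]
    exact inBond_joins _
  · exact hf (Subtype.ext (inBond_injOn K (f i).2 (f j).2 h))
  -- A straight passage has both left faces in `K` and both right faces outside. Two straight
  -- passages through one site therefore have the same direction, hence coincide.
  · rintro i j hij hsite ⟨h1, h2⟩
    have key : ∀ i, ((f (i + 1)).1.1 - (f (i + 1)).1.2.vec) - ((f i).1.1 - (f i).1.2.vec) =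
        ((f i).1.1 - (f i).1.2.vec) - ((f (i - 1)).1.1 - (f (i - 1)).1.2.vec) →
        turn K (f (i - 1)).1 = (f (i - 1)).1.2 := by
      intro i h
      rw [htail, hprev i] at h
      rw [← hprev i, sub_sub_cancel, hprev i, sub_sub_cancel] at h
      rw [← hdir]
      exact Dir.vec_injective h
    have hi := key i h1
    have hj := key j h2
    have hq : (f (i - 1)).1.1 = (f (j - 1)).1.1 := by rw [← hprev, ← hprev]; exact hsite
    obtain ⟨i1, i2⟩ := turn_eq_self (f (i - 1)).2 hi
    obtain ⟨j1, j2⟩ := turn_eq_self (f (j - 1)).2 hj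
    have hib := (f (i - 1)).2
    have hjb := (f (j - 1)).2
    apply hij
    have : f (i - 1) = f (j - 1) := by
      refine Subtype.ext (Prod.ext hq ?_)
      rw [hq] at i1 i2
      unfold BoundaryEdge at hib hjb
      rw [hq] at hib
      revert i1 i2 j1 j2 hib hjb
      cases (f (i - 1)).1.2 <;> cases (f (j - 1)).1.2 <;>
        simp [Dir.rightAhead, Dir.leftAhead, Dir.rightBehind, Dir.left, Dir.right,
          Dir.leftBehind] <;> tauto
    exact sub_left_injective (hf this)
  · rintro _ ⟨i, rfl⟩
    exact (f i).2.inBond_mem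

/-! ### Mod 2 potentials and the identification of the boundary with one circuit -/

/-- A finite set of bonds of even degree at every site is the boundary of a set of faces. -/
lemma exists_potential {b : Bond → ZMod 2} {N : ℤ} (hN : ∀ e : Bond, N ≤ e.1.2 → b e = 0)
    (heven : ∀ x y : ℤ, b ((x, y), false) + b ((x - 1, y), false) + b ((x, y), true) +
      b ((x, y - 1), true) = 0) :
    ∃ f : Site → ZMod 2, (∀ e : Bond, f e.dualSrc + f e.dualTgt = b e) ∧
      ∀ u : Site, N ≤ u.2 → f u = 0 := by
  -- The parity of the number of horizontal bonds of `b` met by the vertical ray going up from the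
  -- face `u`; above height `N` there are none.
  let f : Site → ZMod 2 := fun u => ∑ j ∈ Finset.range (N - u.2).toNat, b ((u.1, N - j), false)
  have hf0 : ∀ u : Site, N ≤ u.2 → f u = 0 := by
    intro u hu
    have : (N - u.2).toNat = 0 := by omega
    simp [f, this]
  have two : ∀ z : ZMod 2, z + z = 0 := CharTwo.add_self_eq_zero
  have hhor : ∀ x y : ℤ, f (x, y - 1) = f (x, y) + b ((x, y), false) := by
    intro x y
    rcases le_or_gt y N with h | h
    · have : (N - (y - 1)).toNat = (N - y).toNat + 1 := by omega
      simp only [f, this, Finset.sum_range_succ]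
      congr 4
      omega
    · rw [hf0 _ (by simp; omega), hf0 _ (by simp; omega), hN _ (by simp; omega), add_zero]
  -- Downward induction from height `N`: the even degree at `(x, y + 1)` carries the jump across a
  -- vertical bond from level `y + 1` to level `y`.
  have hver : ∀ k : ℕ, ∀ x y : ℤ, (N - y).toNat = k → f (x - 1, y) + f (x, y) = b ((x, y), true) := by
    intro k
    induction k with
    | zero =>
      intro x y h
      rw [hf0 _ (by simp; omega), hf0 _ (by simp; omega), hN _ (by simp; omega), add_zero]
    | succ k ih =>
      intro x y h
      have h1 := ih x (y + 1) (by omega)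
      have h2 := hhor x (y + 1)
      have h3 := hhor (x - 1) (y + 1)
      have h4 := heven x (y + 1)
      rw [add_sub_cancel_right] at h2 h3 h4
      rw [h2, h3]
      linear_combination h1 + h4 - two (b ((x, y), true))
  refine ⟨f, ?_, hf0⟩
  rintro ⟨⟨x, y⟩, _ | _⟩
  · simp only [Bond.dualSrc, Bond.dualTgt, Bool.false_eq_true, if_false]
    rw [hhor]
    linear_combination two (f (x, y))
  · simpa [Bond.dualSrc, Bond.dualTgt] using hver _ x y rfl

open Classical in
/-- The potential of a circuit. -/
lemma Circuit.exists_potential (γ : Circuit) :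
    ∃ (f : Site → ZMod 2) (N : ℤ),
      (∀ e : Bond, f e.dualSrc + f e.dualTgt = if e ∈ γ.bonds then 1 else 0) ∧
      ∀ u : Site, N ≤ u.2 → f u = 0 := by
  have : NeZero γ.len := ⟨γ.len_pos.ne'⟩
  let b : Bond → ZMod 2 := fun e => ∑ i, if γ.bond i = e then 1 else 0
  have hb : ∀ e, b e = if e ∈ γ.bonds then 1 else 0 := by
    intro e
    split_ifs with h
    · obtain ⟨i, rfl⟩ := h
      simp only [b, γ.bond_injective.eq_iff, Finset.sum_ite_eq', Finset.mem_univ, if_true]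
    · refine Finset.sum_eq_zero fun i _ => if_neg fun hi => h ⟨i, hi⟩
  have hfin : γ.bonds.Finite := Set.finite_range _
  obtain ⟨N, hN⟩ : ∃ N : ℤ, ∀ e : Bond, N ≤ e.1.2 → b e = 0 := by
    obtain ⟨M, hM⟩ := (hfin.image fun e => e.1.2).bddAbove
    refine ⟨M + 1, fun e he => ?_⟩
    rw [hb, if_neg]
    intro h
    have h1 : e.1.2 ≤ M := hM ⟨e, h, rfl⟩
    omega
  have heven : ∀ x y : ℤ, b ((x, y), false) + b ((x - 1, y), false) + b ((x, y), true) +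
      b ((x, y - 1), true) = 0 := by
    intro x y
    -- The degree at `(x, y)` counts bond ends: each index contributes its initial and its final
    -- site. Around the cycle both counts agree, so the total is even.
    have h1 : ∀ i, ((if γ.bond i = ((x, y), false) then 1 else 0) +
        (if γ.bond i = ((x - 1, y), false) then 1 else 0) +
        (if γ.bond i = ((x, y), true) then 1 else 0) +
        (if γ.bond i = ((x, y - 1), true) then 1 else 0) : ZMod 2) =
        (if γ.site i = (x, y) then 1 else 0) + (if γ.site (i + 1) = (x, y) then 1 else 0) := by
      intro i
      have key : ∀ e : Bond, ((if e = ((x, y), false) then 1 else 0) +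
          (if e = ((x - 1, y), false) then 1 else 0) + (if e = ((x, y), true) then 1 else 0) +
          (if e = ((x, y - 1), true) then 1 else 0) : ZMod 2) =
          (if e.src = (x, y) then 1 else 0) + (if e.tgt = (x, y) then 1 else 0) := by
        rintro ⟨⟨p, q⟩, _ | _⟩
        · simp [Bond.src, Bond.tgt, eq_sub_iff_add_eq]
        · simp [Bond.src, Bond.tgt, eq_sub_iff_add_eq]
      rcases γ.joins i with ⟨h, h'⟩ | ⟨h, h'⟩
      · rw [key, h, h']
      · rw [key, h, h', add_comm]
    have h2 : ∑ i, (if γ.site (i + 1) = (x, y) then 1 else 0 : ZMod 2) =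
        ∑ i, if γ.site i = (x, y) then 1 else 0 :=
      Equiv.sum_comp (Equiv.addRight (1 : ZMod γ.len)) fun i => if γ.site i = (x, y) then (1 : ZMod 2) else 0
    simp only [b]
    rw [← Finset.sum_add_distrib, ← Finset.sum_add_distrib, ← Finset.sum_add_distrib,
      Finset.sum_congr rfl fun i _ => h1 i, Finset.sum_add_distrib, h2]
    exact CharTwo.add_self_eq_zero _
  obtain ⟨f, hf, hf0⟩ := BondPerc.exists_potential hN heven
  exact ⟨f, N, fun e => (hf e).trans (hb e), hf0⟩

lemma DualAdj.exists_bond {K : Set Site} {u v : Site} (h : DualAdj u v) (hu : u ∈ K) (hv : v ∈ K) :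
    ∃ e : Bond, e.DualJoins u v ∧ e ∉ edgeBoundary K := by
  obtain ⟨e, he⟩ := h
  refine ⟨e, he, fun hb => hb ?_⟩
  rcases he with ⟨h1, h2⟩ | ⟨h1, h2⟩ <;> simp [h1, h2, hu, hv]

lemma edgeBoundary_compl (K : Set Site) : edgeBoundary Kᶜ = edgeBoundary K := by
  ext e
  simp only [edgeBoundary, Set.mem_compl_iff, Set.mem_ofPred_eq, not_iff_not]

/-- The boundary of a finite connected set of faces with connected complement is a circuit. -/
lemma exists_circuit_bonds_eq {K : Set Site} (hK : K.Finite) (hne : K.Nonempty)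
    (hconn : DualConnected K) (hconn' : DualConnected Kᶜ) :
    ∃ γ : Circuit, γ.bonds = edgeBoundary K := by
  classical
  obtain ⟨γ, hγ⟩ := exists_circuit_subset_edgeBoundary hK hne
  refine ⟨γ, hγ.antisymm ?_⟩
  obtain ⟨f, N, hf, hf0⟩ := γ.exists_potential
  have two : ∀ z : ZMod 2, z + z = 0 := CharTwo.add_self_eq_zero
  -- The potential jumps only across bonds of `γ`, all of which lie in the boundary of `K`; so it is
  -- constant on `K` and on its complement.
  have hconst : ∀ L : Set Site, edgeBoundary L = edgeBoundary K → ∀ u ∈ L, ∀ v,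
      ConnectedIn L u v → f u = f v := by
    intro L hL u hu v h
    induction h with
    | refl => rfl
    | @tail v w hv hs ih =>
      obtain ⟨e, he, hne⟩ := hs.2.exists_bond (ConnectedIn.mem hv hu) hs.1
      have h0 := hf e
      rw [if_neg fun h => hne (hL ▸ hγ h)] at h0
      rw [ih]
      rcases he with ⟨rfl, rfl⟩ | ⟨rfl, rfl⟩
      · linear_combination h0 - two (f e.dualTgt)
      · linear_combination h0 - two (f e.dualSrc)
  have hout : ∃ v ∈ Kᶜ, f v = 0 := by
    obtain ⟨M, hM⟩ := (hK.image fun u => u.2).bddAbove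
    refine ⟨(0, max (M + 1) N), fun h => ?_, hf0 _ (le_max_right _ _)⟩
    have h1 := hM ⟨_, h, rfl⟩
    have h2 := le_max_left (M + 1) N
    simp only at h1
    omega
  obtain ⟨v₀, hv₀, hfv₀⟩ := hout
  have hKc : ∀ v ∈ Kᶜ, f v = 0 := fun v hv =>
    (hconst Kᶜ (edgeBoundary_compl K) v hv v₀ (hconn' v hv v₀ hv₀)).trans hfv₀
  -- The circuit has at least one bond, across which the potential jumps from 0 outside to 1 inside.
  -- Hence it jumps across every boundary bond of `K`, and all of them belong to `γ`.
  have hK1 : ∀ u ∈ K, f u = 1 := by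
    let e := γ.bond 0
    have he := hf e
    have hmem : e ∈ γ.bonds := ⟨0, rfl⟩
    rw [if_pos hmem] at he
    have hb : ¬ (e.dualSrc ∈ K ↔ e.dualTgt ∈ K) := hγ hmem
    intro u hu
    by_cases hs : e.dualSrc ∈ K
    · have ht : e.dualTgt ∈ Kᶜ := fun ht => hb ⟨fun _ => ht, fun _ => hs⟩
      rw [hKc _ ht, add_zero] at he
      rw [← he]
      exact hconst K rfl u hu _ (hconn u hu _ hs)
    · have ht : e.dualTgt ∈ K := by tauto
      rw [hKc _ hs, zero_add] at he
      rw [← he]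
      exact hconst K rfl u hu _ (hconn u hu _ ht)
  intro e he
  by_contra hne
  have h := hf e
  rw [if_neg hne] at h
  have he : ¬ (e.dualSrc ∈ K ↔ e.dualTgt ∈ K) := he
  by_cases hs : e.dualSrc ∈ K
  · have ht : e.dualTgt ∈ Kᶜ := fun ht => he ⟨fun _ => ht, fun _ => hs⟩
    rw [hK1 _ hs, hKc _ ht] at h
    exact absurd h (by decide)
  · have ht : e.dualTgt ∈ K := by tauto
    rw [hK1 _ ht, hKc _ hs] at h
    exact absurd h (by decide)

/-! ## Interior and exterior of the boundary circuit -/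

lemma mem_segment_horizontal {x y : ℤ} {p : Plane} :
    p ∈ _root_.segment ℝ (toPlane (x, y)) (toPlane (x + 1, y)) ↔
      p 1 = y ∧ (x : ℝ) ≤ p 0 ∧ p 0 ≤ x + 1 := by
  rw [segment_eq_image']
  constructor
  · rintro ⟨t, ⟨h0, h1⟩, rfl⟩
    simp only [toPlane, PiLp.add_apply, PiLp.smul_apply, PiLp.sub_apply]
    simp [h0, h1]
  · rintro ⟨h, h0, h1⟩
    refine ⟨p 0 - x, ⟨by linarith, by linarith⟩, ?_⟩
    ext i
    fin_cases i <;> simp [toPlane, h]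

lemma mem_segment_vertical {x y : ℤ} {p : Plane} :
    p ∈ _root_.segment ℝ (toPlane (x, y)) (toPlane (x, y + 1)) ↔
      p 0 = x ∧ (y : ℝ) ≤ p 1 ∧ p 1 ≤ y + 1 := by
  rw [segment_eq_image']
  constructor
  · rintro ⟨t, ⟨h0, h1⟩, rfl⟩
    simp only [toPlane, PiLp.add_apply, PiLp.smul_apply, PiLp.sub_apply]
    simp [h0, h1]
  · rintro ⟨h, h0, h1⟩
    refine ⟨p 1 - y, ⟨by linarith, by linarith⟩, ?_⟩
    ext i
    fin_cases i <;> simp [toPlane, h]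

lemma openSegment_horizontal {x y : ℤ} {p : Plane}
    (hp : p ∈ openSegment ℝ (toPlane (x, y)) (toPlane (x + 1, y))) :
    p 1 = y ∧ (x : ℝ) < p 0 ∧ p 0 < x + 1 := by
  rw [openSegment_eq_image'] at hp
  obtain ⟨t, ⟨h0, h1⟩, rfl⟩ := hp
  simp only [toPlane, PiLp.add_apply, PiLp.smul_apply, PiLp.sub_apply]
  simp [h0, h1]

lemma openSegment_vertical {x y : ℤ} {p : Plane}
    (hp : p ∈ openSegment ℝ (toPlane (x, y)) (toPlane (x, y + 1))) :
    p 0 = x ∧ (y : ℝ) < p 1 ∧ p 1 < y + 1 := by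
  rw [openSegment_eq_image'] at hp
  obtain ⟨t, ⟨h0, h1⟩, rfl⟩ := hp
  simp only [toPlane, PiLp.add_apply, PiLp.smul_apply, PiLp.sub_apply]
  simp [h0, h1]

lemma int_lt_add_one {a b : ℤ} {t : ℝ} (h1 : (a : ℝ) ≤ t) (h2 : t < b + 1) : a < b + 1 := by
  exact_mod_cast h1.trans_lt h2

lemma int_lt_add_one' {a b : ℤ} {t : ℝ} (h1 : (a : ℝ) < t) (h2 : t ≤ b + 1) : a < b + 1 := by
  exact_mod_cast h1.trans_le h2

/-- A bond as a closed segment. -/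
def Bond.closedSegment (e : Bond) : Set Plane := _root_.segment ℝ (toPlane e.src) (toPlane e.tgt)

lemma Circuit.mem_trace {γ : Circuit} {p : Plane} :
    p ∈ γ.trace ↔ ∃ e ∈ γ.bonds, p ∈ e.closedSegment := by
  simp only [Circuit.trace, Set.mem_iUnion, Circuit.bonds, Set.mem_range, exists_exists_eq_and,
    Bond.closedSegment]

lemma int_not_between {a b : ℤ} (h1 : (a : ℝ) < b) (h2 : (b : ℝ) < a + 1) : False := by
  have h1' : a < b := by exact_mod_cast h1
  have h2' : b < a + 1 := by exact_mod_cast h2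
  omega

/-- A point of an open unit segment has one integer and one non-integer coordinate, which determine
the bond. -/
lemma Bond.eq_of_mem_segments {e f : Bond} {p : Plane} (he : p ∈ e.segment)
    (hf : p ∈ f.closedSegment) : f = e := by
  obtain ⟨⟨x, y⟩, b⟩ := e
  obtain ⟨⟨x', y'⟩, b'⟩ := f
  cases b <;> cases b' <;> simp only [Bond.segment, Bond.closedSegment, Bond.src, Bond.tgt,
    Bool.false_eq_true, if_false, if_true] at he hf
  · obtain ⟨h1, h2, h3⟩ := openSegment_horizontal he
    obtain ⟨h4, h5, h6⟩ := mem_segment_horizontal.1 hf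
    have hy : y' = y := Int.cast_injective (α := ℝ) (h4.symm.trans h1)
    have h7 : x' < x + 1 := int_lt_add_one h5 h3
    have h8 : x < x' + 1 := int_lt_add_one' h2 h6
    have hx : x' = x := by omega
    rw [hx, hy]
  · obtain ⟨h1, h2, h3⟩ := openSegment_horizontal he
    obtain ⟨h4, h5, h6⟩ := mem_segment_vertical.1 hf
    rw [h4] at h2 h3
    exact (int_not_between h2 h3).elim
  · obtain ⟨h1, h2, h3⟩ := openSegment_vertical he
    obtain ⟨h4, h5, h6⟩ := mem_segment_horizontal.1 hf
    rw [h4] at h2 h3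
    exact (int_not_between h2 h3).elim
  · obtain ⟨h1, h2, h3⟩ := openSegment_vertical he
    obtain ⟨h4, h5, h6⟩ := mem_segment_vertical.1 hf
    have hy : x' = x := Int.cast_injective (α := ℝ) (h4.symm.trans h1)
    have h7 : y' < y + 1 := int_lt_add_one h5 h3
    have h8 : y < y' + 1 := int_lt_add_one' h2 h6
    have hx : y' = y := by omega
    rw [hx, hy]

/-- The closed unit square named by `u`. -/
def face (u : Site) : Set Plane :=
  {p | ((u.1 : ℝ) ≤ p 0 ∧ p 0 ≤ u.1 + 1) ∧ ((u.2 : ℝ) ≤ p 1 ∧ p 1 ≤ u.2 + 1)}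

lemma isClosed_face (u : Site) : IsClosed (face u) := by
  have h0 : Continuous fun p : Plane => p 0 := by fun_prop
  have h1 : Continuous fun p : Plane => p 1 := by fun_prop
  exact ((isClosed_le continuous_const h0).inter (isClosed_le h0 continuous_const)).inter
    ((isClosed_le continuous_const h1).inter (isClosed_le h1 continuous_const))

lemma exists_mem_face (p : Plane) : ∃ u, p ∈ face u :=
  ⟨(⌊p 0⌋, ⌊p 1⌋), ⟨Int.floor_le _, (Int.lt_floor_add_one _).le⟩,
    ⟨Int.floor_le _, (Int.lt_floor_add_one _).le⟩⟩

lemma norm_le_abs_add_abs (p : Plane) : ‖p‖ ≤ |p 0| + |p 1| := by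
  rw [EuclideanSpace.norm_eq, Real.sqrt_le_left (by positivity)]
  simp only [Fin.sum_univ_two, Real.norm_eq_abs]
  nlinarith [abs_nonneg (p 0), abs_nonneg (p 1)]

lemma isBounded_face (u : Site) : Bornology.IsBounded (face u) := by
  rw [isBounded_iff_forall_norm_le]
  refine ⟨(|(u.1 : ℝ)| + 1) + (|(u.2 : ℝ)| + 1), fun p hp => (norm_le_abs_add_abs p).trans ?_⟩
  obtain ⟨⟨h1, h2⟩, h3, h4⟩ := hp
  refine add_le_add ?_ ?_ <;> rw [abs_le] <;> constructor
  · linarith [neg_abs_le (u.1 : ℝ)]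
  · linarith [le_abs_self (u.1 : ℝ)]
  · linarith [neg_abs_le (u.2 : ℝ)]
  · linarith [le_abs_self (u.2 : ℝ)]

/-- Local finiteness makes `region K` closed even when `K` is infinite, as is needed for complements
of finite sets. -/
lemma locallyFinite_face : LocallyFinite face := by
  intro p
  refine ⟨Metric.ball p 1, Metric.ball_mem_nhds p one_pos, ?_⟩
  refine (Set.finite_Icc ((⌊p 0⌋ - 2, ⌊p 1⌋ - 2) : Site) (⌊p 0⌋ + 2, ⌊p 1⌋ + 2)).subset ?_
  rintro u ⟨q, ⟨⟨h1, h2⟩, h3, h4⟩, hq⟩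
  rw [Metric.mem_ball, dist_eq_norm] at hq
  have hc : ∀ i, |q i - p i| < 1 := fun i => by
    have := PiLp.norm_apply_le (q - p) i
    rw [PiLp.sub_apply, Real.norm_eq_abs] at this
    exact this.trans_lt hq
  have a0 := abs_lt.1 (hc 0)
  have a1 := abs_lt.1 (hc 1)
  have b0 := Int.floor_le (p 0)
  have b1 := Int.floor_le (p 1)
  have c0 := Int.lt_floor_add_one (p 0)
  have c1 := Int.lt_floor_add_one (p 1)
  have d1 : (u.1 : ℝ) < ((⌊p 0⌋ + 2 : ℤ) : ℝ) := by push_cast; linarith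
  have d2 : ((⌊p 0⌋ : ℤ) : ℝ) < ((u.1 + 2 : ℤ) : ℝ) := by push_cast; linarith
  have d3 : (u.2 : ℝ) < ((⌊p 1⌋ + 2 : ℤ) : ℝ) := by push_cast; linarith
  have d4 : ((⌊p 1⌋ : ℤ) : ℝ) < ((u.2 + 2 : ℤ) : ℝ) := by push_cast; linarith
  rw [Int.cast_lt] at d1 d2 d3 d4
  refine ⟨⟨?_, ?_⟩, ?_, ?_⟩ <;> simp only <;> omega

/-- The union of the closed squares of `K`. -/
def region (K : Set Site) : Set Plane := ⋃ u : K, face u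

lemma mem_region {K : Set Site} {p : Plane} : p ∈ region K ↔ ∃ u ∈ K, p ∈ face u := by
  simp [region]

lemma isClosed_region (K : Set Site) : IsClosed (region K) :=
  (locallyFinite_face.comp_injective Subtype.val_injective).isClosed_iUnion
    fun u => isClosed_face u

lemma mem_closedSegment_of_faces {K : Set Site} {u v : Site} (hu : u ∈ K) (hv : v ∉ K)
    (h1 : u.1 = v.1 ∧ (u.2 = v.2 + 1 ∨ v.2 = u.2 + 1) ∨
      u.2 = v.2 ∧ (u.1 = v.1 + 1 ∨ v.1 = u.1 + 1)) {p : Plane} (hpu : p ∈ face u)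
    (hpv : p ∈ face v) : ∃ e ∈ edgeBoundary K, p ∈ e.closedSegment := by
  obtain ⟨a, b⟩ := u
  obtain ⟨c, d⟩ := v
  obtain ⟨⟨p1, p2⟩, p3, p4⟩ := hpu
  obtain ⟨⟨q1, q2⟩, q3, q4⟩ := hpv
  simp only at h1 p1 p2 p3 p4 q1 q2 q3 q4
  rcases h1 with ⟨rfl, rfl | rfl⟩ | ⟨rfl, rfl | rfl⟩
  · refine ⟨((a, d + 1), false), ?_, mem_segment_horizontal.2 ⟨?_, p1, p2⟩⟩
    · simp [edgeBoundary, Bond.dualSrc, Bond.dualTgt, hu, hv]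
    · push_cast at p3 ⊢; linarith
  · refine ⟨((a, b + 1), false), ?_, mem_segment_horizontal.2 ⟨?_, p1, p2⟩⟩
    · simp [edgeBoundary, Bond.dualSrc, Bond.dualTgt, hu, hv]
    · push_cast at q3 ⊢; linarith
  · refine ⟨((c + 1, b), true), ?_, mem_segment_vertical.2 ⟨?_, p3, p4⟩⟩
    · simp [edgeBoundary, Bond.dualSrc, Bond.dualTgt, hu, hv]
    · push_cast at p1 ⊢; linarith
  · refine ⟨((a + 1, b), true), ?_, mem_segment_vertical.2 ⟨?_, p3, p4⟩⟩
    · simp [edgeBoundary, Bond.dualSrc, Bond.dualTgt, hu, hv]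
    · push_cast at q1 ⊢; linarith

/-- If `p` lies in squares `u` of `K` and `v` off `K`, it also lies in the square `(u.1, v.2)`,
which shares a side or coincides with each of them. One of the two steps crosses the boundary of
`K`, and `p` is on the common side. -/
lemma region_inter_region_compl {K : Set Site} {p : Plane} (h1 : p ∈ region K)
    (h2 : p ∈ region Kᶜ) : ∃ e ∈ edgeBoundary K, p ∈ e.closedSegment := by
  obtain ⟨u, hu, hpu⟩ := mem_region.1 h1
  obtain ⟨v, hv, hpv⟩ := mem_region.1 h2
  have hpw : p ∈ face (u.1, v.2) := ⟨hpu.1, hpv.2⟩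
  have hd : ∀ {a b : ℤ} {t : ℝ}, (a : ℝ) ≤ t ∧ t ≤ a + 1 → (b : ℝ) ≤ t ∧ t ≤ b + 1 →
      a ≠ b → a = b + 1 ∨ b = a + 1 := by
    intro a b t ha hb hab
    have i1 : a ≤ b + 1 := by exact_mod_cast ha.1.trans hb.2
    have i2 : b ≤ a + 1 := by exact_mod_cast hb.1.trans ha.2
    omega
  by_cases hw : (u.1, v.2) ∈ K
  · refine mem_closedSegment_of_faces hw hv (.inr ⟨rfl, hd hpu.1 hpv.1 ?_⟩) hpw hpv
    intro h
    exact hv (by rwa [show v = (u.1, v.2) from Prod.ext h.symm rfl])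
  · refine mem_closedSegment_of_faces hu hw (.inl ⟨rfl, hd hpu.2 hpv.2 ?_⟩) hpu hpw
    intro h
    exact hw (by rwa [show (u.1, v.2) = u from Prod.ext rfl h.symm])

lemma Bond.segment_subset_face {e : Bond} {p : Plane} (hp : p ∈ e.segment) : p ∈ face e.dualTgt := by
  obtain ⟨⟨x, y⟩, _ | _⟩ := e <;>
    simp only [Bond.segment, Bond.src, Bond.tgt, Bool.false_eq_true, if_false, if_true] at hp
  · obtain ⟨h1, h2, h3⟩ := openSegment_horizontal hp
    refine ⟨⟨h2.le, h3.le⟩, h1.ge, ?_⟩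
    change p 1 ≤ (y : ℝ) + 1
    linarith
  · obtain ⟨h1, h2, h3⟩ := openSegment_vertical hp
    refine ⟨⟨h1.ge, ?_⟩, h2.le, h3.le⟩
    change p 0 ≤ (x : ℝ) + 1
    linarith

/-- The bonds both of whose adjacent faces belong to `K`. -/
def innerBonds (K : Set Site) : Set Bond := {e | e.dualSrc ∈ K ∧ e.dualTgt ∈ K}

lemma disjoint_innerBonds_edgeBoundary {K : Set Site} {e : Bond} (he : e ∈ innerBonds K) :
    e ∉ edgeBoundary K := fun h => h ⟨fun _ => he.2, fun _ => he.1⟩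

lemma Circuit.notMem_trace {γ : Circuit} {e : Bond} (he : e ∉ γ.bonds) {p : Plane}
    (hp : p ∈ e.segment) : p ∉ γ.trace := by
  intro h
  obtain ⟨f, hf, hpf⟩ := Circuit.mem_trace.1 h
  exact he (Bond.eq_of_mem_segments hp hpf ▸ hf)

/-- The closed regions of `K` and of its complement cover the plane and meet only on the circuit. A
connected set off the circuit that meets the bounded region of `K` therefore stays inside it. -/
lemma Circuit.innerBonds_subset_interior {γ : Circuit} {K : Set Site} (hK : K.Finite)
    (hγ : γ.bonds = edgeBoundary K) : innerBonds K ⊆ bondsInRegion γ.interior := by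
  intro e he p hp
  have hpt : p ∈ γ.traceᶜ := Circuit.notMem_trace (hγ ▸ disjoint_innerBonds_edgeBoundary he) hp
  refine ⟨hpt, ?_⟩
  have hbdd : Bornology.IsBounded (region K) := by
    have := hK.to_subtype
    exact Bornology.isBounded_iUnion.2 fun u => isBounded_face u
  refine hbdd.subset fun q hq => ?_
  by_contra hqK
  have hconn : IsPreconnected (connectedComponentIn γ.traceᶜ p) := isPreconnected_connectedComponentIn
  have hcov : ∀ z, z ∈ region K ∨ z ∈ region Kᶜ := by
    intro z
    obtain ⟨u, hu⟩ := exists_mem_face z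
    by_cases h : u ∈ K
    · exact .inl (mem_region.2 ⟨u, h, hu⟩)
    · exact .inr (mem_region.2 ⟨u, h, hu⟩)
  obtain ⟨z, hz, hz1, hz2⟩ := isPreconnected_closed_iff.1 hconn (region K) (region Kᶜ)
    (isClosed_region _) (isClosed_region _) (fun z _ => hcov z)
    ⟨p, mem_connectedComponentIn hpt, mem_region.2 ⟨_, he.2, Bond.segment_subset_face hp⟩⟩
    ⟨q, hq, (hcov q).resolve_left hqK⟩
  obtain ⟨f, hf, hzf⟩ := region_inter_region_compl hz1 hz2
  exact connectedComponentIn_subset _ _ hz (Circuit.mem_trace.2 ⟨f, hγ ▸ hf, hzf⟩)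

/-- The centre of a face. -/
noncomputable def faceCentre (u : Site) : Plane := !₂[(u.1 : ℝ) + 1 / 2, (u.2 : ℝ) + 1 / 2]

lemma notMem_closedSegment_of_interior {u : Site} {p : Plane} (h1 : (u.1 : ℝ) < p 0)
    (h2 : p 0 < u.1 + 1) (h3 : (u.2 : ℝ) < p 1) (h4 : p 1 < u.2 + 1) (e : Bond) :
    p ∉ e.closedSegment := by
  intro h
  obtain ⟨⟨x, y⟩, _ | _⟩ := e <;>
    simp only [Bond.closedSegment, Bond.src, Bond.tgt, Bool.false_eq_true, if_false, if_true] at h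
  · have h := (mem_segment_horizontal.1 h).1
    rw [h] at h3 h4
    exact int_not_between h3 h4
  · have h := (mem_segment_vertical.1 h).1
    rw [h] at h1 h2
    exact int_not_between h1 h2

/-- Beyond its starting point the segment runs in the open square, which meets no bond. -/
lemma segment_faceCentre_subset {γ : Circuit} {e : Bond} (he : e ∉ γ.bonds) {p : Plane}
    (hp : p ∈ e.segment) {u : Site} (hu : e.dualSrc = u ∨ e.dualTgt = u) :
    _root_.segment ℝ p (faceCentre u) ⊆ γ.traceᶜ := by
  rw [segment_eq_image']
  rintro _ ⟨t, ⟨h0, h1⟩, rfl⟩ ht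
  rcases h0.eq_or_lt with rfl | h0
  · simp only [zero_smul, add_zero] at ht
    exact Circuit.notMem_trace he hp ht
  · obtain ⟨f, -, hf⟩ := Circuit.mem_trace.1 ht
    have c0 : (p + t • (faceCentre u - p)) 0 = p 0 + t * (u.1 + 1 / 2 - p 0) := by
      simp [faceCentre]
    have c1 : (p + t • (faceCentre u - p)) 1 = p 1 + t * (u.2 + 1 / 2 - p 1) := by
      simp [faceCentre]
    have hface : ((u.1 : ℝ) ≤ p 0 ∧ p 0 ≤ u.1 + 1) ∧ ((u.2 : ℝ) ≤ p 1 ∧ p 1 ≤ u.2 + 1) := by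
      obtain ⟨⟨x, y⟩, _ | _⟩ := e <;>
        simp only [Bond.segment, Bond.src, Bond.tgt, Bool.false_eq_true, if_false, if_true,
          Bond.dualSrc, Bond.dualTgt] at hp hu
      · obtain ⟨h1, h2, h3⟩ := openSegment_horizontal hp
        rcases hu with rfl | rfl <;> refine ⟨⟨h2.le, h3.le⟩, ?_, ?_⟩ <;> push_cast <;> linarith
      · obtain ⟨h1, h2, h3⟩ := openSegment_vertical hp
        rcases hu with rfl | rfl <;> refine ⟨⟨?_, ?_⟩, h2.le, h3.le⟩ <;> push_cast <;> linarith
    obtain ⟨⟨f1, f2⟩, f3, f4⟩ := hface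
    refine notMem_closedSegment_of_interior (u := u) ?_ ?_ ?_ ?_ f hf
    · rw [c0]; nlinarith
    · rw [c0]; nlinarith
    · rw [c1]; nlinarith
    · rw [c1]; nlinarith

lemma Bond.segment_nonempty (e : Bond) : e.segment.Nonempty := by
  rw [Bond.segment, openSegment_eq_image']
  exact ⟨_, 1 / 2, ⟨by norm_num, by norm_num⟩, rfl⟩

/-- A path of faces off `K` yields a chain of face centres in one component off the circuit.
Connectedness of the complement lets this chain reach arbitrarily far away. -/
lemma Circuit.innerBonds_compl_subset_exterior {γ : Circuit} {K : Set Site} (hK : K.Finite)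
    (hconn : DualConnected Kᶜ) (hγ : γ.bonds = edgeBoundary K) :
    innerBonds Kᶜ ⊆ bondsInRegion γ.exterior := by
  intro e he p hp
  have hnb : ∀ {e}, e ∈ innerBonds Kᶜ → e ∉ γ.bonds := fun he => by
    rw [hγ, ← edgeBoundary_compl]
    exact disjoint_innerBonds_edgeBoundary he
  have hpt : p ∈ γ.traceᶜ := Circuit.notMem_trace (hnb he) hp
  refine ⟨hpt, fun hb => ?_⟩
  have hstep : ∀ {e : Bond} {q : Plane} {u : Site}, e ∈ innerBonds Kᶜ → q ∈ e.segment →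
      (e.dualSrc = u ∨ e.dualTgt = u) →
      connectedComponentIn γ.traceᶜ q = connectedComponentIn γ.traceᶜ (faceCentre u) := by
    intro e q u he hq hu
    refine connectedComponentIn_eq ?_
    exact (convex_segment q (faceCentre u)).isPreconnected.subset_connectedComponentIn
      (left_mem_segment _ _ _) (segment_faceCentre_subset (hnb he) hq hu) (right_mem_segment _ _ _)
  have hall : ∀ v, ConnectedIn Kᶜ e.dualTgt v →
      connectedComponentIn γ.traceᶜ p = connectedComponentIn γ.traceᶜ (faceCentre v) := by
    intro v h
    induction h with
    | refl => exact hstep he hp (.inr rfl)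
    | @tail v w hv hs ih =>
      have hvK := ConnectedIn.mem hv he.2
      obtain ⟨f, hf⟩ := hs.2
      obtain ⟨q, hq⟩ := f.segment_nonempty
      have hfK : f ∈ innerBonds Kᶜ := by
        rcases hf with ⟨h1, h2⟩ | ⟨h1, h2⟩
        · exact ⟨h1 ▸ hvK, h2 ▸ hs.1⟩
        · exact ⟨h1 ▸ hs.1, h2 ▸ hvK⟩
      rw [ih, ← hstep (q := q) (u := v) hfK hq (hf.imp And.left And.right), hstep hfK hq]
      exact hf.symm.imp And.left And.right
  obtain ⟨M, hM⟩ := isBounded_iff_forall_norm_le.1 hb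
  obtain ⟨L, hL⟩ := (hK.image fun u => u.1).bddAbove
  -- To the right of all of `K`, and beyond the supposed bound `M` of the component.
  let a : ℤ := max (L + 1) (⌈M⌉ + 1)
  have haK : (a, 0) ∈ Kᶜ := fun h => by
    have h1 : a ≤ L := hL ⟨_, h, rfl⟩
    have h2 : L + 1 ≤ a := le_max_left _ _
    omega
  have hmem : faceCentre (a, 0) ∈ connectedComponentIn γ.traceᶜ p := by
    rw [hall _ (hconn _ he.2 _ haK)]
    refine mem_connectedComponentIn fun ht => ?_
    obtain ⟨f, -, hf⟩ := Circuit.mem_trace.1 ht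
    exact notMem_closedSegment_of_interior (u := (a, 0)) (by simp [faceCentre])
      (by simp [faceCentre]; norm_num) (by simp [faceCentre])
      (by simp [faceCentre]; norm_num) f hf
  have h1 := hM _ hmem
  have h2 := PiLp.norm_apply_le (faceCentre (a, 0)) 0
  have h3 : (faceCentre (a, 0)) 0 = (a : ℝ) + 1 / 2 := by simp [faceCentre]
  rw [h3, Real.norm_eq_abs] at h2
  have h4 := le_abs_self ((a : ℝ) + 1 / 2)
  have h5 : (⌈M⌉ + 1 : ℤ) ≤ a := le_max_right _ _
  have h6 : ((⌈M⌉ + 1 : ℤ) : ℝ) ≤ (a : ℝ) := by exact_mod_cast h5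
  push_cast at h6
  linarith [Int.le_ceil M]

/-- A finite set of faces containing a box has a long boundary. -/
lemma card_edgeBoundary_ge {K : Set Site} (hK : K.Finite) {u : Site} {n : ℕ}
    (hbox : ∀ v ∈ box u n, v ∈ K) {γ : Circuit} (hγ : γ.bonds = edgeBoundary K) :
    n ≤ γ.len := by
  have : NeZero γ.len := ⟨γ.len_pos.ne'⟩
  -- In each of `n` columns through the box, the bond above the top face of `K` is a boundary bond;
  -- different columns give different bonds.
  have hex : ∀ a : Fin n, ∃ i, (γ.bond i).1.1 = u.1 + a := by
    intro a
    have hmem : (u.1 + (a : ℤ), u.2) ∈ K := hbox _ (by simp [supDist])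
    obtain ⟨v, ⟨hv, hva⟩, hmax⟩ := Set.exists_max_image {v ∈ K | v.1 = u.1 + (a : ℤ)}
      (fun v => v.2) (hK.subset fun v hv => hv.1) ⟨_, hmem, rfl⟩
    have hb : (((v.1, v.2 + 1), false) : Bond) ∈ γ.bonds := by
      rw [hγ]
      intro h
      have h1 : ((v.1, v.2 + 1) : Site) ∈ K := by
        refine h.1 ?_
        simpa [Bond.dualSrc] using hv
      have := hmax _ ⟨h1, hva⟩
      simp at this
    obtain ⟨i, hi⟩ := hb
    exact ⟨i, by rw [hi]; exact hva⟩
  choose f hf using hex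
  have hinj : Function.Injective f := by
    intro a b h
    have h1 := hf a
    rw [h, hf b] at h1
    ext
    omega
  simpa [ZMod.card] using Fintype.card_le_of_injective f hinj

/-! ## Decoupling across open circuits -/

/-- The bound in the near-Markov property, for given constants. -/
def NearMarkovWith (P : Measure Config) (C a : ℝ) : Prop :=
  ∀ γ : Circuit, ∀ A B : Set Config,
    MeasurableSet[cylinderEvents (bondsInRegion γ.interior)] A →
    MeasurableSet[cylinderEvents (bondsInRegion γ.exterior)] B →
    0 < P (allOpen γ.bonds ∩ A) → 0 < P (allOpen γ.bonds ∩ B) →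
    |(P[|allOpen γ.bonds ∩ B]).real A / (P[|allOpen γ.bonds]).real A - 1| ≤
      C * Real.exp (-a * γ.len)

lemma cond_real_eq {P : Measure Config} {E : Set Config} (hE : MeasurableSet E) (F : Set Config) :
    (P[|E]).real F = (P.real E)⁻¹ * P.real (E ∩ F) := by
  rw [measureReal_def, cond_apply hE, ENNReal.toReal_mul, ENNReal.toReal_inv]
  rfl

lemma pos_of_measureReal_pos {P : Measure Config} {E : Set Config} (h : 0 < P.real E) : 0 < P E :=
  (ENNReal.toReal_pos_iff.1 h).1

variable {P : Measure Config} [IsProbabilityMeasure P]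

/-- The near-Markov bound cleared of denominators, so that it also holds for null events. -/
lemma NearMarkovWith.abs_sub_le {C a : ℝ} (h : NearMarkovWith P C a) (γ : Circuit)
    {A B : Set Config}
    (hA : MeasurableSet[cylinderEvents (bondsInRegion γ.interior)] A)
    (hB : MeasurableSet[cylinderEvents (bondsInRegion γ.exterior)] B) :
    |P.real (allOpen γ.bonds ∩ (A ∩ B)) * P.real (allOpen γ.bonds) -
      P.real (allOpen γ.bonds ∩ A) * P.real (allOpen γ.bonds ∩ B)| ≤
      C * Real.exp (-a * γ.len) *
        (P.real (allOpen γ.bonds ∩ A) * P.real (allOpen γ.bonds ∩ B)) := by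
  have : NeZero γ.len := ⟨γ.len_pos.ne'⟩
  set O := allOpen γ.bonds
  have hOm : MeasurableSet O := (determinedBy_allOpen _).measurableSet (Set.finite_range _)
  have hBm : MeasurableSet B := cylinderEvents_le_pi _ hB
  have hmono1 : P.real (O ∩ (A ∩ B)) ≤ P.real (O ∩ A) :=
    measureReal_mono (Set.inter_subset_inter_right _ Set.inter_subset_left)
  have hmono2 : P.real (O ∩ (A ∩ B)) ≤ P.real (O ∩ B) :=
    measureReal_mono (Set.inter_subset_inter_right _ Set.inter_subset_right)
  have h0 : 0 ≤ P.real (O ∩ (A ∩ B)) := measureReal_nonneg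
  rcases (measureReal_nonneg (μ := P) (s := O ∩ A)).eq_or_lt with hA0 | hA0
  · rw [← hA0] at hmono1 ⊢
    rw [le_antisymm hmono1 h0]; simp
  rcases (measureReal_nonneg (μ := P) (s := O ∩ B)).eq_or_lt with hB0 | hB0
  · rw [← hB0] at hmono2 ⊢
    rw [le_antisymm hmono2 h0]; simp
  have hO0 : 0 < P.real O := hA0.trans_le (measureReal_mono Set.inter_subset_left)
  have key := h γ A B hA hB (pos_of_measureReal_pos hA0) (pos_of_measureReal_pos hB0)
  rw [cond_real_eq (hOm.inter hBm), cond_real_eq hOm] at key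
  have e : O ∩ B ∩ A = O ∩ (A ∩ B) := by rw [Set.inter_assoc, Set.inter_comm B A]
  rw [e] at key
  have e2 : (P.real (O ∩ B))⁻¹ * P.real (O ∩ (A ∩ B)) / ((P.real O)⁻¹ * P.real (O ∩ A)) - 1 =
      (P.real (O ∩ (A ∩ B)) * P.real O - P.real (O ∩ A) * P.real (O ∩ B)) /
        (P.real (O ∩ A) * P.real (O ∩ B)) := by
    field_simp
  rw [e2, abs_div, abs_of_pos (mul_pos hA0 hB0), div_le_iff₀ (mul_pos hA0 hB0)] at key
  exact key

/-- Since exp(3δ) ≥ 1 + 3δ, it suffices that 3δ² ≤ δ; this is the origin of the bound 1/3 on all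
errors. -/
lemma one_add_le_exp_mul_one_sub {δ : ℝ} (h0 : 0 ≤ δ) (h1 : δ ≤ 1 / 3) :
    1 + δ ≤ Real.exp (3 * δ) * (1 - δ) := by
  have h := Real.add_one_le_exp (3 * δ)
  nlinarith

/-- Both `x * o ≈ g * b` and `x' * o ≈ g * b'` hold up to factors `1 ± δ`; the common `o` and `g`
drop out of their quotient. -/
lemma swap_of_abs_sub_le {o g b b' x x' δ : ℝ} (h0 : 0 ≤ δ) (h1 : δ ≤ 1 / 3) (hg : 0 ≤ g)
    (hb : 0 ≤ b) (hb' : 0 ≤ b') (hx : 0 ≤ x) (hx' : 0 ≤ x') (ho : 0 ≤ o) (hxo : x ≤ o)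
    (h : |x * o - g * b| ≤ δ * (g * b)) (h' : |x' * o - g * b'| ≤ δ * (g * b')) :
    x * b' ≤ Real.exp (3 * δ) * (b * x') := by
  rcases ho.eq_or_lt with rfl | ho
  · rw [le_antisymm hxo hx, zero_mul]
    positivity
  have i1 := (abs_le.1 h).2
  have i2 := (abs_le.1 h').1
  have e1 := one_add_le_exp_mul_one_sub h0 h1
  have e0 := Real.exp_pos (3 * δ)
  refine le_of_mul_le_mul_right ?_ ho
  calc x * b' * o = (x * o) * b' := by ring
    _ ≤ ((1 + δ) * (g * b)) * b' := mul_le_mul_of_nonneg_right (by linarith) hb'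
    _ = (1 + δ) * (g * b * b') := by ring
    _ ≤ (Real.exp (3 * δ) * (1 - δ)) * (g * b * b') := by gcongr
    _ = Real.exp (3 * δ) * b * ((1 - δ) * (g * b')) := by ring
    _ ≤ Real.exp (3 * δ) * b * (x' * o) := mul_le_mul_of_nonneg_left (by linarith) (by positivity)
    _ = Real.exp (3 * δ) * (b * x') * o := by ring

/-- An event on one side of an open circuit may be exchanged between events on the other side. -/
lemma NearMarkovWith.swap {C a δ : ℝ} (hC : 0 < C) (ha : 0 < a) (h : NearMarkovWith P C a)
    {H : Set Site} {n : ℕ} (hδ : C * Real.exp (-a * n) ≤ δ) (hδ' : δ ≤ 1 / 3)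
    (hfin : H.Finite ∨ Hᶜ.Finite) (hH : DualConnected H) (hH' : DualConnected Hᶜ) {u v : Site}
    (hu : ∀ w ∈ box u n, w ∈ H) (hv : ∀ w ∈ box v n, w ∈ Hᶜ) {G B B' : Set Config}
    (hG : MeasurableSet[cylinderEvents (innerBonds H)] G)
    (hB : MeasurableSet[cylinderEvents (innerBonds Hᶜ)] B)
    (hB' : MeasurableSet[cylinderEvents (innerBonds Hᶜ)] B') :
    P.real (allOpen (edgeBoundary H) ∩ (B ∩ G)) * P.real (allOpen (edgeBoundary H) ∩ B') ≤
      Real.exp (3 * δ) * (P.real (allOpen (edgeBoundary H) ∩ B) *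
        P.real (allOpen (edgeBoundary H) ∩ (B' ∩ G))) := by
  have hδ0 : 0 ≤ δ := le_trans (by positivity) hδ
  have hlen : ∀ γ : Circuit, n ≤ γ.len → C * Real.exp (-a * γ.len) ≤ δ := fun γ hγ => by
    refine le_trans ?_ hδ
    gcongr ?_ * Real.exp ?_
    have : (n : ℝ) ≤ γ.len := by exact_mod_cast hγ
    nlinarith
  have hne : H.Nonempty := ⟨u, hu u (by simp)⟩
  have hne' : Hᶜ.Nonempty := ⟨v, hv v (by simp)⟩
  -- The finite one of `H` and its complement supplies the interior of the circuit. The near-Markov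
  -- estimate, once cleared of denominators, is symmetric in the two sides, so either case serves.
  rcases hfin with hf | hf
  · obtain ⟨γ, hγ⟩ := exists_circuit_bonds_eq hf hne hH hH'
    have hl := hlen γ (card_edgeBoundary_ge hf hu hγ)
    have hi := cylinderEvents_mono (X := fun _ : Bond => Bool)
      (Circuit.innerBonds_subset_interior hf hγ)
    have he := cylinderEvents_mono (X := fun _ : Bond => Bool)
      (Circuit.innerBonds_compl_subset_exterior hf hH' hγ)
    have k1 := h.abs_sub_le γ (hi _ hG) (he _ hB)
    have k2 := h.abs_sub_le γ (hi _ hG) (he _ hB')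
    rw [hγ] at k1 k2
    rw [Set.inter_comm B G, Set.inter_comm B' G]
    refine swap_of_abs_sub_le hδ0 hδ' measureReal_nonneg measureReal_nonneg measureReal_nonneg
      measureReal_nonneg measureReal_nonneg measureReal_nonneg
      (measureReal_mono Set.inter_subset_left) (k1.trans ?_) (k2.trans ?_) <;> gcongr
  · have hH2 : DualConnected Hᶜᶜ := by rwa [compl_compl]
    obtain ⟨γ, hγ⟩ := exists_circuit_bonds_eq hf hne' hH' hH2
    have hl := hlen γ (card_edgeBoundary_ge hf hv hγ)
    have hi := cylinderEvents_mono (X := fun _ : Bond => Bool)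
      (Circuit.innerBonds_subset_interior hf hγ)
    have he := cylinderEvents_mono (X := fun _ : Bond => Bool)
      (Circuit.innerBonds_compl_subset_exterior hf hH2 hγ)
    rw [compl_compl] at he
    have k1 := h.abs_sub_le γ (hi _ hB) (he _ hG)
    have k2 := h.abs_sub_le γ (hi _ hB') (he _ hG)
    rw [hγ, edgeBoundary_compl, mul_comm (P.real (_ ∩ B))] at k1
    rw [hγ, edgeBoundary_compl, mul_comm (P.real (_ ∩ B'))] at k2
    refine swap_of_abs_sub_le hδ0 hδ' measureReal_nonneg measureReal_nonneg measureReal_nonneg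
      measureReal_nonneg measureReal_nonneg measureReal_nonneg
      (measureReal_mono Set.inter_subset_left) (k1.trans ?_) (k2.trans ?_) <;> gcongr

/-! ## Components of the complement of a finite connected set -/

lemma connectedIn_univ (u v : Site) : ConnectedIn Set.univ u v :=
  connectedIn_of_box (n := supDist u v) (fun _ _ => trivial) (by simp)

lemma connectedIn_vertical {K : Set Site} {x : ℤ} (hK : ∀ y, (x, y) ∈ K) (y y' : ℤ) :
    ConnectedIn K (x, y) (x, y') := by
  have hup : ∀ (y : ℤ) (n : ℕ), ConnectedIn K (x, y) (x, y + n) := by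
    intro y n
    induction n with
    | zero => simpa using ConnectedIn.refl K _
    | succ n ih =>
      refine .tail ih ⟨hK _, ?_⟩
      have := dualAdj_up x (y + n)
      push_cast
      rwa [add_assoc] at this
  rcases le_total y y' with h | h
  · have := hup y (y' - y).toNat
    rwa [show y + ((y' - y).toNat : ℤ) = y' by omega] at this
  · have := hup y' (y - y').toNat
    rw [show y' + ((y - y').toNat : ℤ) = y by omega] at this
    exact this.symm (hK _)

lemma connectedIn_horizontal {K : Set Site} {y : ℤ} (hK : ∀ x, (x, y) ∈ K) (x x' : ℤ) :
    ConnectedIn K (x, y) (x', y) := by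
  have hup : ∀ (x : ℤ) (n : ℕ), ConnectedIn K (x, y) (x + n, y) := by
    intro x n
    induction n with
    | zero => simpa using ConnectedIn.refl K _
    | succ n ih =>
      refine .tail ih ⟨hK _, ?_⟩
      have := dualAdj_right (x + n) y
      push_cast
      rwa [add_assoc] at this
  rcases le_total x x' with h | h
  · have := hup x (x' - x).toNat
    rwa [show x + ((x' - x).toNat : ℤ) = x' by omega] at this
  · have := hup x' (x - x').toNat
    rw [show x' + ((x - x').toNat : ℤ) = x by omega] at this
    exact this.symm (hK _)

/-- A face off the box lies on a full vertical or horizontal line missing the box; from there a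
second such line leads to the corner. -/
lemma connectedIn_box_compl (n : ℕ) {u : Site} (hu : u ∉ box 0 n) :
    ConnectedIn {v | v ∉ box 0 n} u ((n : ℤ) + 1, (n : ℤ) + 1) := by
  obtain ⟨x, y⟩ := u
  simp only [mem_box, supDist, Prod.fst_zero, Prod.snd_zero] at hu
  have hv : ∀ {x : ℤ}, n < x.natAbs → ∀ y, (x, y) ∈ {v | v ∉ box 0 n} := by
    intro x hx y
    simp only [mem_box, supDist, Prod.fst_zero, Prod.snd_zero, Set.mem_ofPred_eq]
    omega
  have hh : ∀ {y : ℤ}, n < y.natAbs → ∀ x, (x, y) ∈ {v | v ∉ box 0 n} := by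
    intro y hy x
    simp only [mem_box, supDist, Prod.fst_zero, Prod.snd_zero, Set.mem_ofPred_eq]
    omega
  by_cases hx : n < x.natAbs
  · exact (connectedIn_vertical (hv hx) y (n + 1)).trans
      (connectedIn_horizontal (hh (by omega)) _ _)
  · exact (connectedIn_horizontal (hh (by omega)) x (n + 1)).trans
      (connectedIn_vertical (hv (by omega)) _ _)

lemma exists_subset_box (k : Finset Site) : ∃ n, ∀ u ∈ k, u ∈ box 0 n :=
  ⟨k.sup fun u => supDist 0 u, fun u hu => by
    rw [mem_box]; exact Finset.le_sup (f := fun u => supDist 0 u) hu⟩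

/-- The component of `u` in the complement of `k`. -/
def complComponent (k : Finset Site) (u : Site) : Set Site :=
  {v | ConnectedIn (k : Set Site)ᶜ u v}

section complComponent

variable {k : Finset Site} {u v w : Site}

lemma complComponent_subset (hu : u ∉ k) (hv : v ∈ complComponent k u) : v ∉ k :=
  ConnectedIn.mem hv hu

lemma complComponent_of_adj (hv : v ∈ complComponent k u) (hw : w ∉ k) (h : DualAdj v w) :
    w ∈ complComponent k u := Relation.ReflTransGen.tail hv ⟨hw, h⟩

lemma dualConnected_complComponent (k : Finset Site) (u : Site) : DualConnected (complComponent k u) := by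
  have h : ∀ v ∈ complComponent k u, ConnectedIn (complComponent k u) u v := by
    intro v hv
    have hv' : ConnectedIn (k : Set Site)ᶜ u v := hv
    clear hv
    induction hv' with
    | refl => exact ConnectedIn.refl _ _
    | tail hab hs ih => exact .tail ih ⟨Relation.ReflTransGen.tail hab hs, hs.2⟩
  intro v hv w hw
  exact ((h v hv).symm (ConnectedIn.refl _ _)).trans (h w hw)

/-- A path can leave the component only into `k`. So every face off the component is joined, without
entering it, to the connected set `k`. -/
lemma dualConnected_complComponent_compl (hk : DualConnected (k : Set Site)) (hne : k.Nonempty)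
    (hu : u ∉ k) : DualConnected (complComponent k u)ᶜ := by
  obtain ⟨w₀, hw₀⟩ := hne
  have hkH : (k : Set Site) ⊆ (complComponent k u)ᶜ := fun w hw h => complComponent_subset hu h hw
  have h : ∀ v, v ∈ complComponent k u ∨
      ∃ w ∈ k, ConnectedIn (complComponent k u)ᶜ w v := by
    intro v
    have hv := connectedIn_univ w₀ v
    induction hv with
    | refl => exact .inr ⟨w₀, hw₀, ConnectedIn.refl _ _⟩
    | @tail a b hab hs ih =>
      by_cases hb : b ∈ complComponent k u
      · exact .inl hb
      refine .inr ?_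
      by_cases hbk : b ∈ k
      · exact ⟨b, hbk, ConnectedIn.refl _ _⟩
      rcases ih with ha | ⟨w, hw, hwa⟩
      · exact (hb (complComponent_of_adj ha hbk hs.2)).elim
      · exact ⟨w, hw, .tail hwa ⟨hb, hs.2⟩⟩
  intro v hv v' hv'
  obtain ⟨w, hw, h1⟩ := (h v).resolve_left hv
  obtain ⟨w', hw', h2⟩ := (h v').resolve_left hv'
  exact ((h1.symm (hkH hw)).trans ((hk w hw w' hw').mono hkH)).trans h2

/-- All faces off a box containing `k` lie in a single component, so each component is either inside
the box or contains everything off it. -/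
lemma finite_complComponent (k : Finset Site) (u : Site) :
    (complComponent k u).Finite ∨ (complComponent k u)ᶜ.Finite := by
  obtain ⟨n, hn⟩ := exists_subset_box k
  have hsub : {v | v ∉ box 0 n} ⊆ (k : Set Site)ᶜ := fun v hv hvk => hv (hn v hvk)
  by_cases h : complComponent k u ⊆ box 0 n
  · exact .inl ((box 0 n).finite_toSet.subset h)
  · right
    obtain ⟨v, hv, hvb⟩ := Set.not_subset.1 h
    refine (box 0 n).finite_toSet.subset fun w hw => ?_
    by_contra hwb
    have h1 := (connectedIn_box_compl n hvb).mono hsub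
    have h2 := ((connectedIn_box_compl n hwb).symm hwb).mono hsub
    exact hw (ConnectedIn.trans hv (h1.trans h2))

end complComponent

/-- The bonds with at least one adjacent face in `k`. -/
def touchBonds (k : Finset Site) : Finset Bond :=
  k.biUnion fun u => {(u, false), (u, true), ((u.1, u.2 + 1), false), ((u.1 + 1, u.2), true)}

lemma mem_touchBonds {k : Finset Site} {e : Bond} :
    e ∈ touchBonds k ↔ e.dualSrc ∈ k ∨ e.dualTgt ∈ k := by
  simp only [touchBonds, Finset.mem_biUnion, Finset.mem_insert, Finset.mem_singleton]
  constructor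
  · rintro ⟨u, hu, rfl | rfl | rfl | rfl⟩ <;> simp [Bond.dualSrc, Bond.dualTgt, hu]
  · obtain ⟨⟨x, y⟩, _ | _⟩ := e <;> simp only [Bond.dualSrc, Bond.dualTgt] <;>
      rintro (h | h) <;> exact ⟨_, h, by simp⟩

lemma card_touchBonds_le (k : Finset Site) : (touchBonds k).card ≤ 4 * k.card := by
  rw [mul_comm]
  exact Finset.card_biUnion_le_card_mul _ _ _ fun u _ => Finset.card_le_four

lemma edgeBoundary_subset_touchBonds (k : Finset Site) :
    edgeBoundary (k : Set Site) ⊆ touchBonds k := by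
  intro e he
  rw [Finset.mem_coe, mem_touchBonds]
  by_contra h
  push Not at h
  exact he (by simp [h.1, h.2])

/-- Replacing the states on `D` by open ones before testing membership removes the dependence on `D`
and changes nothing when `D` is open. -/
lemma DeterminedBy.exists_eq_allOpen_inter {S : Set Config} {X D : Set Bond}
    (hS : DeterminedBy S (X ∪ D)) (hD : S ⊆ allOpen D) :
    ∃ B, DeterminedBy B X ∧ S = allOpen D ∩ B := by
  classical
  refine ⟨{ω | (fun e => if e ∈ D then true else ω e) ∈ S}, ?_, ?_⟩
  · intro ω ω' h hω
    refine hS _ _ ?_ hω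
    intro e he
    by_cases hD : e ∈ D
    · simp [hD]
    · simpa [hD] using h e (he.resolve_right hD)
  · have key : ∀ ω ∈ allOpen D, (fun e => if e ∈ D then true else ω e) = ω := by
      intro ω hω
      funext e
      split_ifs with h
      · exact (hω e h).symm
      · rfl
    ext ω
    constructor
    · intro hω
      refine ⟨hD hω, ?_⟩
      change (fun e => if e ∈ D then true else ω e) ∈ S
      rwa [key ω (hD hω)]
    · rintro ⟨h1, h2⟩
      have h2 : (fun e => if e ∈ D then true else ω e) ∈ S := h2
      rwa [key ω h1] at h2

open Classical in
/-- The adjacent face of `e` outside `k`. -/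
noncomputable def outerFace (k : Finset Site) (e : Bond) : Site :=
  if e.dualSrc ∈ k then e.dualTgt else e.dualSrc

lemma outerFace_notMem {k : Finset Site} {e : Bond} (he : e ∈ edgeBoundary (k : Set Site)) :
    outerFace k e ∉ k := by
  unfold outerFace
  split_ifs with h
  · exact fun h' => he ⟨fun _ => h', fun _ => h⟩
  · exact h

/-- A path from `k` enters each component through a boundary bond, so finitely many bonds name all
components, possibly with repetition. -/
lemma exists_mem_complComponent {k : Finset Site} (hne : k.Nonempty) (v : Site) (hv : v ∉ k) :
    ∃ e ∈ edgeBoundary (k : Set Site), v ∈ complComponent k (outerFace k e) := by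
  obtain ⟨w₀, hw₀⟩ := hne
  have h : ∀ v, v ∈ k ∨ ∃ e ∈ edgeBoundary (k : Set Site),
      v ∈ complComponent k (outerFace k e) := by
    intro v
    have hv := connectedIn_univ w₀ v
    induction hv with
    | refl => exact .inl hw₀
    | @tail a b hab hs ih =>
      by_cases hb : b ∈ k
      · exact .inl hb
      refine .inr ?_
      rcases ih with ha | ⟨e, he, hae⟩
      · obtain ⟨e, he⟩ := hs.2
        rcases he with ⟨rfl, rfl⟩ | ⟨rfl, rfl⟩
        · refine ⟨e, fun h => hb (h.1 ha), ?_⟩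
          rw [outerFace, if_pos ha]
          exact ConnectedIn.refl _ _
        · refine ⟨e, fun h => hb (h.2 ha), ?_⟩
          rw [outerFace, if_neg hb]
          exact ConnectedIn.refl _ _
      · exact ⟨e, he, complComponent_of_adj hae hb hs.2⟩
  exact (h v).resolve_left hv

/-! ### Exchange of events across the open boundary of a connected set -/

/-- Two events `S`, `T` determined inside a finite connected set `k` of faces with open boundary
have nearly proportional joint probabilities with events outside. -/
lemma NearMarkovWith.swap_agreeOn {C a δ : ℝ} (hC : 0 < C) (ha : 0 < a) (h : NearMarkovWith P C a)
    {k : Finset Site} {n : ℕ} (hδ : C * Real.exp (-a * n) ≤ δ) (hδ' : δ ≤ 1 / 3)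
    (hk : DualConnected (k : Set Site)) {v : Site} (hv : ∀ w ∈ box v n, w ∈ k)
    {S T : Set Config} (hS : DeterminedBy S (touchBonds k)) (hT : DeterminedBy T (touchBonds k))
    (hSo : S ⊆ allOpen (edgeBoundary k)) (hTo : T ⊆ allOpen (edgeBoundary k))
    {Y : Set Bond} (hYf : Y.Finite) (hY : Y ⊆ innerBonds (k : Set Site)ᶜ)
    (hYb : ∀ y ∈ Y, ∀ w ∈ box y.1 n, w ∉ k) (η : Config) :
    P.real (S ∩ agreeOn Y η) * P.real T ≤
      Real.exp (3 * δ * (touchBonds k).card) * (P.real S * P.real (T ∩ agreeOn Y η)) := by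
  classical
  have hδ0 : 0 ≤ δ := le_trans (by positivity) hδ
  have hne : k.Nonempty := ⟨v, hv v (by simp)⟩
  -- Components of the complement are named by boundary bonds of `k`. The induction adds them one at
  -- a time, each costing at most a factor exp(3δ).
  let part : Finset Bond → Set Bond := fun Q =>
    {y ∈ Y | ∃ e ∈ Q, y.1 ∈ complComponent k (outerFace k e)}
  let Q₀ : Finset Bond := (touchBonds k).filter fun e => e ∈ edgeBoundary (k : Set Site)
  have main : ∀ Q ⊆ Q₀, P.real (S ∩ agreeOn (part Q) η) * P.real T ≤
      Real.exp (3 * δ * Q.card) * (P.real S * P.real (T ∩ agreeOn (part Q) η)) := by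
    intro Q
    induction Q using Finset.induction_on with
    | empty =>
      intro _
      have : part ∅ = ∅ := by ext; simp [part]
      simp [this, agreeOn]
    | insert e Q he ih =>
      intro hQ
      have heQ := Finset.mem_filter.1 (hQ (Finset.mem_insert_self e Q))
      have hQ' : Q ⊆ Q₀ := (Finset.subset_insert e Q).trans hQ
      have hIH := ih hQ'
      have hmono : Real.exp (3 * δ * Q.card) ≤ Real.exp (3 * δ * (insert e Q).card) := by
        gcongr
        exact Finset.subset_insert e Q
      set H := complComponent k (outerFace k e) with hH
      have hnot := outerFace_notMem heQ.2
      -- If the component of `e` was treated before or carries no bond of `Y`, nothing changes.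
      -- Otherwise it is new and contains some bond `y₀` of `Y`.
      by_cases hcase : part (insert e Q) = part Q
      · rw [hcase]
        exact hIH.trans (by gcongr)
      have hsplit : part (insert e Q) = part Q ∪ {y ∈ Y | y.1 ∈ H} := by
        ext y
        simp only [part, Finset.mem_insert, Set.mem_ofPred_eq, Set.mem_union]
        constructor
        · rintro ⟨hy, f, rfl | hf, hyf⟩
          · exact .inr ⟨hy, hyf⟩
          · exact .inl ⟨hy, f, hf, hyf⟩
        · rintro (⟨hy, f, hf, hyf⟩ | ⟨hy, hyH⟩)
          · exact ⟨hy, f, .inr hf, hyf⟩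
          · exact ⟨hy, e, .inl rfl, hyH⟩
      have hdisj : ∀ y ∈ part Q, y.1 ∉ H := by
        rintro y ⟨hy, e', he', hye'⟩ hyH
        apply hcase
        rw [hsplit, Set.union_eq_left]
        rintro z ⟨hz, hzH⟩
        refine ⟨hz, e', he', ?_⟩
        have h1 : ConnectedIn (k : Set Site)ᶜ y.1 (outerFace k e) := ConnectedIn.symm hyH hnot
        exact ConnectedIn.trans hye' (h1.trans hzH)
      obtain ⟨y₀, hy₀, hy₀H⟩ : ∃ y ∈ Y, y.1 ∈ H := by
        by_contra hno
        push Not at hno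
        apply hcase
        rw [hsplit, Set.union_eq_left]
        rintro z ⟨hz, hzH⟩
        exact (hno z hz hzH).elim
      have hkH : ∀ w ∈ k, w ∈ Hᶜ := fun w hw h => complComponent_subset hnot h hw
      -- The box about `y₀` is connected and avoids `k`, so it lies in `H`, while the box about `v`
      -- lies in the complement of `H`. Whichever of the two is finite, its boundary circuit has
      -- length at least `n`.
      have hbox : ∀ w ∈ box y₀.1 n, w ∈ H := by
        intro w hw
        exact ConnectedIn.trans hy₀H (connectedIn_of_box (K := (k : Set Site)ᶜ)
          (fun z hz => hYb y₀ hy₀ z hz) hw)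
      have hbd : edgeBoundary H ⊆ edgeBoundary k := by
        intro f hf hfk
        apply hf
        by_cases h1 : f.dualSrc ∈ (k : Set Site)
        · exact iff_of_false (hkH _ h1) (hkH _ (hfk.1 h1))
        · have h2 : f.dualTgt ∉ (k : Set Site) := fun h => h1 (hfk.2 h)
          exact ⟨fun h => complComponent_of_adj h h2 ⟨f, f.dualJoins⟩,
            fun h => complComponent_of_adj h h1 ⟨f, f.dualJoins.symm⟩⟩
      have hopen : allOpen (edgeBoundary (k : Set Site)) ⊆ allOpen (edgeBoundary H) :=
        fun ω hω f hf => hω f (hbd hf)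
      let X : Set Bond := {f | f ∈ touchBonds k ∧ f ∈ innerBonds Hᶜ}
      have hXf : X.Finite := (touchBonds k).finite_toSet.subset fun f hf => hf.1
      have hXD : (touchBonds k : Set Bond) ⊆ X ∪ edgeBoundary H := by
        intro f hf
        by_cases hfH : f ∈ edgeBoundary H
        · exact .inr hfH
        refine .inl ⟨hf, ?_⟩
        have hiff : f.dualSrc ∈ H ↔ f.dualTgt ∈ H := not_not.1 hfH
        rcases mem_touchBonds.1 hf with h | h
        · exact ⟨hkH _ h, fun h' => hkH _ h (hiff.2 h')⟩
        · exact ⟨fun h' => hkH _ h (hiff.1 h'), hkH _ h⟩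
      obtain ⟨S', hS', hSe⟩ := (hS.mono hXD).exists_eq_allOpen_inter (hSo.trans hopen)
      obtain ⟨T', hT', hTe⟩ := (hT.mono hXD).exists_eq_allOpen_inter (hTo.trans hopen)
      have hpartf : (part Q).Finite := hYf.subset fun y hy => hy.1
      have hpartH : part Q ⊆ innerBonds Hᶜ := by
        intro y hy
        have hyk := hY hy.1
        exact ⟨fun h => hdisj y hy (complComponent_of_adj h hyk.2 ⟨y, y.dualJoins⟩), hdisj y hy⟩
      have hXi := cylinderEvents_mono (X := fun _ : Bond => Bool)
        (fun f (hf : f ∈ X) => hf.2)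
      have hpi := cylinderEvents_mono (X := fun _ : Bond => Bool) hpartH
      have hmp := hpi _ ((determinedBy_agreeOn (part Q) η).measurableSet_cylinderEvents hpartf)
      have hGf : {y ∈ Y | y.1 ∈ H}.Finite := hYf.subset fun y hy => hy.1
      have hGi : {y ∈ Y | y.1 ∈ H} ⊆ innerBonds H := by
        rintro y ⟨hy, hyH⟩
        exact ⟨complComponent_of_adj hyH (hY hy).1 ⟨y, y.dualJoins.symm⟩, hyH⟩
      have hG := cylinderEvents_mono (X := fun _ : Bond => Bool) hGi _
        ((determinedBy_agreeOn {y ∈ Y | y.1 ∈ H} η).measurableSet_cylinderEvents hGf)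
      have hB := (hXi _ (hS'.measurableSet_cylinderEvents hXf)).inter hmp
      have hB' := (hXi _ (hT'.measurableSet_cylinderEvents hXf)).inter hmp
      have hsw := h.swap (P := P) hC ha hδ hδ' (finite_complComponent k _)
        (dualConnected_complComponent _ _) (dualConnected_complComponent_compl hk hne hnot)
        hbox (fun w hw => hkH w (hv w hw)) hG hB hB'
      simp only [← Set.inter_assoc] at hsw
      rw [← hH, ← hSe, ← hTe] at hsw
      rw [hsplit, agreeOn_union, ← Set.inter_assoc, ← Set.inter_assoc]
      set sg := P.real (S ∩ agreeOn (part Q) η ∩ agreeOn {y ∈ Y | y.1 ∈ H} η)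
      set tg := P.real (T ∩ agreeOn (part Q) η ∩ agreeOn {y ∈ Y | y.1 ∈ H} η)
      set s := P.real (S ∩ agreeOn (part Q) η)
      set t := P.real (T ∩ agreeOn (part Q) η)
      have hsg : sg ≤ s := measureReal_mono Set.inter_subset_left
      have h0 : 0 ≤ sg := measureReal_nonneg
      have h0' : 0 ≤ tg := measureReal_nonneg
      have h0'' : 0 ≤ s := measureReal_nonneg
      have hT0 : 0 ≤ P.real T := measureReal_nonneg
      have hS0 : 0 ≤ P.real S := measureReal_nonneg
      rw [Finset.card_insert_of_notMem he]
      push_cast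
      rw [mul_add, mul_one, Real.exp_add]
      -- The induction hypothesis and the new exchange are chained through `t`, which is then
      -- cancelled.
      rcases (show (0 : ℝ) ≤ t from measureReal_nonneg).eq_or_lt with ht0 | ht0
      · rw [← ht0, mul_zero, mul_zero] at hIH
        have : sg * P.real T ≤ 0 := (mul_le_mul_of_nonneg_right hsg hT0).trans hIH
        exact this.trans (by positivity)
      · refine le_of_mul_le_mul_right ?_ ht0
        calc sg * P.real T * t = sg * t * P.real T := by ring
          _ ≤ Real.exp (3 * δ) * (s * tg) * P.real T := by gcongr
          _ = Real.exp (3 * δ) * tg * (s * P.real T) := by ring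
          _ ≤ Real.exp (3 * δ) * tg * (Real.exp (3 * δ * Q.card) * (P.real S * t)) := by gcongr
          _ = _ := by ring
  have hQ₀ : part Q₀ = Y := by
    ext y
    refine ⟨fun hy => hy.1, fun hy => ⟨hy, ?_⟩⟩
    obtain ⟨e, he, hye⟩ := exists_mem_complComponent hne y.1 (hY hy).2
    exact ⟨e, Finset.mem_filter.2 ⟨edgeBoundary_subset_touchBonds k he, he⟩, hye⟩
  have := main Q₀ subset_rfl
  rw [hQ₀] at this
  refine this.trans ?_
  gcongr
  exact Finset.filter_subset _ _

/-- `NearMarkovWith.swap_agreeOn` for general outside events. -/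
lemma NearMarkovWith.swap_outside {C a δ : ℝ} (hC : 0 < C) (ha : 0 < a) (h : NearMarkovWith P C a)
    {k : Finset Site} {n : ℕ} (hδ : C * Real.exp (-a * n) ≤ δ) (hδ' : δ ≤ 1 / 3)
    (hk : DualConnected (k : Set Site)) {v : Site} (hv : ∀ w ∈ box v n, w ∈ k)
    {S T : Set Config} (hS : DeterminedBy S (touchBonds k)) (hT : DeterminedBy T (touchBonds k))
    (hSo : S ⊆ allOpen (edgeBoundary k)) (hTo : T ⊆ allOpen (edgeBoundary k))
    {Y : Set Bond} (hYf : Y.Finite) (hY : Y ⊆ innerBonds (k : Set Site)ᶜ)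
    (hYb : ∀ y ∈ Y, ∀ w ∈ box y.1 n, w ∉ k) {X : Set Config} (hX : DeterminedBy X Y) :
    P.real (S ∩ X) * P.real T ≤
      Real.exp (3 * δ * (touchBonds k).card) * (P.real S * P.real (T ∩ X)) := by
  have := measureReal_inter_le_of_atoms P hYf (U := S) (V := T) (a := P.real T)
    (b := Real.exp (3 * δ * (touchBonds k).card) * P.real S) (fun η => ?_) hX
  · linarith
  · have := h.swap_agreeOn hC ha hδ hδ' hk hv hS hT hSo hTo hYf hY hYb η
    linarith

/-! ## Estimates for the decay sums -/

lemma summable_exp_neg_supDist {lam : ℝ} (hl : 0 < lam) :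
    Summable fun v : Site => Real.exp (-lam * supDist 0 v) := by
  have hN : Summable fun n : ℕ => Real.exp (n * (-(lam / 2))) :=
    Real.summable_exp_nat_mul_iff.2 (by linarith)
  have hZ : Summable fun n : ℤ => Real.exp (n.natAbs * (-(lam / 2))) := by
    refine Summable.of_nat_of_neg ?_ ?_
    · simpa using hN
    · simpa using hN
  refine Summable.of_nonneg_of_le (fun _ => (Real.exp_pos _).le) (fun v => ?_)
    (hZ.mul_of_nonneg hZ (fun _ => (Real.exp_pos _).le) fun _ => (Real.exp_pos _).le)
  rw [← Real.exp_add]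
  refine Real.exp_le_exp.2 ?_
  have h1 : v.1.natAbs + v.2.natAbs ≤ 2 * supDist 0 v := by
    simp only [supDist, Prod.fst_zero, Prod.snd_zero]; omega
  have h2 : (v.1.natAbs : ℝ) + v.2.natAbs ≤ 2 * supDist 0 v := by exact_mod_cast h1
  nlinarith

/-- The constant in the bound for decay sums. -/
noncomputable def decayConst (lam : ℝ) : ℝ := ∑' v : Site, Real.exp (-(lam / 2) * supDist 0 v)

lemma decayConst_nonneg (lam : ℝ) : 0 ≤ decayConst lam := tsum_nonneg fun _ => (Real.exp_pos _).le

/-- Half of the decay rate pays for the distance `l`; the other half makes the sum over all sites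
`y` converge, and there are at most `2 * R.card` sites `x`. -/
lemma decaySum_le {lam : ℝ} (hl : 0 < lam) {X : Set Bond} {R : Finset Bond} (hX : X ⊆ R)
    (F : Set Bond) {l : ℕ} (hd : ∀ x ∈ endpoints X, ∀ y ∈ endpoints F, l ≤ supDist x y) :
    decaySum lam X F ≤
      ENNReal.ofReal (2 * R.card * (decayConst lam * Real.exp (-(lam / 2) * l))) := by
  classical
  have hrow : ∀ x : endpoints X, ∑' y : endpoints F,
      ENNReal.ofReal (Real.exp (-lam * dist (toPlane x) (toPlane y))) ≤
      ENNReal.ofReal (decayConst lam * Real.exp (-(lam / 2) * l)) := by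
    intro x
    have h1 : ∀ y : endpoints F,
        ENNReal.ofReal (Real.exp (-lam * dist (toPlane x) (toPlane y))) ≤
        ENNReal.ofReal (Real.exp (-(lam / 2) * l)) *
          ENNReal.ofReal (Real.exp (-(lam / 2) * supDist x y)) := by
      intro y
      rw [← ENNReal.ofReal_mul (Real.exp_pos _).le, ← Real.exp_add]
      refine ENNReal.ofReal_le_ofReal (Real.exp_le_exp.2 ?_)
      have i1 : (l : ℝ) ≤ supDist x y := by exact_mod_cast hd x x.2 y y.2
      have i2 := supDist_le_dist x y
      nlinarith
    have h2 : ∑' y : Site, ENNReal.ofReal (Real.exp (-(lam / 2) * supDist x y)) =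
        ENNReal.ofReal (decayConst lam) := by
      rw [decayConst, ENNReal.ofReal_tsum_of_nonneg (fun _ => (Real.exp_pos _).le)
        (summable_exp_neg_supDist (by linarith))]
      rw [← Equiv.tsum_eq (Equiv.addLeft (x : Site))]
      refine tsum_congr fun v => ?_
      congr 4
      simp [supDist]
    calc _ ≤ ∑' y : endpoints F, ENNReal.ofReal (Real.exp (-(lam / 2) * l)) *
          ENNReal.ofReal (Real.exp (-(lam / 2) * supDist x y)) := ENNReal.tsum_le_tsum h1
      _ = ENNReal.ofReal (Real.exp (-(lam / 2) * l)) *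
          ∑' y : endpoints F, ENNReal.ofReal (Real.exp (-(lam / 2) * supDist x y)) :=
        ENNReal.tsum_mul_left
      _ ≤ ENNReal.ofReal (Real.exp (-(lam / 2) * l)) *
          ∑' y : Site, ENNReal.ofReal (Real.exp (-(lam / 2) * supDist x y)) := by
        gcongr
        exact ENNReal.tsum_comp_le_tsum_of_injective Subtype.val_injective
          (fun y : Site => ENNReal.ofReal (Real.exp (-(lam / 2) * supDist x y)))
      _ = _ := by
        rw [h2, ← ENNReal.ofReal_mul (Real.exp_pos _).le, mul_comm]
  set c := ENNReal.ofReal (decayConst lam * Real.exp (-(lam / 2) * l)) with hc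
  let V : Finset Site := R.image Bond.src ∪ R.image Bond.tgt
  have hV : endpoints X ⊆ V := by
    rintro x ⟨e, he, rfl | rfl⟩
    · exact Finset.mem_union_left _ (Finset.mem_image_of_mem _ (hX he))
    · exact Finset.mem_union_right _ (Finset.mem_image_of_mem _ (hX he))
  have hVc : V.card ≤ 2 * R.card := by
    refine (Finset.card_union_le _ _).trans ?_
    have h1 := Finset.card_image_le (s := R) (f := Bond.src)
    have h2 := Finset.card_image_le (s := R) (f := Bond.tgt)
    omega
  calc decaySum lam X F ≤ ∑' _ : endpoints X, c := ENNReal.tsum_le_tsum hrow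
    _ ≤ ∑' _ : (V : Set Site), c := ENNReal.tsum_mono_subtype (fun _ => c) hV
    _ = V.card * c := by simp
    _ ≤ (2 * R.card : ℕ) * c := by gcongr
    _ = _ := by
      rw [hc, ENNReal.ofReal_mul (p := 2 * (R.card : ℝ)) (by positivity)]
      congr 1
      rw [← ENNReal.ofReal_natCast]
      push_cast
      rfl

/-! ## Crossings of annuli -/

/-- The dual site `z` is joined inside its box of radius `n` to the boundary of this box. -/
def exitEvent (z : Site) (n : ℕ) : Set Config :=
  {ω | ∃ v, supDist z v = n ∧ ConnOn (innerBonds (box z n)) ω z v}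

/-- Cut the path at its first site at distance `n`: steps change the distance by at most one, so the
path has stayed in the box. -/
lemma mem_exitEvent {Q : Set Bond} {ω : Config} {z v : Site} {n : ℕ} (h : ConnOn Q ω z v)
    (hn : n ≤ supDist z v) : ω ∈ exitEvent z n := by
  have key : ω ∈ exitEvent z n ∨
      (supDist z v < n ∧ ConnOn (innerBonds (box z n)) ω z v) := by
    clear hn
    induction h with
    | refl =>
      rcases Nat.eq_zero_or_pos n with rfl | hn0
      · exact .inl ⟨z, supDist_self z, .refl⟩
      · exact .inr ⟨by simpa using hn0, .refl⟩
    | @tail a b hab hs ih =>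
      rcases ih with h | ⟨ha, hc⟩
      · exact .inl h
      · have hd := hs.supDist_eq
        have htri := supDist_triangle z a b
        obtain ⟨e, he, hω, hj⟩ := hs
        have hab : a ∈ box z n ∧ b ∈ box z n := by
          simp only [mem_box]; omega
        have he' : e ∈ innerBonds (box z n) := by
          rcases hj with ⟨rfl, rfl⟩ | ⟨rfl, rfl⟩
          · exact hab
          · exact hab.symm
        have hcb : ConnOn (innerBonds (box z n)) ω z b := .tail hc ⟨e, he', hω, hj⟩
        rcases Nat.lt_or_ge (supDist z b) n with h | h
        · exact .inr ⟨h, hcb⟩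
        · exact .inl ⟨b, by omega, hcb⟩
  rcases key with h | h
  · exact h
  · omega

lemma determinedBy_exitEvent (z : Site) (n : ℕ) :
    DeterminedBy (exitEvent z n) (innerBonds (box z n)) := by
  rintro ω ω' h ⟨v, hv, hc⟩
  exact ⟨v, hv, hc.mono subset_rfl fun e he h' => by rwa [← h e he]⟩

/-- The bound in the decay of dual connectivity, for given constants. -/
def DualDecayWith (P : Measure Config) (C c : ℝ) : Prop :=
  ∀ x : Site, P.real {ω | DualConn ω 0 x} ≤ C * Real.exp (-c * ‖toPlane x‖)

section

variable {P : Measure Config} [IsProbabilityMeasure P]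

/-- Only an inequality is claimed, because the bound by the image measure then needs no
measurability of the connection event. -/
lemma measureReal_dualConn_le (ht : TranslationInvariant P) (u v : Site) :
    P.real {ω | DualConn ω u v} ≤ P.real {ω | DualConn ω 0 (v - u)} := by
  let f : Config → Config := fun ω e => ω (e.translate u)
  have hf : Measurable f := measurable_pi_lambda _ fun e => measurable_pi_apply _
  have hsub : {ω | DualConn ω u v} ⊆ f ⁻¹' {ω | DualConn ω 0 (v - u)} := by
    intro ω hω
    have hω : DualConn ω u v := hω
    change DualConn (f ω) 0 (v - u)
    rw [← sub_self u]
    refine Relation.ReflTransGen.lift (fun w => w - u) (fun a b h => ?_) _ _ hω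
    obtain ⟨e, he, h⟩ := h
    refine ⟨e.translate (-u), ?_, ?_⟩
    · simpa [f, Bond.translate] using he
    · obtain ⟨⟨x, y⟩, _ | _⟩ := e <;>
        simp only [Bond.translate, Bond.dualSrc, Bond.dualTgt, Bool.false_eq_true, if_false,
          if_true] at h ⊢ <;>
        refine h.imp ?_ ?_ <;> rintro ⟨rfl, rfl⟩ <;> constructor <;> ext <;> simp <;> ring
  have h1 := Measure.le_map_apply hf.aemeasurable (μ := P) {ω | DualConn ω 0 (v - u)}
  rw [ht u] at h1
  exact ENNReal.toReal_mono (measure_ne_top _ _) ((measure_mono hsub).trans h1)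

lemma measureReal_exitEvent_le (ht : TranslationInvariant P) {C c : ℝ} (hC : 0 < C) (hc : 0 < c)
    (h : DualDecayWith P C c) (z : Site) (n : ℕ) :
    P.real (exitEvent z n) ≤ (2 * n + 1) ^ 2 * (C * Real.exp (-c * n)) := by
  have hsub : exitEvent z n ⊆
      ⋃ v ∈ (box z n).filter (fun v => supDist z v = n), {ω | DualConn ω z v} := by
    rintro ω ⟨v, hv, hω⟩
    simp only [Set.mem_iUnion]
    exact ⟨v, Finset.mem_filter.2 ⟨mem_box.2 hv.le, hv⟩,
      dualConn_iff.2 (hω.mono (Set.subset_univ _) fun _ _ h => h)⟩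
  calc P.real (exitEvent z n)
      ≤ P.real (⋃ v ∈ (box z n).filter (fun v => supDist z v = n), {ω | DualConn ω z v}) :=
        measureReal_mono hsub (measure_ne_top _ _)
    _ ≤ ∑ v ∈ (box z n).filter (fun v => supDist z v = n), P.real {ω | DualConn ω z v} :=
        measureReal_biUnion_finset_le _ _
    _ ≤ ∑ v ∈ (box z n).filter (fun v => supDist z v = n), C * Real.exp (-c * n) := by
        refine Finset.sum_le_sum fun v hv => (measureReal_dualConn_le ht z v).trans
          ((h _).trans ?_)
        have h1 := supDist_le_dist (v - z) 0
        have h2 : supDist (v - z) 0 = n := by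
          rw [← (Finset.mem_filter.1 hv).2, supDist_comm]
          simp only [supDist, Prod.fst_sub, Prod.snd_sub, Prod.fst_zero, Prod.snd_zero]
          omega
        have h3 : toPlane 0 = 0 := by
          ext i; fin_cases i <;> simp [toPlane]
        rw [h2, h3, dist_zero_right] at h1
        gcongr ?_ * Real.exp ?_
        nlinarith
    _ ≤ (2 * n + 1) ^ 2 * (C * Real.exp (-c * n)) := by
        rw [Finset.sum_const, nsmul_eq_mul]
        gcongr
        have := (Finset.card_filter_le (box z n) (fun v => supDist z v = n)).trans
          (card_box z n).le
        exact_mod_cast this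

/-! ## A selection lemma -/

/-- If finitely many disjoint events nearly exhaust the probability space and are, in total
variation, nearly independent of each of finitely many events, then one of them is nearly
independent of all these events in ratio. -/
lemma exists_forall_abs_sub_le {ι : Type*} (I : Finset ι) (T : ι → Set Config)
    (hTm : ∀ i ∈ I, MeasurableSet (T i)) (hd : Set.PairwiseDisjoint (I : Set ι) T)
    (J : Finset (Set Config)) {η δ : ℝ} (hδ : 0 < δ)
    (hJ : ∀ V ∈ J, ∀ Q ⊆ I, |P.real (V ∩ ⋃ i ∈ Q, T i) - P.real V * P.real (⋃ i ∈ Q, T i)| ≤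
      η * P.real V)
    (hη : 2 * J.card * η < δ * P.real (⋃ i ∈ I, T i)) (hη0 : 0 ≤ η) :
    ∃ i ∈ I, 0 < P.real (T i) ∧
      ∀ V ∈ J, |P.real (V ∩ T i) - P.real V * P.real (T i)| ≤ δ * (P.real V * P.real (T i)) := by
  classical
  by_contra! hcon
  have hsum : ∀ Q ⊆ I, P.real (⋃ i ∈ Q, T i) = ∑ i ∈ Q, P.real (T i) := fun Q hQ =>
    measureReal_biUnion_finset (hd.subset hQ) fun i hi => hTm i (hQ hi)
  have hsumV : ∀ V, ∀ Q ⊆ I, P.real (V ∩ ⋃ i ∈ Q, T i) = ∑ i ∈ Q, P.real (V ∩ T i) := by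
    intro V Q hQ
    have h1 := measureReal_biUnion_finset (μ := P.restrict V) (hd.subset hQ)
      fun i hi => hTm i (hQ hi)
    rw [measureReal_restrict_apply (Finset.measurableSet_biUnion _ fun i hi => hTm i (hQ hi))] at h1
    rw [Set.inter_comm, h1]
    exact Finset.sum_congr rfl fun i hi => by
      rw [measureReal_restrict_apply (hTm i (hQ hi)), Set.inter_comm]
  -- For each `V`, the indices violating the ratio bound upwards, and below those violating it
  -- downwards. Within one class all errors have the same sign and add up, so the hypothesis on
  -- unions bounds the mass of the class by `η / δ`. If every index of positive mass were bad, these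
  -- `2 * J.card` classes would exhaust the total mass.
  let up : Set Config → Finset ι := fun V => I.filter fun i =>
    δ * (P.real V * P.real (T i)) < P.real (V ∩ T i) - P.real V * P.real (T i)
  let dn : Set Config → Finset ι := fun V => I.filter fun i =>
    δ * (P.real V * P.real (T i)) < P.real V * P.real (T i) - P.real (V ∩ T i)
  have hbound : ∀ V ∈ J, ∀ Q ⊆ I, (∀ i ∈ Q, 0 < P.real V) →
      δ * (P.real V * ∑ i ∈ Q, P.real (T i)) ≤
        |P.real (V ∩ ⋃ i ∈ Q, T i) - P.real V * P.real (⋃ i ∈ Q, T i)| →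
      δ * ∑ i ∈ Q, P.real (T i) ≤ η := by
    intro V hV Q hQ hpos h
    rcases Q.eq_empty_or_nonempty with rfl | ⟨i, hi⟩
    · simpa using hη0
    · have hV0 := hpos i hi
      have := h.trans (hJ V hV Q hQ)
      refine le_of_mul_le_mul_right ?_ hV0
      linarith
  have hVpos : ∀ V i, δ * (P.real V * P.real (T i)) < P.real (V ∩ T i) - P.real V * P.real (T i) ∨
      δ * (P.real V * P.real (T i)) < P.real V * P.real (T i) - P.real (V ∩ T i) →
      0 < P.real V := by
    intro V i h
    rcases (measureReal_nonneg (μ := P) (s := V)).eq_or_lt with h0 | h0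
    · have h1 : P.real (V ∩ T i) ≤ P.real V := measureReal_mono Set.inter_subset_left
      have h2 : 0 ≤ P.real (V ∩ T i) := measureReal_nonneg
      rw [← h0] at h h1
      rcases h with h | h <;> nlinarith
    · exact h0
  have hup : ∀ V ∈ J, δ * ∑ i ∈ up V, P.real (T i) ≤ η := by
    intro V hV
    have hsub : up V ⊆ I := Finset.filter_subset _ _
    refine hbound V hV _ hsub (fun i hi => hVpos V i (.inl (Finset.mem_filter.1 hi).2)) ?_
    refine le_trans ?_ (le_abs_self _)
    rw [hsum _ hsub, hsumV _ _ hsub, Finset.mul_sum, Finset.mul_sum, ← Finset.sum_sub_distrib]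
    exact Finset.sum_le_sum fun i hi => (Finset.mem_filter.1 hi).2.le
  have hdn : ∀ V ∈ J, δ * ∑ i ∈ dn V, P.real (T i) ≤ η := by
    intro V hV
    have hsub : dn V ⊆ I := Finset.filter_subset _ _
    refine hbound V hV _ hsub (fun i hi => hVpos V i (.inr (Finset.mem_filter.1 hi).2)) ?_
    refine le_trans ?_ (neg_le_abs _)
    rw [hsum _ hsub, hsumV _ _ hsub, neg_sub, Finset.mul_sum, Finset.mul_sum,
      ← Finset.sum_sub_distrib]
    exact Finset.sum_le_sum fun i hi => (Finset.mem_filter.1 hi).2.le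
  have hcover : ∀ i ∈ I, P.real (T i) ≤ ∑ V ∈ J,
      ((if i ∈ up V then P.real (T i) else 0) + (if i ∈ dn V then P.real (T i) else 0)) := by
    intro i hi
    have hnn : ∀ V ∈ J, 0 ≤ (if i ∈ up V then P.real (T i) else 0) +
        (if i ∈ dn V then P.real (T i) else 0) := fun V _ => by
      have : 0 ≤ P.real (T i) := measureReal_nonneg
      split_ifs <;> linarith
    rcases (measureReal_nonneg (μ := P) (s := T i)).eq_or_lt with h0 | h0
    · rw [← h0] at hnn ⊢
      exact Finset.sum_nonneg hnn
    · obtain ⟨V, hV, hbad⟩ := hcon i hi h0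
      refine le_trans ?_ (Finset.single_le_sum hnn hV)
      rcases lt_abs.1 hbad with h | h
      · rw [if_pos (Finset.mem_filter.2 ⟨hi, h⟩)]
        split_ifs <;> linarith
      · rw [neg_sub] at h
        rw [if_pos (c := i ∈ dn V) (Finset.mem_filter.2 ⟨hi, h⟩)]
        split_ifs <;> linarith
  have htot : δ * P.real (⋃ i ∈ I, T i) ≤ 2 * J.card * η := by
    calc δ * P.real (⋃ i ∈ I, T i) = δ * ∑ i ∈ I, P.real (T i) := by rw [hsum _ subset_rfl]
      _ ≤ δ * ∑ i ∈ I, ∑ V ∈ J, ((if i ∈ up V then P.real (T i) else 0) +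
          (if i ∈ dn V then P.real (T i) else 0)) := by
        gcongr with i hi
        exact hcover i hi
      _ = ∑ V ∈ J, (δ * ∑ i ∈ up V, P.real (T i) + δ * ∑ i ∈ dn V, P.real (T i)) := by
        rw [Finset.sum_comm, Finset.mul_sum]
        refine Finset.sum_congr rfl fun V _ => ?_
        rw [Finset.sum_add_distrib, mul_add, ← Finset.sum_filter, ← Finset.sum_filter]
        congr 3 <;> ext i <;> simp only [up, dn, Finset.mem_filter] <;> tauto
      _ ≤ ∑ V ∈ J, (η + η) := Finset.sum_le_sum fun V hV => add_le_add (hup V hV) (hdn V hV)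
      _ = 2 * J.card * η := by rw [Finset.sum_const, nsmul_eq_mul]; ring
  linarith

end

/-! ## Exploration of the dual clusters meeting a given set of faces -/

/-- The set `W` together with all faces joined to it by dual paths crossing closed bonds that are
not inner bonds of `W`. -/
def explored (W : Finset Site) (ω : Config) : Set Site :=
  {v | ∃ u ∈ W, ConnOn (innerBonds (W : Set Site))ᶜ ω u v}

section explored

variable {W k : Finset Site} {ω : Config}

lemma subset_explored : (W : Set Site) ⊆ explored W ω := fun u hu => ⟨u, hu, .refl⟩

lemma explored_step {a b : Site} (ha : a ∈ explored W ω)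
    (h : StepOn (innerBonds (W : Set Site))ᶜ ω a b) : b ∈ explored W ω := by
  obtain ⟨u, hu, hc⟩ := ha
  exact ⟨u, hu, .tail hc h⟩

/-- A closed boundary bond would have been crossed by the exploration; it cannot be an inner bond of
`W`, since `W` lies inside the explored set. -/
lemma explored_eq_subset_allOpen (W k : Finset Site) :
    {ω | explored W ω = k} ⊆ allOpen (edgeBoundary (k : Set Site)) := by
  intro ω hω e he
  have hω : explored W ω = k := hω
  by_contra hne
  have hf : ω e = false := by simpa using hne
  have hWk : (W : Set Site) ⊆ k := hω ▸ subset_explored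
  have hinner : e ∈ (innerBonds (W : Set Site))ᶜ := fun h => he ⟨fun _ => hWk h.2, fun _ => hWk h.1⟩
  apply he
  rw [← hω]
  exact ⟨fun h => explored_step h ⟨e, hinner, hf, e.dualJoins⟩,
    fun h => explored_step h ⟨e, hinner, hf, e.dualJoins.symm⟩⟩

/-- An exploration that stops at `k` examines only bonds touching `k` and never an inner bond of
`W`. The second point keeps it away from the piece around which `W` is built. -/
lemma determinedBy_explored_eq (W k : Finset Site) :
    DeterminedBy {ω | explored W ω = k} {e | e ∈ touchBonds k ∧ e ∉ innerBonds (W : Set Site)} := by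
  intro ω ω' h hω
  have hω : explored W ω = k := hω
  have hagree : ∀ e : Bond, ∀ a b : Site, a ∈ k → e.DualJoins a b →
      e ∉ innerBonds (W : Set Site) → ω e = ω' e := by
    intro e a b ha hj hW
    refine h e ⟨mem_touchBonds.2 ?_, hW⟩
    rcases hj with ⟨rfl, -⟩ | ⟨-, rfl⟩
    · exact .inl ha
    · exact .inr ha
  change explored W ω' = k
  refine Set.Subset.antisymm ?_ ?_
  · rintro v ⟨u, hu, hc⟩
    induction hc with
    | refl => exact hω ▸ subset_explored hu
    | @tail a b hab hs ih =>
      obtain ⟨e, he, hf, hj⟩ := hs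
      have hae := hagree e a b ih hj he
      rw [← hω] at ih ⊢
      exact explored_step ih ⟨e, he, hae.trans hf, hj⟩
  · rw [← hω]
    rintro v ⟨u, hu, hc⟩
    refine ⟨u, hu, ?_⟩
    induction hc with
    | refl => exact .refl
    | @tail a b hab hs ih =>
      obtain ⟨e, he, hf, hj⟩ := hs
      have ha : a ∈ explored W ω := ⟨u, hu, hab⟩
      rw [hω] at ha
      exact .tail ih ⟨e, he, by rw [← hagree e a b ha hj he]; exact hf, hj⟩

lemma dualConnected_of_explored_eq (hW : DualConnected (W : Set Site))
    (hω : explored W ω = k) : DualConnected (k : Set Site) := by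
  have hWk : (W : Set Site) ⊆ k := hω ▸ subset_explored
  have h : ∀ v ∈ k, ∃ u ∈ W, ConnectedIn (k : Set Site) u v := by
    intro v hv
    rw [← Finset.mem_coe, ← hω] at hv
    obtain ⟨u, hu, hc⟩ := hv
    refine ⟨u, hu, ?_⟩
    induction hc with
    | refl => exact ConnectedIn.refl _ _
    | @tail a b hab hs ih =>
      refine .tail ih ⟨?_, hs.imp fun e he => he.2.2⟩
      rw [← hω]
      exact explored_step ⟨u, hu, hab⟩ hs
  intro v hv v' hv'
  obtain ⟨u, hu, h1⟩ := h v hv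
  obtain ⟨u', hu', h2⟩ := h v' hv'
  exact ((h1.symm (hWk hu)).trans ((hW u hu u' hu').mono hWk)).trans h2

end explored

/-- The sites within distance `n` of the bonds of `D`. -/
noncomputable def thicken (D : Finset Bond) (n : ℕ) : Finset Site := D.biUnion fun d => box d.1 n

lemma mem_thicken {D : Finset Bond} {n : ℕ} {v : Site} :
    v ∈ thicken D n ↔ ∃ d ∈ D, supDist d.1 v ≤ n := by
  simp [thicken]

lemma card_thicken_le (D : Finset Bond) (n : ℕ) : (thicken D n).card ≤ D.card * (2 * n + 1) ^ 2 :=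
  Finset.card_biUnion_le_card_mul _ _ _ fun d _ => (card_box d.1 n).le

/-- The bonds of `D` are connected by steps of length at most `l`. -/
def ChainConnected (D : Finset Bond) (l : ℕ) : Prop :=
  ∀ d ∈ D, ∀ d' ∈ D, Relation.ReflTransGen (fun a b => b ∈ D ∧ supDist a.1 b.1 ≤ l) d d'

/-- Two boxes of radius `n` whose centres are within `2 * n` share the rounded midpoint of the
centres. -/
lemma ChainConnected.dualConnected_thicken {D : Finset Bond} {n : ℕ}
    (h : ChainConnected D (2 * n)) : DualConnected (thicken D n : Set Site) := by
  have hbox : ∀ d ∈ D, ∀ v ∈ box d.1 n, v ∈ (thicken D n : Set Site) := fun d hd v hv =>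
    mem_thicken.2 ⟨d, hd, mem_box.1 hv⟩
  have hcentre : ∀ d ∈ D, ∀ d', Relation.ReflTransGen
      (fun a b => b ∈ D ∧ supDist a.1 b.1 ≤ 2 * n) d d' →
      d' ∈ D ∧ ConnectedIn (thicken D n : Set Site) d.1 d'.1 := by
    intro d hd d' hc
    induction hc with
    | refl => exact ⟨hd, ConnectedIn.refl _ _⟩
    | @tail a b _ hs ih =>
      obtain ⟨haD, ih⟩ := ih
      refine ⟨hs.1, ih.trans ?_⟩
      have hs2 := hs.2
      let m : Site := ((a.1.1 + b.1.1) / 2, (a.1.2 + b.1.2) / 2)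
      have ha : m ∈ box a.1 n := by
        simp only [m, mem_box, supDist] at hs2 ⊢; omega
      have hb : m ∈ box b.1 n := by
        simp only [m, mem_box, supDist] at hs2 ⊢; omega
      exact (connectedIn_of_box (hbox a haD) ha).trans
        ((connectedIn_of_box (hbox b hs.1) hb).symm (hbox b hs.1 _ (by simp)))
  intro u hu v hv
  obtain ⟨d, hd, hdu⟩ := mem_thicken.1 hu
  obtain ⟨d', hd', hdv⟩ := mem_thicken.1 hv
  exact (((connectedIn_of_box (hbox d hd) (mem_box.2 hdu)).symm (hbox d hd _ (by simp))).trans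
    (hcentre d hd d' (h d hd d' hd')).2).trans (connectedIn_of_box (hbox d' hd') (mem_box.2 hdv))

/-! ## Decoupling a connected piece -/

/-- The bound in the weak mixing property, for given constants. -/
def WeakMixingWith (P : Measure Config) (C lam : ℝ) : Prop :=
  ∀ 𝒟 ℱ : Set Bond, ∀ E F : Set Config,
    MeasurableSet[cylinderEvents 𝒟] E → MeasurableSet[cylinderEvents ℱ] F → 0 < P F →
    ENNReal.ofReal |(P[|F]).real E - P.real E| ≤ ENNReal.ofReal C * decaySum lam 𝒟 ℱ

variable {P : Measure Config} [IsProbabilityMeasure P]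

lemma WeakMixingWith.abs_sub_le {C lam : ℝ} (hC : 0 < C) (hl : 0 < lam)
    (h : WeakMixingWith P C lam) {R : Finset Bond} {F : Set Bond} (hF : F.Finite) {l : ℕ}
    (hd : ∀ x ∈ endpoints (R : Set Bond), ∀ y ∈ endpoints F, l ≤ supDist x y)
    {T V : Set Config} (hT : DeterminedBy T R) (hV : DeterminedBy V F) :
    |P.real (V ∩ T) - P.real V * P.real T| ≤
      C * (2 * R.card * (decayConst lam * Real.exp (-(lam / 2) * l))) * P.real V := by
  have hVm := hV.measurableSet hF
  have hnn : 0 ≤ 2 * R.card * (decayConst lam * Real.exp (-(lam / 2) * l)) := by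
    have := decayConst_nonneg lam
    positivity
  rcases (measureReal_nonneg (μ := P) (s := V)).eq_or_lt with h0 | h0
  · have h1 : P.real (V ∩ T) ≤ P.real V := measureReal_mono Set.inter_subset_left
    have h2 : 0 ≤ P.real (V ∩ T) := measureReal_nonneg
    rw [← h0] at h1 ⊢
    rw [le_antisymm h1 h2]; simp
  · have key := h R F T V (hT.measurableSet_cylinderEvents R.finite_toSet)
      (hV.measurableSet_cylinderEvents hF) (pos_of_measureReal_pos h0)
    have key2 := key.trans (mul_le_mul_right (decaySum_le hl subset_rfl F hd) (ENNReal.ofReal C))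
    rw [← ENNReal.ofReal_mul hC.le, ENNReal.ofReal_le_ofReal_iff (by positivity),
      cond_real_eq hVm] at key2
    have e : P.real (V ∩ T) - P.real V * P.real T =
        ((P.real V)⁻¹ * P.real (V ∩ T) - P.real T) * P.real V := by
      field_simp
    rw [e, abs_mul, abs_of_pos h0]
    exact mul_le_mul_of_nonneg_right key2 h0.le

/-- The arithmetic of combining ratio bounds for a well-chosen exploration event. -/
lemma mul_le_exp_mul_of_ratio_bounds {e1x z x e1z pe1x pz px pe1z g o δ θ : ℝ} (hδ0 : 0 ≤ δ)
    (hδ : δ ≤ 1 / 3) (ho : 0 < o) (hg : 0 ≤ g) (hz : 0 ≤ pz) (hx : 0 ≤ px)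
    (he1z : 0 ≤ pe1z) (hx0 : 0 ≤ x) (hz0 : 0 ≤ z) (he0 : 0 ≤ e1x) (hez0 : 0 ≤ e1z) (heg : e1x ≤ g)
    (k1 : |e1x - pe1x * o| ≤ δ * (pe1x * o)) (k2 : |z - pz * o| ≤ δ * (pz * o))
    (k3 : |x - px * o| ≤ δ * (px * o)) (k4 : |e1z - pe1z * o| ≤ δ * (pe1z * o))
    (s1 : e1x * o ≤ Real.exp θ * (g * x)) (s2 : z * g ≤ Real.exp θ * (o * e1z)) :
    pe1x * pz ≤ Real.exp (2 * θ + 6 * δ) * (px * pe1z) := by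
  have m1 : (1 - δ) * (pe1x * o) ≤ e1x := by linarith [(abs_le.1 k1).1]
  have m2 : (1 - δ) * (pz * o) ≤ z := by linarith [(abs_le.1 k2).1]
  have m3 : x ≤ (1 + δ) * (px * o) := by linarith [(abs_le.1 k3).2]
  have m4 : e1z ≤ (1 + δ) * (pe1z * o) := by linarith [(abs_le.1 k4).2]
  have hE := Real.exp_pos θ
  -- Multiplying the two exchange inequalities cancels both `o` and `g`; this is why `s2` is taken
  -- in the opposite direction to `s1`.
  have hmain : e1x * z ≤ Real.exp θ * Real.exp θ * (x * e1z) := by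
    rcases hg.eq_or_lt with rfl | hg
    · rw [le_antisymm heg he0, zero_mul]; positivity
    · refine le_of_mul_le_mul_right ?_ (mul_pos ho hg)
      calc e1x * z * (o * g) = (e1x * o) * (z * g) := by ring
        _ ≤ (Real.exp θ * (g * x)) * (Real.exp θ * (o * e1z)) :=
          mul_le_mul s1 s2 (by positivity) (by positivity)
        _ = _ := by ring
  have hexp : Real.exp (2 * θ + 6 * δ) =
      Real.exp θ * Real.exp θ * (Real.exp (3 * δ) * Real.exp (3 * δ)) := by
    rw [← Real.exp_add, ← Real.exp_add, ← Real.exp_add]; ring_nf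
  have h1 := one_add_le_exp_mul_one_sub hδ0 hδ
  have hE3 := Real.exp_pos (3 * δ)
  have hpos : 0 < (1 - δ) * (1 - δ) * (o * o) := by
    have : 0 < 1 - δ := by linarith
    positivity
  refine le_of_mul_le_mul_right ?_ hpos
  have h1' : (0 : ℝ) ≤ 1 - δ := by linarith
  calc pe1x * pz * ((1 - δ) * (1 - δ) * (o * o))
      = ((1 - δ) * (pe1x * o)) * ((1 - δ) * (pz * o)) := by ring
    _ ≤ e1x * z := mul_le_mul m1 m2 (by positivity) he0
    _ ≤ Real.exp θ * Real.exp θ * (x * e1z) := hmain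
    _ ≤ Real.exp θ * Real.exp θ * (((1 + δ) * (px * o)) * ((1 + δ) * (pe1z * o))) := by
        gcongr
    _ = Real.exp θ * Real.exp θ * (((1 + δ) * (1 + δ)) * (px * pe1z * (o * o))) := by ring
    _ ≤ Real.exp θ * Real.exp θ * (((Real.exp (3 * δ) * (1 - δ)) * (Real.exp (3 * δ) * (1 - δ))) *
          (px * pe1z * (o * o))) := by gcongr
    _ = _ := by rw [hexp]; ring

/-- An event on a connected piece may be exchanged between distant events. -/
lemma swap_of_chainConnected {C lam C' a δ δ' ρ : ℝ} (hC : 0 < C) (hl : 0 < lam)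
    (hwm : WeakMixingWith P C lam) (hC' : 0 < C') (ha : 0 < a) (hnm : NearMarkovWith P C' a)
    {s : ℕ} (hs : 3 ≤ s) (hδ : C' * Real.exp (-a * s) ≤ δ) (hδ3 : δ ≤ 1 / 3)
    {D : Finset Bond} (hD : D.Nonempty) (hchain : ChainConnected D (6 * s))
    (hexit : ∀ w, P.real (exitEvent w s) ≤ ρ)
    (hρ : (D.card * (6 * s + 1) ^ 2 : ℝ) * ρ ≤ 1 / 2)
    (hδ'0 : 0 < δ') (hδ'3 : δ' ≤ 1 / 3)
    (hη : 16 * (C * (2 * (4 * (D.card * (8 * s + 1) ^ 2)) *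
      (decayConst lam * Real.exp (-(lam / 2) * s)))) < δ')
    {Y : Set Bond} (hYf : Y.Finite) (hY : ∀ y ∈ Y, ∀ d ∈ D, 6 * s ≤ supDist d.1 y.1)
    {E X Z : Set Config} (hE : DeterminedBy E D) (hX : DeterminedBy X Y) (hZ : DeterminedBy Z Y) :
    P.real (E ∩ X) * P.real Z ≤
      Real.exp (2 * (3 * δ * (4 * (D.card * (8 * s + 1) ^ 2))) + 6 * δ') *
        (P.real X * P.real (E ∩ Z)) := by
  classical
  -- The exploration starts from `W` and should stop inside `N`, that is, within a further distance
  -- `s`. The ring in between is far from both `D` and `Y`.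
  let W := thicken D (3 * s)
  let N := thicken D (4 * s)
  have hWc : DualConnected (W : Set Site) :=
    ChainConnected.dualConnected_thicken (by rwa [show 2 * (3 * s) = 6 * s by ring])
  let I : Finset (Finset Site) := N.powerset.filter fun k => W ⊆ k
  let T : Finset Site → Set Config := fun k => {ω | explored W ω = k}
  let R : Finset Bond := (touchBonds N).filter fun e => e ∉ innerBonds (W : Set Site)
  have hIN : ∀ k ∈ I, k ⊆ N := fun k hk => Finset.mem_powerset.1 (Finset.mem_filter.1 hk).1
  have htouch : ∀ k ⊆ N, touchBonds k ⊆ touchBonds N := fun k hk e he =>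
    mem_touchBonds.2 ((mem_touchBonds.1 he).imp (fun h => hk h) fun h => hk h)
  have hTR : ∀ k ∈ I, DeterminedBy (T k) R := fun k hk =>
    (determinedBy_explored_eq W k).mono fun e he =>
      Finset.mem_coe.2 (Finset.mem_filter.2 ⟨htouch k (hIN k hk) he.1, he.2⟩)
  have hTm : ∀ k ∈ I, MeasurableSet (T k) := fun k hk => (hTR k hk).measurableSet R.finite_toSet
  have hdisj : Set.PairwiseDisjoint (I : Set (Finset Site)) T := by
    intro k _ k' _ hne
    refine Set.disjoint_left.2 fun ω h1 h2 => hne ?_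
    have h1 : explored W ω = k := h1
    have h2 : explored W ω = k' := h2
    exact Finset.coe_injective (h1.symm.trans h2)
  -- Leaving `N` requires a closed dual path of length `s` from a face of `W`.
  have hcover : (⋃ k ∈ I, T k)ᶜ ⊆ ⋃ w ∈ W, exitEvent w s := by
    intro ω hω
    by_contra hno
    simp only [Set.mem_iUnion, not_exists] at hno
    have hsub : explored W ω ⊆ N := by
      rintro v ⟨u, hu, hc⟩
      obtain ⟨d, hd, hdu⟩ := mem_thicken.1 hu
      by_contra hv
      refine hno u hu (mem_exitEvent hc ?_)
      by_contra hlt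
      refine hv (mem_thicken.2 ⟨d, hd, ?_⟩)
      have := supDist_triangle d.1 u v
      omega
    have hfin : (explored W ω).Finite := N.finite_toSet.subset hsub
    apply hω
    refine Set.mem_iUnion₂.2 ⟨hfin.toFinset, ?_, ?_⟩
    · refine Finset.mem_filter.2 ⟨Finset.mem_powerset.2 fun v hv => ?_, fun v hv => ?_⟩
      · exact hsub (hfin.mem_toFinset.1 hv)
      · exact hfin.mem_toFinset.2 (subset_explored hv)
    · exact hfin.coe_toFinset.symm
  have hρ0 : 0 ≤ ρ := measureReal_nonneg.trans (hexit 0)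
  have hmass : 1 / 2 ≤ P.real (⋃ k ∈ I, T k) := by
    have h1 : P.real (⋃ k ∈ I, T k)ᶜ ≤ 1 / 2 := by
      calc P.real (⋃ k ∈ I, T k)ᶜ ≤ P.real (⋃ w ∈ W, exitEvent w s) :=
            measureReal_mono hcover (measure_ne_top _ _)
        _ ≤ ∑ w ∈ W, P.real (exitEvent w s) := measureReal_biUnion_finset_le _ _
        _ ≤ ∑ w ∈ W, ρ := Finset.sum_le_sum fun w _ => hexit w
        _ = W.card * ρ := by rw [Finset.sum_const, nsmul_eq_mul]
        _ ≤ (D.card * (6 * s + 1) ^ 2 : ℝ) * ρ := by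
          gcongr
          have := card_thicken_le D (3 * s)
          rw [show 2 * (3 * s) + 1 = 6 * s + 1 by ring] at this
          exact_mod_cast this
        _ ≤ 1 / 2 := hρ
    rw [probReal_compl_eq_one_sub (Finset.measurableSet_biUnion _ hTm)] at h1
    linarith
  have hRcard : (R.card : ℝ) ≤ 4 * (D.card * (8 * s + 1) ^ 2) := by
    have h1 : R.card ≤ (touchBonds N).card := Finset.card_filter_le _ _
    have h2 := card_touchBonds_le N
    have h3 := card_thicken_le D (4 * s)
    rw [show 2 * (4 * s) + 1 = 8 * s + 1 by ring] at h3
    have h4 : R.card ≤ 4 * (D.card * (8 * s + 1) ^ 2) := by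
      calc R.card ≤ 4 * N.card := h1.trans h2
        _ ≤ _ := by gcongr
    exact_mod_cast h4
  have hend : ∀ {F : Set Bond} {x : Site}, x ∈ endpoints F → ∃ e ∈ F, supDist e.1 x ≤ 1 := by
    rintro F x ⟨e, he, rfl | rfl⟩
    · exact ⟨e, he, by rw [e.supDist_src]; omega⟩
    · exact ⟨e, he, e.supDist_tgt.le⟩
  -- Bonds of `R` are at distance at least `3 * s` from all of `D` and at most `4 * s + 1` from some
  -- bond of it. Passing to endpoints costs 2, and `6 * s - (4 * s + 1) - 2 ≥ s` requires `3 ≤ s`.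
  have hdist : ∀ x ∈ endpoints (R : Set Bond), ∀ y ∈ endpoints ((D : Set Bond) ∪ Y),
      s ≤ supDist x y := by
    intro x hx y hy
    obtain ⟨e, he, hex⟩ := hend hx
    obtain ⟨f, hf, hfy⟩ := hend hy
    obtain ⟨he1, he2⟩ := Finset.mem_filter.1 he
    have hfar : ∀ d ∈ D, 3 * s ≤ supDist d.1 e.1 := by
      intro d hd
      by_contra hlt
      refine he2 ⟨mem_thicken.2 ⟨d, hd, ?_⟩, mem_thicken.2 ⟨d, hd, ?_⟩⟩
      · have := supDist_triangle d.1 e.1 e.dualSrc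
        have := e.supDist_dualSrc
        omega
      · change supDist d.1 e.1 ≤ _
        omega
    have hnear : ∃ d ∈ D, supDist d.1 e.1 ≤ 4 * s + 1 := by
      rcases mem_touchBonds.1 he1 with h | h
      · obtain ⟨d, hd, hdd⟩ := mem_thicken.1 h
        refine ⟨d, hd, ?_⟩
        have := supDist_triangle d.1 e.dualSrc e.1
        have := e.supDist_dualSrc
        rw [supDist_comm] at this
        omega
      · obtain ⟨d, hd, hdd⟩ := mem_thicken.1 h
        exact ⟨d, hd, le_trans hdd (by omega)⟩
    have t1 := supDist_triangle e.1 x f.1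
    have t2 := supDist_triangle x y f.1
    rw [supDist_comm] at hfy
    rcases hf with hf | hf
    · have := hfar f hf
      rw [supDist_comm] at this
      omega
    · obtain ⟨d, hd, hdd⟩ := hnear
      have := hY f hf d hd
      have t3 := supDist_triangle d.1 e.1 f.1
      omega
  have hDY : ((D : Set Bond) ∪ Y).Finite := D.finite_toSet.union hYf
  let J : Finset (Set Config) := {E ∩ X, Z, X, E ∩ Z}
  have hJD : ∀ V ∈ J, DeterminedBy V ((D : Set Bond) ∪ Y) := by
    have hE' := hE.mono (Set.subset_union_left (t := Y))
    have hX' := hX.mono (Set.subset_union_right (s := (D : Set Bond)))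
    have hZ' := hZ.mono (Set.subset_union_right (s := (D : Set Bond)))
    intro V hV
    simp only [J, Finset.mem_insert, Finset.mem_singleton] at hV
    rcases hV with rfl | rfl | rfl | rfl
    · exact hE'.inter hX'
    · exact hZ'
    · exact hX'
    · exact hE'.inter hZ'
  set η : ℝ := C * (2 * (4 * (D.card * (8 * s + 1) ^ 2)) *
      (decayConst lam * Real.exp (-(lam / 2) * s))) with hηdef
  have hdc := decayConst_nonneg lam
  have hη0 : 0 ≤ η := by positivity
  have hmix : ∀ V ∈ J, ∀ Q ⊆ I,
      |P.real (V ∩ ⋃ i ∈ Q, T i) - P.real V * P.real (⋃ i ∈ Q, T i)| ≤ η * P.real V := by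
    intro V hV Q hQ
    have hTQ : DeterminedBy (⋃ i ∈ Q, T i) R :=
      DeterminedBy.iUnion fun i => DeterminedBy.iUnion fun hi => hTR i (hQ hi)
    refine (hwm.abs_sub_le hC hl hDY hdist hTQ (hJD V hV)).trans ?_
    rw [hηdef]
    gcongr
  have hJc : (J.card : ℝ) ≤ 4 := by exact_mod_cast Finset.card_le_four
  -- The factor 16 in `hη` is 2 signs, times 4 events, divided by the mass 1/2.
  obtain ⟨k, hk, hkpos, hgood⟩ := exists_forall_abs_sub_le I T hTm hdisj J hδ'0 hmix (by
    calc 2 * (J.card : ℝ) * η ≤ 2 * 4 * η := by gcongr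
      _ < δ' * (1 / 2) := by linarith
      _ ≤ _ := by gcongr) hη0
  obtain ⟨hkN, hWk⟩ := Finset.mem_filter.1 hk
  have hkN := Finset.mem_powerset.1 hkN
  obtain ⟨ω₀, hω₀⟩ : (T k).Nonempty := by
    by_contra hempty
    rw [Set.not_nonempty_iff_eq_empty.1 hempty] at hkpos
    simp at hkpos
  have hkc : DualConnected (k : Set Site) := dualConnected_of_explored_eq hWc hω₀
  obtain ⟨d₀, hd₀⟩ := hD
  have hbox : ∀ w ∈ box d₀.1 s, w ∈ k := fun w hw =>
    hWk (mem_thicken.2 ⟨d₀, hd₀, (mem_box.1 hw).trans (by omega)⟩)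
  have hTk : DeterminedBy (T k) (touchBonds k) :=
    (determinedBy_explored_eq W k).mono fun e he => he.1
  have hTo := explored_eq_subset_allOpen W k
  have hEk : DeterminedBy E (touchBonds k) := hE.mono fun d hd =>
    mem_touchBonds.2 (.inr (hWk (mem_thicken.2 ⟨d, hd, by
      change supDist d.1 d.1 ≤ _
      simp⟩)))
  have hYk : ∀ y ∈ Y, ∀ w, supDist y.1 w ≤ s → w ∉ k := by
    intro y hy w hw hwk
    obtain ⟨d, hd, hdw⟩ := mem_thicken.1 (hkN hwk)
    have := hY y hy d hd
    have := supDist_triangle d.1 w y.1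
    rw [supDist_comm] at hw
    omega
  have hYin : Y ⊆ innerBonds (k : Set Site)ᶜ := fun y hy =>
    ⟨hYk y hy _ (by rw [y.supDist_dualSrc]; omega), hYk y hy _ (by change supDist y.1 y.1 ≤ s; simp)⟩
  have hYb : ∀ y ∈ Y, ∀ w ∈ box y.1 s, w ∉ k := fun y hy w hw => hYk y hy w (mem_box.1 hw)
  have hδ0 : 0 ≤ δ := le_trans (by positivity) hδ
  -- `E ∩ T k` and `T k` are exchanged against `X` here, and in the reverse order against `Z` below,
  -- so that the probability of `E ∩ T k` cancels.
  have sw1 := hnm.swap_outside hC' ha hδ hδ3 hkc hbox (hEk.inter hTk) hTk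
    (Set.inter_subset_right.trans hTo) hTo hYf hYin hYb hX
  have sw2 := hnm.swap_outside hC' ha hδ hδ3 hkc hbox hTk (hEk.inter hTk)
    hTo (Set.inter_subset_right.trans hTo) hYf hYin hYb hZ
  have hθ : 3 * δ * (touchBonds k).card ≤ 3 * δ * (4 * (D.card * (8 * s + 1) ^ 2)) := by
    gcongr
    have h2 := card_touchBonds_le k
    have h3 := card_thicken_le D (4 * s)
    rw [show 2 * (4 * s) + 1 = 8 * s + 1 by ring] at h3
    have h4 : (touchBonds k).card ≤ 4 * (D.card * (8 * s + 1) ^ 2) := by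
      calc _ ≤ 4 * k.card := h2
        _ ≤ 4 * N.card := by gcongr
        _ ≤ _ := by gcongr
    exact_mod_cast h4
  have hexp := Real.exp_le_exp.2 hθ
  have g1 := hgood (E ∩ X) (by simp [J])
  have g2 := hgood Z (by simp [J])
  have g3 := hgood X (by simp [J])
  have g4 := hgood (E ∩ Z) (by simp [J])
  have e1 : E ∩ T k ∩ X = E ∩ X ∩ T k := Set.inter_right_comm _ _ _
  have e2 : E ∩ T k ∩ Z = E ∩ Z ∩ T k := Set.inter_right_comm _ _ _
  rw [e1, Set.inter_comm (T k) X] at sw1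
  rw [e2, Set.inter_comm (T k) Z] at sw2
  exact mul_le_exp_mul_of_ratio_bounds hδ'0.le hδ'3 hkpos measureReal_nonneg measureReal_nonneg
    measureReal_nonneg measureReal_nonneg measureReal_nonneg measureReal_nonneg
    measureReal_nonneg measureReal_nonneg
    (measureReal_mono (Set.inter_subset_inter_left _ Set.inter_subset_left)) g1 g2 g3 g4
    (sw1.trans (mul_le_mul_of_nonneg_right hexp
      (mul_nonneg measureReal_nonneg measureReal_nonneg)))
    (sw2.trans (mul_le_mul_of_nonneg_right hexp
      (mul_nonneg measureReal_nonneg measureReal_nonneg)))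

/-! ## Decoupling of distant sets of bonds -/

/-- The bound in the decoupling property, at distance `m`. -/
def DecouplingAt (P : Measure Config) (κ : ℝ) (m : ℕ) : Prop :=
  ∀ (D : Finset Bond) (X : Set Bond), X.Finite →
    (D.card : ℝ) ≤ Real.exp (κ * m) → (∀ x ∈ X, ∀ d ∈ D, m ≤ supDist d.1 x.1) →
    ∀ E F : Set Config, DeterminedBy E X → DeterminedBy F D →
      P.real (E ∩ F) ≤ (1 + Real.exp (-κ * m)) * (P.real E * P.real F)

/-- Distant events are independent up to a factor near one, one of the sets of bonds being not too
large. -/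
def Decoupling (P : Measure Config) : Prop :=
  ∃ κ : ℝ, 0 < κ ∧ ∀ᶠ m : ℕ in atTop, DecouplingAt P κ m

lemma eventually_mul_pow_mul_exp_le (K : ℝ) (p : ℕ) {b : ℝ} (hb : 0 < b) :
    ∀ᶠ s : ℕ in atTop, K * (8 * s + 1) ^ p * Real.exp (-b * s) ≤ 1 := by
  have h1 : Tendsto (fun s : ℕ => b * (s : ℝ)) atTop atTop :=
    tendsto_natCast_atTop_atTop.const_mul_atTop hb
  have h2 := ((Real.tendsto_pow_mul_exp_neg_atTop_nhds_zero p).comp h1).const_mul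
    (|K| * 9 ^ p / b ^ p)
  rw [mul_zero] at h2
  filter_upwards [h2.eventually_le_const one_pos, eventually_ge_atTop 1] with s hs hs1
  refine le_trans ?_ hs
  have hs1' : (1 : ℝ) ≤ s := by exact_mod_cast hs1
  calc K * (8 * s + 1) ^ p * Real.exp (-b * s)
      ≤ |K| * (9 * s) ^ p * Real.exp (-b * s) := by
        gcongr
        · exact le_abs_self K
        · linarith
    _ = _ := by
        simp only [Function.comp, mul_pow, neg_mul]
        field_simp

lemma exists_supDist_le_of_mem_endpoints {F : Set Bond} {x : Site} (hx : x ∈ endpoints F) :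
    ∃ e ∈ F, supDist e.1 x ≤ 1 := by
  obtain ⟨e, he, rfl | rfl⟩ := hx
  · exact ⟨e, he, by rw [e.supDist_src]; omega⟩
  · exact ⟨e, he, e.supDist_tgt.le⟩

variable {P : Measure Config} [IsProbabilityMeasure P]

/-- The decay sum has rate λ/2: λ/8 of it cancels the size of `D`, λ/8 remains as the error, and λ/4
absorbs the constants. Passing from bonds to endpoints loses 2 in the distance. -/
lemma RatioWeakMixing.decoupling (h : RatioWeakMixing P) : Decoupling P := by
  obtain ⟨C, lam, hC, hl, h⟩ := h
  refine ⟨lam / 8, by positivity, ?_⟩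
  filter_upwards [eventually_mul_pow_mul_exp_le (2 * (C * (2 * decayConst lam * Real.exp lam))) 0
    (b := lam / 4) (by positivity), eventually_ge_atTop 2] with m hm hm2
  intro D X hX hD hdist E F hE hF
  have hdc := decayConst_nonneg lam
  have hb : ENNReal.ofReal C * decaySum lam D X ≤ ENNReal.ofReal (Real.exp (-(lam / 8) * m) / 2) := by
    have hd : ∀ x ∈ endpoints (D : Set Bond), ∀ y ∈ endpoints X, m - 2 ≤ supDist x y := by
      intro x hx y hy
      obtain ⟨d, hd, hdx⟩ := exists_supDist_le_of_mem_endpoints hx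
      obtain ⟨e, he, hey⟩ := exists_supDist_le_of_mem_endpoints hy
      have h1 := hdist e he d hd
      have h2 := supDist_triangle d.1 x e.1
      have h3 := supDist_triangle x y e.1
      rw [supDist_comm] at hey
      omega
    refine (mul_le_mul_right (decaySum_le hl subset_rfl X hd) _).trans ?_
    rw [← ENNReal.ofReal_mul hC.le]
    refine ENNReal.ofReal_le_ofReal ?_
    rw [Nat.cast_sub hm2]
    push_cast
    rw [pow_zero, mul_one] at hm
    have e1 : Real.exp (-(lam / 2) * (m - 2)) = Real.exp lam * Real.exp (-(lam / 4) * m) *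
        Real.exp (-(lam / 8) * m) * Real.exp (-(lam / 8) * m) := by
      rw [← Real.exp_add, ← Real.exp_add, ← Real.exp_add]; ring_nf
    have e2 : Real.exp (lam / 8 * m) * Real.exp (-(lam / 8) * m) = 1 := by
      rw [← Real.exp_add]; ring_nf; exact Real.exp_zero
    have hx := Real.exp_pos (-(lam / 8) * m)
    calc C * (2 * D.card * (decayConst lam * Real.exp (-(lam / 2) * (m - 2))))
        ≤ C * (2 * Real.exp (lam / 8 * m) *
          (decayConst lam * Real.exp (-(lam / 2) * (m - 2)))) := by gcongr
      _ = (2 * (C * (2 * decayConst lam * Real.exp lam)) * Real.exp (-(lam / 4) * m)) *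
          (Real.exp (lam / 8 * m) * Real.exp (-(lam / 8) * m)) *
          Real.exp (-(lam / 8) * m) / 2 := by rw [e1]; ring
      _ ≤ 1 * 1 * Real.exp (-(lam / 8) * m) / 2 := by rw [e2]; gcongr
      _ = _ := by ring
  have hlt : Real.exp (-(lam / 8) * m) / 2 < 1 := by
    have : Real.exp (-(lam / 8) * m) ≤ 1 := by
      rw [Real.exp_le_one_iff]
      have : (0 : ℝ) ≤ m := Nat.cast_nonneg _
      nlinarith
    linarith
  have hE0 : 0 ≤ P.real E := measureReal_nonneg
  have hF0 : 0 ≤ P.real F := measureReal_nonneg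
  have hpos := Real.exp_pos (-(lam / 8) * m)
  rcases hE0.eq_or_lt with hE1 | hE1
  · have : P.real (E ∩ F) ≤ P.real E := measureReal_mono Set.inter_subset_left
    rw [← hE1] at this
    exact this.trans (by positivity)
  rcases hF0.eq_or_lt with hF1 | hF1
  · have : P.real (E ∩ F) ≤ P.real F := measureReal_mono Set.inter_subset_right
    rw [← hF1] at this
    exact this.trans (by positivity)
  have key := (h D X (hb.trans_lt (by
      rw [← ENNReal.ofReal_one]
      exact (ENNReal.ofReal_lt_ofReal_iff one_pos).2 hlt)) F E
    (hF.measurableSet_cylinderEvents D.finite_toSet) (hE.measurableSet_cylinderEvents hX)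
    (ENNReal.mul_pos (pos_of_measureReal_pos hF1).ne' (pos_of_measureReal_pos hE1).ne')).trans hb
  rw [ENNReal.ofReal_le_ofReal_iff (by positivity)] at key
  have k2 := (abs_le.1 key).2
  have k3 : P.real (F ∩ E) / (P.real F * P.real E) ≤ 1 + Real.exp (-(lam / 8) * m) := by linarith
  rw [div_le_iff₀ (mul_pos hF1 hE1)] at k3
  rw [Set.inter_comm, mul_comm (P.real E)]
  exact k3

/-! ### Decoupling from weak mixing and the near-Markov property -/

/-- Peeling off chain-connected pieces one at a time. -/
lemma measureReal_inter_agreeOn_le_of_swap {s M : ℕ} {θ : ℝ} (hθ : 0 ≤ θ)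
    (hswap : ∀ D : Finset Bond, D.Nonempty → D.card ≤ M → ChainConnected D (6 * s) →
      ∀ Y : Set Bond, Y.Finite → (∀ y ∈ Y, ∀ d ∈ D, 6 * s ≤ supDist d.1 y.1) →
      ∀ E X Z : Set Config, DeterminedBy E D → DeterminedBy X Y → DeterminedBy Z Y →
      P.real (E ∩ X) * P.real Z ≤ Real.exp θ * (P.real X * P.real (E ∩ Z)))
    {X : Set Bond} (hX : X.Finite) {E : Set Config} (hE : DeterminedBy E X) (η : Config) :
    ∀ D : Finset Bond, D.card ≤ M → (∀ x ∈ X, ∀ d ∈ D, 6 * s ≤ supDist d.1 x.1) →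
      P.real (E ∩ agreeOn D η) ≤ Real.exp (D.card * θ) * (P.real E * P.real (agreeOn D η)) := by
  classical
  intro D
  induction D using Finset.strongInduction with
  | H D ih =>
    intro hM hdist
    rcases D.eq_empty_or_nonempty with rfl | ⟨d₀, hd₀⟩
    · have : agreeOn ((∅ : Finset Bond) : Set Bond) η = Set.univ := by
        ext; simp [agreeOn]
      rw [this]; simp
    -- The chain component of `d₀`; by maximality the rest of `D` is at distance more than `6 * s`
    -- from it.
    let D₁ : Finset Bond := D.filter fun d =>
      Relation.ReflTransGen (fun a b => b ∈ D ∧ supDist a.1 b.1 ≤ 6 * s) d₀ d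
    have hd₁ : d₀ ∈ D₁ := Finset.mem_filter.2 ⟨hd₀, .refl⟩
    have hfrom : ∀ d ∈ D₁,
        Relation.ReflTransGen (fun a b => b ∈ D₁ ∧ supDist a.1 b.1 ≤ 6 * s) d₀ d ∧
        Relation.ReflTransGen (fun a b => b ∈ D₁ ∧ supDist a.1 b.1 ≤ 6 * s) d d₀ := by
      intro d hd
      have hc := (Finset.mem_filter.1 hd).2
      clear hd
      induction hc with
      | refl => exact ⟨.refl, .refl⟩
      | @tail a b hab hs ih =>
        have hb : b ∈ D₁ := Finset.mem_filter.2 ⟨hs.1, .tail hab hs⟩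
        have ha : a ∈ D₁ := by
          refine Finset.mem_filter.2 ⟨?_, hab⟩
          rcases Relation.ReflTransGen.cases_tail hab with h | ⟨c, _, h⟩
          · rwa [h]
          · exact h.1
        refine ⟨.tail ih.1 ⟨hb, hs.2⟩, .head ⟨ha, ?_⟩ ih.2⟩
        rw [supDist_comm]
        exact hs.2
    have hchain : ChainConnected D₁ (6 * s) := fun d hd d' hd' =>
      (hfrom d hd).2.trans (hfrom d' hd').1
    let D₂ : Finset Bond := D \ D₁
    have hsub₁ : D₁ ⊆ D := Finset.filter_subset _ _
    have hsub₂ : D₂ ⊆ D := Finset.sdiff_subset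
    have hss : D₂ ⊂ D := Finset.ssubset_iff_subset_ne.2 ⟨hsub₂, fun h => by
      have : d₀ ∈ D₂ := h ▸ hd₀
      exact (Finset.mem_sdiff.1 this).2 hd₁⟩
    have hfar : ∀ y ∈ D₂, ∀ d ∈ D₁, 6 * s ≤ supDist d.1 y.1 := by
      intro y hy d hd
      by_contra hlt
      obtain ⟨hyD, hy₁⟩ := Finset.mem_sdiff.1 hy
      exact hy₁ (Finset.mem_filter.2 ⟨hyD, .tail (Finset.mem_filter.1 hd).2 ⟨hyD, by omega⟩⟩)
    have hIH := ih D₂ hss ((Finset.card_le_card hsub₂).trans hM) fun x hx d hd =>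
      hdist x hx d (hsub₂ hd)
    have hag : agreeOn (D : Set Bond) η = agreeOn D₁ η ∩ agreeOn D₂ η := by
      rw [← agreeOn_union, ← Finset.coe_union, Finset.union_sdiff_of_subset hsub₁]
    -- The rest of `D` joins the distant bonds. The pattern on `D₁` is exchanged between `E`
    -- together with the pattern on `D₂`, and the pattern on `D₂` alone.
    have hsw := hswap D₁ ⟨d₀, hd₁⟩ ((Finset.card_le_card hsub₁).trans hM) hchain
      (X ∪ D₂) (hX.union D₂.finite_toSet)
      (fun y hy d hd => hy.elim (fun h => hdist y h d (hsub₁ hd)) fun h => hfar y h d hd)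
      (agreeOn D₁ η) (E ∩ agreeOn D₂ η) (agreeOn D₂ η) (determinedBy_agreeOn _ _)
      ((hE.mono Set.subset_union_left).inter
        ((determinedBy_agreeOn _ _).mono Set.subset_union_right))
      ((determinedBy_agreeOn _ _).mono Set.subset_union_right)
    rw [← hag, Set.inter_left_comm, ← hag] at hsw
    have hcard : (D.card : ℝ) * θ ≥ D₂.card * θ + θ := by
      have : D₂.card + 1 ≤ D.card := Finset.card_lt_card hss
      have : (D₂.card : ℝ) + 1 ≤ D.card := by exact_mod_cast this
      nlinarith
    have hexp : Real.exp (D₂.card * θ) * Real.exp θ ≤ Real.exp (D.card * θ) := by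
      rw [← Real.exp_add]
      exact Real.exp_le_exp.2 hcard
    have hE0 : 0 ≤ P.real E := measureReal_nonneg
    have ha0 : 0 ≤ P.real (agreeOn D η) := measureReal_nonneg
    rcases (measureReal_nonneg (μ := P) (s := agreeOn D₂ η)).eq_or_lt with h0 | h0
    · have h1 : P.real (E ∩ agreeOn D η) ≤ P.real (agreeOn D₂ η) := by
        rw [hag]
        exact measureReal_mono fun ω hω => hω.2.2
      rw [← h0] at h1
      exact h1.trans (by positivity)
    · refine le_of_mul_le_mul_right ?_ h0
      calc P.real (E ∩ agreeOn D η) * P.real (agreeOn D₂ η)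
          ≤ Real.exp θ * (P.real (E ∩ agreeOn D₂ η) * P.real (agreeOn D η)) := hsw
        _ ≤ Real.exp θ * ((Real.exp (D₂.card * θ) * (P.real E * P.real (agreeOn D₂ η))) *
            P.real (agreeOn D η)) := by gcongr
        _ = (Real.exp (D₂.card * θ) * Real.exp θ) * (P.real E * P.real (agreeOn D η)) *
            P.real (agreeOn D₂ η) := by ring
        _ ≤ _ := by gcongr

lemma exp_le_one_add_of_le {x y : ℝ} (hx : 0 ≤ x) (h : x ≤ y / 2) (hy : y ≤ 1) :
    Real.exp x ≤ 1 + y := by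
  have h1 := Real.abs_exp_sub_one_le (x := x) (by rw [abs_of_nonneg hx]; linarith)
  rw [abs_of_nonneg hx] at h1
  linarith [(abs_le.1 h1).2]

set_option maxHeartbeats 1000000 in
-- All three decay rates are replaced by a common μ, and `D` may grow only at rate μ/100. Each piece
-- costs exp(θ) with θ decaying exponentially, there are at most `D.card` pieces, and the product is
-- still exponentially small.
lemma decoupling_of_weakMixing_of_nearMarkov (ht : TranslationInvariant P) (hd : DualExpDecay P)
    (hwm : WeakMixing P) (hnm : NearMarkov P) : Decoupling P := by
  obtain ⟨Cd, c, hCd, hc, hd⟩ := hd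
  obtain ⟨C, lam, hC, hl, hwm⟩ := hwm
  obtain ⟨C', a, hC', ha, hnm⟩ := hnm
  have hwm : WeakMixingWith P C lam := hwm
  have hnm : NearMarkovWith P C' a := hnm
  have hd : DualDecayWith P Cd c := hd
  have hdc := decayConst_nonneg lam
  let μ := min (lam / 2) (min a c)
  have hμ : 0 < μ := lt_min (by positivity) (lt_min ha hc)
  have hμl : μ ≤ lam / 2 := min_le_left _ _
  have hμa : μ ≤ a := (min_le_right _ _).trans (min_le_left _ _)
  have hμc : μ ≤ c := (min_le_right _ _).trans (min_le_right _ _)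
  let L := Real.exp (6 * (μ / 100))
  have hL : 0 < L := Real.exp_pos _
  have key : ∀ᶠ s : ℕ in atTop, ∀ m : ℕ, 6 * s ≤ m → m ≤ 6 * s + 6 →
      ∀ (D : Finset Bond) (X : Set Bond), X.Finite →
      (D.card : ℝ) ≤ Real.exp (μ / 100 * m) → (∀ x ∈ X, ∀ d ∈ D, m ≤ supDist d.1 x.1) →
      ∀ E F : Set Config, DeterminedBy E X → DeterminedBy F D →
        P.real (E ∩ F) ≤ (1 + Real.exp (-(μ / 100) * m)) * (P.real E * P.real F) := by
    -- Rates in percent of μ, with s about m/6: each factor `D.card` costs 6, the target error costs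
    -- 6, and `δ'` costs 50. Thus 94 = 100 - 6, 44 = 94 - 50, 82 = 100 - 3 · 6 and 38 = 50 - 2 · 6.
    -- The constant `L` compensates for rounding `m` to a multiple of 6.
    filter_upwards [eventually_ge_atTop 3,
      eventually_mul_pow_mul_exp_le (3 * C') 0 hμ,
      eventually_mul_pow_mul_exp_le (2 * (L * Cd)) 4 (b := μ * 94 / 100) (by positivity),
      eventually_mul_pow_mul_exp_le 3 0 (b := μ / 2) (by positivity),
      eventually_mul_pow_mul_exp_le (2 * (128 * C * L * decayConst lam)) 2 (b := μ * 44 / 100)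
        (by positivity),
      eventually_mul_pow_mul_exp_le (96 * C' * L ^ 3) 2 (b := μ * 82 / 100) (by positivity),
      eventually_mul_pow_mul_exp_le (24 * L ^ 2) 0 (b := μ * 38 / 100) (by positivity)]
      with s hs h1 h2 h3 h4 h5 h6
    intro m hm1 hm2 D X hX hD hdist E F hE hF
    have hs0 : (0 : ℝ) ≤ s := Nat.cast_nonneg s
    let q := Real.exp (μ * 6 / 100 * s)
    have hq : 0 < q := Real.exp_pos _
    have hDq : ∀ D' : Finset Bond, D'.card ≤ D.card → (D'.card : ℝ) ≤ L * q := by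
      intro D' hD'
      have i1 : (D'.card : ℝ) ≤ D.card := by exact_mod_cast hD'
      have i2 : (m : ℝ) ≤ 6 * s + 6 := by exact_mod_cast hm2
      refine (i1.trans hD).trans ?_
      rw [← Real.exp_add]
      exact Real.exp_le_exp.2 (by nlinarith)
    simp only [pow_zero, mul_one] at h1 h3 h6
    have hsplit : ∀ x y : ℝ, Real.exp (-x * s) * Real.exp (-y * s) = Real.exp (-(x + y) * s) := by
      intro x y; rw [← Real.exp_add]; ring_nf
    have hqe : ∀ x : ℝ, q * Real.exp (-x * s) = Real.exp (-(x - μ * 6 / 100) * s) := by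
      intro x; simp only [q]; rw [← Real.exp_add]; ring_nf
    have hexpmono : ∀ x : ℝ, μ ≤ x → Real.exp (-x * s) ≤ Real.exp (-μ * s) := fun x hx =>
      Real.exp_le_exp.2 (by nlinarith)
    let δ := C' * Real.exp (-μ * s)
    let δ' := Real.exp (-(μ / 2) * s)
    have hδ0 : 0 ≤ δ := by positivity
    have hδ'0 : 0 < δ' := Real.exp_pos _
    have hδ3 : δ ≤ 1 / 3 := by simp only [δ]; linarith
    have hδ'3 : δ' ≤ 1 / 3 := by simp only [δ']; linarith
    let θ := 2 * (3 * δ * (4 * (L * q * (8 * s + 1) ^ 2))) + 6 * δ'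
    have hθ0 : 0 ≤ θ := by positivity
    have hswap : ∀ D' : Finset Bond, D'.Nonempty → D'.card ≤ D.card →
        ChainConnected D' (6 * s) →
        ∀ Y : Set Bond, Y.Finite → (∀ y ∈ Y, ∀ d ∈ D', 6 * s ≤ supDist d.1 y.1) →
        ∀ E X Z : Set Config, DeterminedBy E D' → DeterminedBy X Y → DeterminedBy Z Y →
        P.real (E ∩ X) * P.real Z ≤ Real.exp θ * (P.real X * P.real (E ∩ Z)) := by
      intro D' hne hD' hch Y hYf hY E X Z hE hX hZ
      have hcard := hDq D' hD'
      refine (swap_of_chainConnected hC hl hwm hC' ha hnm hs (δ := δ) (δ' := δ')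
        (ρ := (2 * s + 1) ^ 2 * (Cd * Real.exp (-c * s))) ?_ hδ3 hne hch
        (fun w => measureReal_exitEvent_le ht hCd hc hd w s) ?_ hδ'0 hδ'3 ?_ hYf hY hE hX hZ).trans ?_
      · exact mul_le_mul_of_nonneg_left (hexpmono a hμa) hC'.le
      · have hp : (6 * (s : ℝ) + 1) ^ 2 * (2 * s + 1) ^ 2 ≤ (8 * s + 1) ^ 4 := by
          calc (6 * (s : ℝ) + 1) ^ 2 * (2 * s + 1) ^ 2 ≤ (8 * s + 1) ^ 2 * (8 * s + 1) ^ 2 := by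
                gcongr <;> linarith
            _ = _ := by ring
        calc (D'.card * (6 * s + 1) ^ 2 : ℝ) * ((2 * s + 1) ^ 2 * (Cd * Real.exp (-c * s)))
            = D'.card * ((6 * (s : ℝ) + 1) ^ 2 * (2 * s + 1) ^ 2) * (Cd * Real.exp (-c * s)) := by
              ring
          _ ≤ (L * q) * (8 * s + 1) ^ 4 * (Cd * Real.exp (-μ * s)) := by
              gcongr
          _ = L * Cd * (8 * s + 1) ^ 4 * (q * Real.exp (-μ * s)) := by ring
          _ ≤ 1 / 2 := by
              rw [hqe, show μ - μ * 6 / 100 = μ * 94 / 100 by ring]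
              linarith
      · calc 16 * (C * (2 * (4 * (D'.card * (8 * s + 1) ^ 2)) *
              (decayConst lam * Real.exp (-(lam / 2) * s))))
            ≤ 16 * (C * (2 * (4 * ((L * q) * (8 * s + 1) ^ 2)) *
              (decayConst lam * Real.exp (-μ * s)))) := by
              gcongr ?_ * (?_ * (?_ * (?_ * (?_ * ?_)) * (?_ * ?_)))
              exact hexpmono _ hμl
          _ = 128 * C * L * decayConst lam * (8 * s + 1) ^ 2 * (q * Real.exp (-μ * s)) := by ring
          _ = (128 * C * L * decayConst lam * (8 * s + 1) ^ 2 * Real.exp (-(μ * 44 / 100) * s)) *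
              δ' := by
              rw [hqe, mul_assoc _ _ δ', hsplit]; ring_nf
          _ ≤ 1 / 2 * δ' := by gcongr; linarith
          _ < δ' := by linarith
      · refine mul_le_mul_of_nonneg_right (Real.exp_le_exp.2 ?_) (by positivity)
        change _ ≤ 2 * (3 * δ * (4 * (L * q * (8 * s + 1) ^ 2))) + 6 * δ'
        gcongr
    have hst : P.real (E ∩ F) ≤ Real.exp (D.card * θ) * (P.real E * P.real F) := by
      have := measureReal_inter_le_of_atoms P D.finite_toSet (U := E) (V := Set.univ) (a := 1)
        (b := Real.exp (D.card * θ) * P.real E) (fun η => ?_) hF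
      · rw [Set.univ_inter] at this; linarith
      · have := measureReal_inter_agreeOn_le_of_swap hθ0 hswap hX hE η D le_rfl
          fun x hx d hd => hm1.trans (hdist x hx d hd)
        rw [Set.univ_inter]; linarith
    refine hst.trans ?_
    gcongr
    have hnum : (D.card : ℝ) * θ ≤ Real.exp (-(μ / 100) * m) / 2 := by
      have i2 : (m : ℝ) ≤ 6 * s + 6 := by exact_mod_cast hm2
      have i3 : L⁻¹ * Real.exp (-(μ * 6 / 100) * s) ≤ Real.exp (-(μ / 100) * m) := by
        simp only [L]
        rw [← Real.exp_neg, ← Real.exp_add]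
        exact Real.exp_le_exp.2 (by nlinarith)
      have i4 : (D.card : ℝ) * θ ≤ L * q * θ := mul_le_mul_of_nonneg_right (hDq D le_rfl) hθ0
      have a1 : L * q * (2 * (3 * δ * (4 * (L * q * (8 * s + 1) ^ 2)))) ≤
          L⁻¹ * Real.exp (-(μ * 6 / 100) * s) / 4 := by
        calc L * q * (2 * (3 * δ * (4 * (L * q * (8 * s + 1) ^ 2))))
            = (96 * C' * L ^ 3 * (8 * s + 1) ^ 2 * (q * (q * Real.exp (-μ * s)))) *
              L⁻¹ / 4 := by simp only [δ]; field_simp; ring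
          _ = (96 * C' * L ^ 3 * (8 * s + 1) ^ 2 * Real.exp (-(μ * 82 / 100) * s)) *
              L⁻¹ * Real.exp (-(μ * 6 / 100) * s) / 4 := by
              rw [hqe, hqe, show μ - μ * 6 / 100 - μ * 6 / 100 = μ * 82 / 100 + μ * 6 / 100 by ring,
                ← hsplit]
              ring
          _ ≤ 1 * L⁻¹ * Real.exp (-(μ * 6 / 100) * s) / 4 := by gcongr
          _ = _ := by ring
      have a2 : L * q * (6 * δ') ≤ L⁻¹ * Real.exp (-(μ * 6 / 100) * s) / 4 := by
        calc L * q * (6 * δ') = (24 * L ^ 2 * (q * δ')) * L⁻¹ / 4 := by field_simp; ring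
          _ = (24 * L ^ 2 * Real.exp (-(μ * 38 / 100) * s)) * L⁻¹ *
              Real.exp (-(μ * 6 / 100) * s) / 4 := by
              rw [hqe, show μ / 2 - μ * 6 / 100 = μ * 38 / 100 + μ * 6 / 100 by ring, ← hsplit]
              ring
          _ ≤ 1 * L⁻¹ * Real.exp (-(μ * 6 / 100) * s) / 4 := by gcongr
          _ = _ := by ring
      have a3 : L * q * θ = L * q * (2 * (3 * δ * (4 * (L * q * (8 * s + 1) ^ 2)))) +
          L * q * (6 * δ') := by ring
      linarith
    refine exp_le_one_add_of_le (by positivity) hnum ?_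
    rw [Real.exp_le_one_iff]
    have : (0 : ℝ) ≤ m := Nat.cast_nonneg _
    nlinarith
  refine ⟨μ / 100, by positivity, ?_⟩
  have hdiv : Tendsto (fun m : ℕ => m / 6) atTop atTop :=
    Nat.tendsto_div_const_atTop (by norm_num)
  filter_upwards [hdiv.eventually key] with m hm
  exact hm m (by omega) (by omega)

/-! ## Bounded energy -/

section energy

variable {P : Measure Config} [IsProbabilityMeasure P]

/-- Integrate the conditional probability of the state of `e` over `F`, which is measurable with
respect to the other bonds. -/
lemma mul_measureReal_le_of_boundedEnergy {p : ℝ} {e : Bond}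
    (h : ∀ᵐ ρ ∂P, p < (condDistr P {e} ρ).real {ω | ω e = true} ∧
      (condDistr P {e} ρ).real {ω | ω e = true} < 1 - p)
    {F : Set Config} {X : Set Bond} (hX : X.Finite) (hF : DeterminedBy F X) (he : e ∉ X)
    (b : Bool) : p * P.real F ≤ P.real (F ∩ {ω | ω e = b}) := by
  have hs : MeasurableSet {ω : Config | ω e = true} :=
    measurableSet_eq_fun (measurable_pi_apply e) measurable_const
  have hm : cylinderEvents (X := fun _ : Bond => Bool) ({e}ᶜ : Set Bond) ≤ MeasurableSpace.pi :=
    fun s => cylinderEvents_le_pi s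
  have hXe : X ⊆ {e}ᶜ := fun f hf hfe => he (Set.mem_singleton_iff.1 hfe ▸ hf)
  have hF' : MeasurableSet[cylinderEvents ({e}ᶜ : Set Bond)] F :=
    cylinderEvents_mono (X := fun _ : Bond => Bool) hXe F (hF.measurableSet_cylinderEvents hX)
  have hFm := hm F hF'
  have hint : ∫ ρ in F, (condDistr P {e} ρ).real {ω | ω e = true} ∂P =
      P.real (F ∩ {ω | ω e = true}) := by
    have h1 := condExpKernel_ae_eq_condExp (μ := P) hm hs
    calc ∫ ρ in F, (condDistr P {e} ρ).real {ω | ω e = true} ∂P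
        = ∫ ρ in F, (P⟦{ω | ω e = true} | cylinderEvents ({e}ᶜ : Set Bond)⟧) ρ ∂P :=
          integral_congr_ae (ae_restrict_of_ae h1)
      _ = ∫ ρ in F, ({ω : Config | ω e = true}.indicator fun _ => (1 : ℝ)) ρ ∂P :=
          setIntegral_condExp hm ((integrable_const _).indicator hs) hF'
      _ = _ := by
          rw [setIntegral_indicator hs]
          simp
  have hi : IntegrableOn (fun ρ => (condDistr P {e} ρ).real {ω | ω e = true}) F P :=
    ((integrable_condExp (μ := P) (m := cylinderEvents ({e}ᶜ : Set Bond))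
      (f := {ω : Config | ω e = true}.indicator fun _ => (1 : ℝ))).congr
      (condExpKernel_ae_eq_condExp hm hs).symm).integrableOn
  have hc : ∀ q : ℝ, ∫ _ in F, q ∂P = q * P.real F := fun q => by
    rw [setIntegral_const, smul_eq_mul, mul_comm]
  cases b with
  | true =>
    rw [← hint, ← hc]
    exact setIntegral_mono_ae (integrable_const _).integrableOn hi (h.mono fun ρ hρ => hρ.1.le)
  | false =>
    have h1 : P.real (F ∩ {ω | ω e = true}) ≤ (1 - p) * P.real F := by
      rw [← hint, ← hc]
      exact setIntegral_mono_ae hi (integrable_const _).integrableOn (h.mono fun ρ hρ => hρ.2.le)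
    have h2 := measureReal_inter_add_sdiff (μ := P) (s := F) hs
    have h3 : F \ {ω | ω e = true} = F ∩ {ω | ω e = false} := by
      ext ω; simp
    rw [h3] at h2
    linarith

lemma pow_card_le_measureReal_agreeOn {p : ℝ} (hp : 0 ≤ p)
    (h : ∀ e : Bond, ∀ᵐ ρ ∂P, p < (condDistr P {e} ρ).real {ω | ω e = true} ∧
      (condDistr P {e} ρ).real {ω | ω e = true} < 1 - p) (η : Config) (D : Finset Bond) :
    p ^ D.card ≤ P.real (agreeOn D η) := by
  classical
  induction D using Finset.induction_on with
  | empty =>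
    have : agreeOn ((∅ : Finset Bond) : Set Bond) η = Set.univ := by ext; simp [agreeOn]
    rw [this]; simp
  | insert e D he ih =>
    have h1 := mul_measureReal_le_of_boundedEnergy (h e) D.finite_toSet
      (determinedBy_agreeOn D η) (by simpa using he) (η e)
    have h2 : agreeOn D η ∩ {ω | ω e = η e} = agreeOn (insert e D : Finset Bond) η := by
      ext ω; simp [agreeOn, and_comm]
    rw [h2] at h1
    rw [Finset.card_insert_of_notMem he, pow_succ']
    exact (mul_le_mul_of_nonneg_left ih hp).trans h1

end energy

/-! ## Separation in the plane and on the lattice -/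

lemma Bond.exists_mem_segment_abs_sub_le (e : Bond) : ∃ p ∈ e.segment,
    0 ≤ p 0 - e.1.1 ∧ p 0 - e.1.1 ≤ 1 / 2 ∧ 0 ≤ p 1 - e.1.2 ∧ p 1 - e.1.2 ≤ 1 / 2 := by
  refine ⟨(1 / 2 : ℝ) • toPlane e.src + (1 / 2 : ℝ) • toPlane e.tgt,
    ⟨1 / 2, 1 / 2, by norm_num, by norm_num, by norm_num, rfl⟩, ?_⟩
  rcases e with ⟨⟨a, b⟩, _ | _⟩ <;> simp [toPlane, src, tgt] <;> norm_num <;>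
    refine ⟨?_, ?_, ?_, ?_⟩ <;> linarith

/-- Compare midpoints: each is within 1/2 of its base site in both coordinates, and the Euclidean
distance is at most the sum of the coordinate differences. -/
lemma DistGE.le_supDist {r : ℝ} {C E : Set Bond} (h : DistGE r C E) {e f : Bond} (he : e ∈ C)
    (hf : f ∈ E) : r ≤ 2 * supDist e.1 f.1 + 1 := by
  obtain ⟨p, hp, hp1, hp2, hp3, hp4⟩ := e.exists_mem_segment_abs_sub_le
  obtain ⟨q, hq, hq1, hq2, hq3, hq4⟩ := f.exists_mem_segment_abs_sub_le
  refine (h e he f hf p hp q hq).trans ?_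
  have e1 : |((e.1.1 - f.1.1 : ℤ) : ℝ)| ≤ supDist e.1 f.1 := by
    rw [← Int.cast_abs, Int.abs_eq_natAbs]
    exact_mod_cast le_max_left (e.1.1 - f.1.1).natAbs (e.1.2 - f.1.2).natAbs
  have e2 : |((e.1.2 - f.1.2 : ℤ) : ℝ)| ≤ supDist e.1 f.1 := by
    rw [← Int.cast_abs, Int.abs_eq_natAbs]
    exact_mod_cast le_max_right (e.1.1 - f.1.1).natAbs (e.1.2 - f.1.2).natAbs
  push_cast at e1 e2
  rw [abs_le] at e1 e2
  have b1 : |p 0 - q 0| ≤ supDist e.1 f.1 + 1 / 2 := abs_le.2 ⟨by linarith, by linarith⟩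
  have b2 : |p 1 - q 1| ≤ supDist e.1 f.1 + 1 / 2 := abs_le.2 ⟨by linarith, by linarith⟩
  rw [EuclideanSpace.dist_eq, Fin.sum_univ_two, Real.dist_eq, Real.dist_eq]
  refine Real.sqrt_le_iff.2 ⟨by positivity, ?_⟩
  have := abs_nonneg (p 0 - q 0)
  have := abs_nonneg (p 1 - q 1)
  nlinarith

/-! ## The dual cluster -/

/-- The set of dual sites joined to `x`. -/
def siteCluster (x : Site) (ω : Config) : Set Site := {v | DualConn ω x v}

lemma mem_siteCluster_self (x : Site) (ω : Config) : x ∈ siteCluster x ω := Relation.ReflTransGen.refl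

lemma siteCluster_step {x u v : Site} {ω : Config} (hu : u ∈ siteCluster x ω) {e : Bond}
    (he : ω e = false) (hj : e.DualJoins u v) : v ∈ siteCluster x ω :=
  Relation.ReflTransGen.tail hu ⟨e, he, hj⟩

lemma siteCluster_mono {x : Site} {ω ω' : Config} (h : ∀ e, ω e = false → ω' e = false) :
    siteCluster x ω ⊆ siteCluster x ω' := fun _ hv =>
  Relation.ReflTransGen.mono (fun _ _ ⟨e, he, hj⟩ => ⟨e, h e he, hj⟩) _ _ hv

/-- Tracing the cluster examines only bonds with an adjacent face in it. -/
lemma siteCluster_eq_of_agree {x : Site} {S : Finset Site} {ω ω' : Config}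
    (hS : siteCluster x ω = S) (h : ∀ e ∈ touchBonds S, ω e = ω' e) : siteCluster x ω' = S := by
  have htouch : ∀ {a b : Site} {e : Bond}, a ∈ siteCluster x ω → e.DualJoins a b →
      e ∈ touchBonds S := by
    intro a b e ha hj
    rw [hS] at ha
    rcases hj with ⟨rfl, -⟩ | ⟨-, rfl⟩
    · exact mem_touchBonds.2 (.inl ha)
    · exact mem_touchBonds.2 (.inr ha)
  rw [← hS]
  refine Set.Subset.antisymm (fun v hv => ?_) fun v hv => ?_
  · induction hv with
    | refl => exact mem_siteCluster_self _ _
    | tail _ hs ih =>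
      obtain ⟨e, he, hj⟩ := hs
      exact siteCluster_step ih ((h e (htouch ih hj)).trans he) hj
  · induction hv with
    | refl => exact mem_siteCluster_self _ _
    | tail hab hs ih =>
      obtain ⟨e, he, hj⟩ := hs
      exact siteCluster_step ih ((h e (htouch hab hj)).symm.trans he) hj

lemma dualCluster_subset_touchBonds {x : Site} {S : Finset Site} {ω : Config}
    (hS : siteCluster x ω ⊆ S) : dualCluster x ω ⊆ touchBonds S := fun _ he =>
  mem_touchBonds.2 (.inl (hS he.2))

/-- Fixing a finite cluster turns `A` into an event on finitely many bonds near that cluster, to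
which decoupling applies. -/
lemma determinedBy_inter_siteCluster_eq {A : Set Config} {x : Site}
    (hA : OccursOnlyOn A (dualCluster x)) (S : Finset Site) :
    DeterminedBy (A ∩ {ω | siteCluster x ω = S}) (touchBonds S) := by
  rintro ω ω' h ⟨hω, hS⟩
  exact ⟨hA ω hω ω' fun e he => (h e (dualCluster_subset_touchBonds hS.subset he)).symm,
    siteCluster_eq_of_agree hS h⟩

lemma exists_mem_dualCluster_supDist_le {x : Site} {ω : Config} (h : (dualCluster x ω).Nonempty) :
    ∃ e ∈ dualCluster x ω, supDist e.1 x ≤ 1 := by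
  obtain ⟨e, he, hc⟩ := h
  rcases Relation.ReflTransGen.cases_head hc with rfl | ⟨y, ⟨f, hf, hj⟩, -⟩
  · exact ⟨e, ⟨he, .refl⟩, e.supDist_dualSrc.le⟩
  · refine ⟨f, ⟨hf, ?_⟩, Bond.DualJoins.supDist_left hj⟩
    rcases hj with ⟨rfl, -⟩ | ⟨rfl, rfl⟩
    · exact .refl
    · exact .single ⟨f, hf, .inr ⟨rfl, rfl⟩⟩

lemma determinedBy_occursOn (B : Set Config) (E : Set Bond) :
    DeterminedBy {ω | OccursOn B E ω} E :=
  fun _ _ h hω ω₁ h₁ => hω ω₁ fun e he => (h₁ e he).trans (h e he).symm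

lemma OccursOn.mem {B : Set Config} {E : Set Bond} {ω : Config} (h : OccursOn B E ω) : ω ∈ B :=
  h ω fun _ _ => rfl

lemma OccursOn.mono {B : Set Config} {E F : Set Bond} {ω : Config} (h : OccursOn B E ω)
    (hEF : E ⊆ F) : OccursOn B F ω := fun ω' hω' => h ω' fun e he => hω' e (hEF he)

/-- Given a change off `E ∩ D`, apply occurrence on `E` to the configuration changed only within
`D`; the part off `D` does not affect `B`. -/
lemma OccursOn.inter_of_determinedBy {B : Set Config} {E D : Set Bond} {ω : Config}
    (h : OccursOn B E ω) (hB : DeterminedBy B D) : OccursOn B (E ∩ D) ω := by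
  classical
  intro ω' hω'
  refine hB (fun e => if e ∈ D then ω' e else ω e) ω' (fun e he => if_pos he) (h _ fun e he => ?_)
  by_cases hD : e ∈ D
  · simp [hD, hω' e ⟨he, hD⟩]
  · simp [hD]

/-! ## Separate occurrence -/

/-- The event that for some well-separated `c` and `E` in `Q`, the bonds of `c` are closed, which
forces `A`, and `B` occurs on `E`. -/
def witnessEvent (A B : Set Config) (D : Finset Bond) (x : Site) (N m : ℕ) (Q : Set Bond) :
    Set Config :=
  {ω | ∃ c E : Set Bond, (c ⊆ touchBonds (box x N) ∧ E ⊆ D ∧ c ⊆ Q ∧ E ⊆ Q) ∧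
    (∀ ω', (∀ e ∈ c, ω' e = false) → ω' ∈ A) ∧ (∀ e ∈ c, ∀ f ∈ E, 6 * m + 1 ≤ supDist e.1 f.1) ∧
    (∀ f ∈ E, 6 * m ≤ supDist x f.1) ∧ (∀ e ∈ c, ω e = false) ∧ OccursOn B E ω}

section witness

variable {A B : Set Config} {D : Finset Bond} {x : Site} {N m : ℕ}

lemma determinedBy_witnessEvent (Q : Set Bond) :
    DeterminedBy (witnessEvent A B D x N m Q) ((touchBonds (box x N) ∪ D) ∩ Q) := by
  rintro ω ω' h ⟨c, E, ⟨hc, hE, hcQ, hEQ⟩, h1, h2, h3, h4, h5⟩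
  refine ⟨c, E, ⟨hc, hE, hcQ, hEQ⟩, h1, h2, h3, fun e he => ?_, ?_⟩
  · rw [← h e ⟨.inl (hc he), hcQ he⟩]
    exact h4 e he
  · exact determinedBy_occursOn B E ω ω' (fun e he => h e ⟨.inr (hE he), hEQ he⟩) h5

lemma witnessEvent_mono {Q Q' : Set Bond} (h : Q ⊆ Q') :
    witnessEvent A B D x N m Q ⊆ witnessEvent A B D x N m Q' :=
  fun _ ⟨c, E, ⟨h1, h2, h3, h4⟩, h5⟩ => ⟨c, E, ⟨h1, h2, h3.trans h, h4.trans h⟩, h5⟩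

lemma atSeparation_inter_subset_witnessEvent {r : ℝ} (hr : 12 * m + 3 ≤ r)
    (hA : OccursOnlyOn A (dualCluster x)) (hAu : A ≠ Set.univ) (hB : DeterminedBy B D) :
    atSeparation r A B ∩ {ω | siteCluster x ω ⊆ box x N} ⊆
      witnessEvent A B D x N m Set.univ := by
  classical
  rintro ω ⟨⟨C, E, hd, hC, hE⟩, hfin⟩
  -- Opening all bonds off `C` preserves `A` and puts the dual cluster of `x` inside `C`; the closed
  -- bonds of that cluster alone already force `A`.
  let ω₁ : Config := fun e => if e ∈ C then ω e else true
  have hω₁ : ω₁ ∈ A := hC ω₁ fun e he => if_pos he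
  have hcl : ∀ e, ω₁ e = false → e ∈ C ∧ ω e = false := by
    intro e he
    by_cases h : e ∈ C
    · exact ⟨h, by simpa [ω₁, h] using he⟩
    · simp [ω₁, h] at he
  have hforce : ∀ ω', (∀ e ∈ dualCluster x ω₁, ω' e = false) → ω' ∈ A := fun ω' h =>
    hA ω₁ hω₁ ω' fun e he => (h e he).trans he.1.symm
  have hsep : ∀ e ∈ dualCluster x ω₁, ∀ f ∈ E ∩ D, 6 * m + 1 ≤ supDist e.1 f.1 := by
    intro e he f hf
    have := hr.trans (hd.le_supDist (hcl e he.1).1 hf.1)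
    have : (6 * m + 1 : ℝ) ≤ supDist e.1 f.1 := by linarith
    exact_mod_cast this
  -- An empty cluster would force `A` unconditionally. A nonempty one has a bond next to `x`, which
  -- transfers the separation from `c` to `x` at the cost of 1.
  have hne : (dualCluster x ω₁).Nonempty := by
    by_contra hem
    rw [Set.not_nonempty_iff_eq_empty] at hem
    exact hAu (Set.eq_univ_of_forall fun ω' => hforce ω' (by simp [hem]))
  obtain ⟨e₀, he₀, hex⟩ := exists_mem_dualCluster_supDist_le hne
  refine ⟨dualCluster x ω₁, E ∩ D, ⟨dualCluster_subset_touchBonds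
      ((siteCluster_mono fun e he => (hcl e he).2).trans hfin), Set.inter_subset_right,
      Set.subset_univ _, Set.subset_univ _⟩, hforce, hsep, fun f hf => ?_,
      fun e he => (hcl e he.1).2, hE.inter_of_determinedBy hB⟩
  have h1 := hsep e₀ he₀ f hf
  have h2 := supDist_triangle e₀.1 x f.1
  omega

/-- The bonds of `D` at distance more than `2 * m` from `S`. -/
noncomputable def farBonds (D : Finset Bond) (m : ℕ) (S : Finset Site) : Finset Bond :=
  D.filter fun d => ∀ u ∈ S, 2 * m < supDist u d.1

/-- The distance to `E` changes by at most one at each step of a cluster path from `x`, so it takes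
the value `l` on the way to `u`. -/
lemma exists_entry {E : Set Bond} {ω : Config} {l : ℕ} (hx : ∀ f ∈ E, l < supDist x f.1) {u : Site}
    (hu : u ∈ siteCluster x ω) {d : Bond} (hd : d ∈ E) (hud : supDist u d.1 ≤ l) :
    ∃ z ∈ siteCluster x ω, (∀ f ∈ E, l ≤ supDist z f.1) ∧ ∃ f ∈ E, supDist z f.1 ≤ l := by
  by_contra hno
  push Not at hno
  have key : ∀ v ∈ siteCluster x ω, ∀ f ∈ E, l < supDist v f.1 := by
    intro v hv
    induction hv with
    | refl => exact hx
    | @tail a b hab hs ih =>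
      obtain ⟨e, he, hj⟩ := hs
      refine hno b (siteCluster_step hab he hj) fun f hf => ?_
      have h1 := ih f hf
      have h2 := supDist_triangle a b f.1
      rw [Bond.DualJoins.supDist_eq hj] at h2
      omega
  exact absurd (key u hu d hd) (by omega)

/-- Either the cluster stays farther than 2m from the witness of `B`, or it contains a site `z` at
distance 3m from it. Since `c` and `x` are about 6m from that witness, `z` is at distance at least
3m from `c` and from `x`; the latter makes the cluster leave the box of radius m about `z`. -/
lemma witnessEvent_inter_subset (hm : 1 ≤ m) :
    witnessEvent A B D x N m Set.univ ∩ {ω | siteCluster x ω ⊆ box x N} ⊆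
      (⋃ S ∈ (box x N).powerset, (A ∩ {ω | siteCluster x ω = S}) ∩
        {ω | OccursOn B (farBonds D m S) ω}) ∪
      ⋃ z ∈ thicken D (3 * m),
        witnessEvent A B D x N m {e | 3 * m ≤ supDist z e.1} ∩ exitEvent z m := by
  rintro ω ⟨⟨c, E, ⟨hc, hE, -, -⟩, h1, h2, h3, h4, h5⟩, hfin⟩
  have hfin' : (siteCluster x ω).Finite := (box x N).finite_toSet.subset hfin
  by_cases hfar : E ⊆ farBonds D m hfin'.toFinset
  · refine .inl (Set.mem_iUnion₂.2 ⟨hfin'.toFinset, Finset.mem_powerset.2 fun v hv =>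
      hfin (hfin'.mem_toFinset.1 hv), ⟨h1 ω h4, ?_⟩, h5.mono hfar⟩)
    exact hfin'.coe_toFinset.symm
  · right
    obtain ⟨d, hd, hdn⟩ := Set.not_subset.1 hfar
    simp only [farBonds, Finset.coe_filter, Set.mem_ofPred_eq, not_and, not_forall, not_lt,
      hfin'.mem_toFinset] at hdn
    obtain ⟨u, hu, hud⟩ := hdn (hE hd)
    obtain ⟨z, hz, hzE, f, hf, hzf⟩ := exists_entry (l := 3 * m)
      (fun f hf => lt_of_lt_of_le (by omega) (h3 f hf)) hu hd (by omega)
    refine Set.mem_iUnion₂.2 ⟨z, mem_thicken.2 ⟨f, hE hf, by rwa [supDist_comm]⟩,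
      ⟨c, E, ⟨hc, hE, fun e he => ?_, hzE⟩, h1, h2, h3, h4, h5⟩,
      mem_exitEvent (dualConn_iff.1 hz).symm ?_⟩
    · have t1 := h2 e he f hf
      have t2 := supDist_triangle e.1 z f.1
      rw [supDist_comm e.1 z] at t2
      change 3 * m ≤ _
      omega
    · have t1 := h3 f hf
      have t2 := supDist_triangle x z f.1
      rw [supDist_comm x z] at t2
      omega

end witness

section separation

variable {P : Measure Config} [IsProbabilityMeasure P] {A B : Set Config} {D : Finset Bond}
  {x : Site} {m : ℕ} {κ : ℝ}

/-- For fixed `S` the two events live at distance at least m and decouple. The events that the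
cluster equals `S` are disjoint, so the sum over `S` rebuilds at most P(A). -/
lemma DecouplingAt.sum_cluster_le (h : DecouplingAt P κ m) (hD : (D.card : ℝ) ≤ Real.exp (κ * m))
    (hA : OccursOnlyOn A (dualCluster x)) (I : Finset (Finset Site)) :
    P.real (⋃ S ∈ I, (A ∩ {ω | siteCluster x ω = S}) ∩ {ω | OccursOn B (farBonds D m S) ω}) ≤
      (1 + Real.exp (-κ * m)) * (P.real A * P.real B) := by
  have hdisj : Set.PairwiseDisjoint (I : Set (Finset Site))
      fun S => A ∩ {ω | siteCluster x ω = S} := by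
    intro S _ T _ hne
    refine Set.disjoint_left.2 fun ω h1 h2 => hne ?_
    exact Finset.coe_injective (h1.2.symm.trans h2.2)
  calc P.real (⋃ S ∈ I, (A ∩ {ω | siteCluster x ω = S}) ∩ {ω | OccursOn B (farBonds D m S) ω})
      ≤ ∑ S ∈ I, P.real ((A ∩ {ω | siteCluster x ω = S}) ∩
          {ω | OccursOn B (farBonds D m S) ω}) := measureReal_biUnion_finset_le _ _
    _ ≤ ∑ S ∈ I, P.real (A ∩ {ω | siteCluster x ω = S}) *
          ((1 + Real.exp (-κ * m)) * P.real B) := by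
        refine Finset.sum_le_sum fun S _ => ?_
        have h1 := h (farBonds D m S) (touchBonds S) (Finset.finite_toSet _)
          (le_trans (by exact_mod_cast Finset.card_filter_le _ _) hD) (fun e he d hd => by
            have hd' := (Finset.mem_filter.1 hd).2
            rcases mem_touchBonds.1 he with hu | hu
            · have t1 := hd' _ hu
              have t2 := supDist_triangle e.dualSrc e.1 d.1
              rw [supDist_comm _ e.1, e.supDist_dualSrc, supDist_comm e.1] at t2
              omega
            · have t1 : 2 * m < supDist e.1 d.1 := hd' _ hu
              rw [supDist_comm] at t1
              omega) _ _ (determinedBy_inter_siteCluster_eq hA S)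
          (determinedBy_occursOn B (farBonds D m S))
        have h2 : P.real {ω | OccursOn B (farBonds D m S) ω} ≤ P.real B :=
          measureReal_mono fun ω hω => OccursOn.mem hω
        calc _ ≤ _ := h1
          _ ≤ (1 + Real.exp (-κ * m)) * (P.real (A ∩ {ω | siteCluster x ω = S}) * P.real B) := by
            gcongr
          _ = _ := by ring
    _ = P.real (⋃ S ∈ I, A ∩ {ω | siteCluster x ω = S}) *
          ((1 + Real.exp (-κ * m)) * P.real B) := by
        rw [← Finset.sum_mul, measureReal_biUnion_finset hdisj fun S _ =>
          (determinedBy_inter_siteCluster_eq hA S).measurableSet (Finset.finite_toSet _)]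
    _ ≤ P.real A * ((1 + Real.exp (-κ * m)) * P.real B) := by
        refine mul_le_mul_of_nonneg_right (measureReal_mono ?_) (by positivity)
        exact Set.iUnion₂_subset fun S _ => Set.inter_subset_left
    _ = _ := by ring

/-- The witnesses keep distance 3m from `z` and the crossing uses only bonds within m of `z`; here
the box plays the part of the small set. -/
lemma DecouplingAt.witness_exit_le (h : DecouplingAt P κ m) (hκ : 0 < κ)
    (hbox : (4 * (2 * m + 1) ^ 2 : ℝ) ≤ Real.exp (κ * m)) (N : ℕ) (z : Site) :
    P.real (witnessEvent A B D x N m {e | 3 * m ≤ supDist z e.1} ∩ exitEvent z m) ≤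
      2 * (P.real (witnessEvent A B D x N m Set.univ) * P.real (exitEvent z m)) := by
  classical
  have h1 := h ((touchBonds (box z m)).filter fun e => e ∈ innerBonds (box z m : Set Site))
    ((touchBonds (box x N) ∪ D) ∩ {e | 3 * m ≤ supDist z e.1})
    (((touchBonds (box x N)).finite_toSet.union D.finite_toSet).inter_of_left _)
    (le_trans (by
      have i1 := (Finset.card_filter_le (touchBonds (box z m))
        fun e => e ∈ innerBonds (box z m : Set Site)).trans (card_touchBonds_le _)
      rw [card_box] at i1
      exact_mod_cast i1) hbox) (fun e he d hd => by
        have hd' : d.1 ∈ box z m := (Finset.mem_filter.1 hd).2.2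
        have t1 := mem_box.1 hd'
        have t2 : 3 * m ≤ supDist z e.1 := he.2
        have t3 := supDist_triangle z d.1 e.1
        omega) _ _ (determinedBy_witnessEvent (A := A) (B := B) (m := m) _) ((determinedBy_exitEvent z m).mono fun e he =>
        Finset.mem_coe.2 (Finset.mem_filter.2 ⟨mem_touchBonds.2 (.inl he.1), he⟩))
  refine h1.trans ?_
  have hexp : Real.exp (-κ * m) ≤ 1 := by
    rw [Real.exp_le_one_iff]
    have : (0 : ℝ) ≤ m := Nat.cast_nonneg _
    nlinarith
  have h2 : P.real (witnessEvent A B D x N m {e | 3 * m ≤ supDist z e.1}) ≤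
      P.real (witnessEvent A B D x N m Set.univ) :=
    measureReal_mono (witnessEvent_mono (Set.subset_univ _))
  gcongr
  linarith

/-- The bad part of the witness event is at most θ times the probability of the witness event
itself, so it can be moved to the left-hand side. -/
lemma DecouplingAt.mul_measureReal_atSeparation_le (h : DecouplingAt P κ m) (hκ : 0 < κ)
    (hbox : (4 * (2 * m + 1) ^ 2 : ℝ) ≤ Real.exp (κ * m)) (hD : (D.card : ℝ) ≤ Real.exp (κ * m))
    (hm : 1 ≤ m) {φ : ℕ → ℝ} (hφ : ∀ z n, P.real (exitEvent z n) ≤ φ n)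
    (hφ0 : Tendsto φ atTop (𝓝 0)) {θ : ℝ} (hθ : D.card * (6 * m + 1) ^ 2 * (2 * φ m) ≤ θ)
    (hθ1 : θ ≤ 1) {r : ℝ} (hr : 12 * m + 3 ≤ r) (hA : OccursOnlyOn A (dualCluster x))
    (hAu : A ≠ Set.univ) (hB : DeterminedBy B D) :
    (1 - θ) * P.real (atSeparation r A B) ≤
      (1 + Real.exp (-κ * m)) * (P.real A * P.real B) := by
  have hφm : 0 ≤ φ m := measureReal_nonneg.trans (hφ x m)
  -- Confining the cluster to a box of radius `N` reduces everything to finitely many bonds; the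
  -- error φ(N) disappears in the limit.
  have key : ∀ N : ℕ, (1 - θ) * P.real (atSeparation r A B) ≤
      (1 + Real.exp (-κ * m)) * (P.real A * P.real B) + φ N + (1 - θ) * φ N := by
    intro N
    have hfin : P.real {ω | siteCluster x ω ⊆ box x N}ᶜ ≤ φ N := by
      refine (measureReal_mono fun ω hω => ?_).trans (hφ x N)
      obtain ⟨v, hv, hvN⟩ := Set.not_subset.1 hω
      rw [Finset.mem_coe, mem_box, not_le] at hvN
      exact mem_exitEvent (dualConn_iff.1 hv) hvN.le
    have hsplit : ∀ U : Set Config, P.real U ≤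
        P.real (U ∩ {ω | siteCluster x ω ⊆ box x N}) + φ N := fun U =>
      ((measureReal_mono fun ω hω => by
        by_cases hf : ω ∈ {ω | siteCluster x ω ⊆ box x N}
        · exact .inl ⟨hω, hf⟩
        · exact .inr hf).trans (measureReal_union_le _ _)).trans (add_le_add_right hfin _)
    let U := witnessEvent A B D x N m Set.univ
    have h1 : P.real (atSeparation r A B) ≤ P.real U + φ N := (hsplit _).trans
      (add_le_add_left (measureReal_mono
        (atSeparation_inter_subset_witnessEvent hr hA hAu hB)) _)
    have h2 : P.real (U ∩ {ω | siteCluster x ω ⊆ box x N}) ≤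
        (1 + Real.exp (-κ * m)) * (P.real A * P.real B) + θ * P.real U := by
      refine ((measureReal_mono (witnessEvent_inter_subset hm)).trans
        (measureReal_union_le _ _)).trans (add_le_add (h.sum_cluster_le hD hA _) ?_)
      calc _ ≤ ∑ z ∈ thicken D (3 * m), P.real (witnessEvent A B D x N m
              {e | 3 * m ≤ supDist z e.1} ∩ exitEvent z m) := measureReal_biUnion_finset_le _ _
        _ ≤ ∑ z ∈ thicken D (3 * m), 2 * (P.real U * φ m) := by
            refine Finset.sum_le_sum fun z _ => (h.witness_exit_le hκ hbox N z).trans ?_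
            have := hφ z m
            gcongr
        _ = (thicken D (3 * m)).card * (2 * φ m) * P.real U := by
            rw [Finset.sum_const, nsmul_eq_mul]; ring
        _ ≤ D.card * (6 * m + 1) ^ 2 * (2 * φ m) * P.real U := by
            have i1 := card_thicken_le D (3 * m)
            rw [show 2 * (3 * m) + 1 = 6 * m + 1 by ring] at i1
            have i2 : ((thicken D (3 * m)).card : ℝ) ≤ D.card * (6 * m + 1) ^ 2 := by
              exact_mod_cast i1
            gcongr
        _ ≤ θ * P.real U := by gcongr
    have h3 : (1 - θ) * P.real U ≤ (1 + Real.exp (-κ * m)) * (P.real A * P.real B) + φ N := by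
      have := hsplit U
      linarith
    have h4 := mul_le_mul_of_nonneg_left h1 (sub_nonneg.2 hθ1)
    linarith
  have hlim : Tendsto (fun N => (1 + Real.exp (-κ * m)) * (P.real A * P.real B) + φ N +
      (1 - θ) * φ N) atTop (𝓝 ((1 + Real.exp (-κ * m)) * (P.real A * P.real B))) := by
    simpa using (hφ0.const_add ((1 + Real.exp (-κ * m)) * (P.real A * P.real B))).add
      (hφ0.const_mul (1 - θ))
  exact ge_of_tendsto' hlim key

lemma Decoupling.eventually_measureReal_atSeparation_le (h : Decoupling P)
    (ht : TranslationInvariant P) (hd : DualExpDecay P) :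
    ∃ μ : ℝ, 0 < μ ∧ ∀ᶠ m : ℕ in atTop, ∀ (D : Finset Bond) (x : Site) (r : ℝ) (A B : Set Config),
      (D.card : ℝ) ≤ Real.exp (μ * m) → 12 * m + 3 ≤ r → OccursOnlyOn A (dualCluster x) →
      DeterminedBy B D →
      P.real (atSeparation r A B) ≤ (1 + 4 * Real.exp (-μ * m)) * (P.real A * P.real B) := by
  obtain ⟨κ, hκ, h⟩ := h
  obtain ⟨C, c, hC, hc, hd⟩ := hd
  have hd : DualDecayWith P C c := hd
  let μ := min κ (c / 4)
  have hμ : 0 < μ := lt_min hκ (by positivity)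
  have hμκ : μ ≤ κ := min_le_left _ _
  have hμc : μ ≤ c / 4 := min_le_right _ _
  let φ : ℕ → ℝ := fun n => (2 * n + 1) ^ 2 * (C * Real.exp (-c * n))
  have hφ0 : Tendsto φ atTop (𝓝 0) := by
    have hlim : Tendsto (fun n : ℕ => Real.exp (-(c / 2) * n)) atTop (𝓝 0) := by
      refine Real.tendsto_exp_atBot.comp ?_
      exact tendsto_natCast_atTop_atTop.const_mul_atTop_of_neg (by linarith)
    refine squeeze_zero' (Eventually.of_forall fun n => by positivity) ?_ hlim
    filter_upwards [eventually_mul_pow_mul_exp_le C 2 (b := c / 2) (by positivity)] with n hn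
    calc φ n ≤ (8 * n + 1) ^ 2 * (C * Real.exp (-c * n)) := by
          simp only [φ]; gcongr; norm_num
      _ = (C * (8 * n + 1) ^ 2 * Real.exp (-(c / 2) * n)) * Real.exp (-(c / 2) * n) := by
          rw [mul_assoc _ (Real.exp _), ← Real.exp_add]; ring_nf
      _ ≤ 1 * Real.exp (-(c / 2) * n) := by gcongr
      _ = _ := one_mul _
  refine ⟨μ, hμ, ?_⟩
  filter_upwards [h, eventually_ge_atTop 1, eventually_mul_pow_mul_exp_le 4 2 hκ,
    eventually_mul_pow_mul_exp_le (4 * C) 4 (b := c / 2) (by positivity)] with m h hm h1 h2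
  intro D x r A B hD hr hA hB
  have hm0 : (0 : ℝ) ≤ m := Nat.cast_nonneg _
  have hPA : 0 ≤ P.real A := measureReal_nonneg
  have hPB : 0 ≤ P.real B := measureReal_nonneg
  -- The certain event has the empty witness, so nothing keeps `B` away from `x`; the bound is then
  -- immediate from P(A) = 1.
  by_cases hAu : A = Set.univ
  · have i1 : P.real (atSeparation r A B) ≤ P.real B :=
      measureReal_mono fun ω ⟨_, _, _, _, hE⟩ => hE.mem
    have i2 : P.real A = 1 := by rw [hAu]; simp
    rw [i2, one_mul]
    refine i1.trans (le_mul_of_one_le_left hPB ?_)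
    have := Real.exp_pos (-μ * m)
    linarith
  have hbox : (4 * (2 * m + 1) ^ 2 : ℝ) ≤ Real.exp (κ * m) := by
    have i1 : Real.exp (-κ * m) * Real.exp (κ * m) = 1 := by
      rw [← Real.exp_add]; ring_nf; exact Real.exp_zero
    calc (4 * (2 * m + 1) ^ 2 : ℝ) ≤ 4 * (8 * m + 1) ^ 2 := by gcongr; norm_num
      _ = (4 * (8 * m + 1) ^ 2 * Real.exp (-κ * m)) * Real.exp (κ * m) := by
          rw [mul_assoc _ (Real.exp _), i1, mul_one]
      _ ≤ 1 * Real.exp (κ * m) := by gcongr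
      _ = _ := one_mul _
  have hDκ : (D.card : ℝ) ≤ Real.exp (κ * m) :=
    hD.trans (Real.exp_le_exp.2 (by nlinarith))
  let y := Real.exp (-μ * m)
  have hy0 : 0 < y := Real.exp_pos _
  have hy1 : y ≤ 1 := by
    simp only [y]
    rw [Real.exp_le_one_iff]
    nlinarith
  have hθ : D.card * (6 * m + 1) ^ 2 * (2 * φ m) ≤ y / 2 := by
    calc D.card * (6 * m + 1) ^ 2 * (2 * φ m)
        ≤ Real.exp (μ * m) * (8 * m + 1) ^ 2 * (2 * ((8 * m + 1) ^ 2 *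
          (C * Real.exp (-c * m)))) := by
          simp only [φ]
          gcongr <;> norm_num
      _ = (4 * C * (8 * m + 1) ^ 4 * (Real.exp (μ * m) * Real.exp (-c * m))) / 2 := by ring
      _ ≤ (4 * C * (8 * m + 1) ^ 4 * (Real.exp (-(c / 2) * m) * y)) / 2 := by
          rw [← Real.exp_add, ← Real.exp_add]
          gcongr 4 * C * (8 * _ + 1) ^ 4 * ?_ / 2
          exact Real.exp_le_exp.2 (by nlinarith)
      _ = (4 * C * (8 * m + 1) ^ 4 * Real.exp (-(c / 2) * m)) * y / 2 := by ring
      _ ≤ 1 * y / 2 := by gcongr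
      _ = _ := by ring
  have key := DecouplingAt.mul_measureReal_atSeparation_le h hκ hbox hDκ hm
    (measureReal_exitEvent_le ht hC hc hd) hφ0 hθ (by linarith) hr hA hAu hB
  have hκy : Real.exp (-κ * m) ≤ y := Real.exp_le_exp.2 (by nlinarith)
  have hpos : 0 < 1 - y / 2 := by linarith
  refine le_of_mul_le_mul_left ?_ hpos
  calc (1 - y / 2) * P.real (atSeparation r A B)
      ≤ (1 + Real.exp (-κ * m)) * (P.real A * P.real B) := key
    _ ≤ (1 + y) * (P.real A * P.real B) := by gcongr
    -- For 0 ≤ y ≤ 1 the product is 1 + 7y/2 - 2y² ≥ 1 + y; this is where the factor 4 comes from.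
    _ ≤ ((1 - y / 2) * (1 + 4 * y)) * (P.real A * P.real B) := by
        gcongr
        nlinarith
    _ = _ := by ring

end separation

end BondPerc

/-! ### Conclusion: large r by decoupling, small r by bounded energy -/

theorem lemma3p2 (P : Measure BondPerc.Config) [IsProbabilityMeasure P]
    (hP : BondPerc.StandingAssumptions P)
    (hmix : BondPerc.RatioWeakMixing P ∨ (BondPerc.WeakMixing P ∧ BondPerc.NearMarkov P)) :
    ∃ K₁ K₂ ε : ℝ, 0 < K₁ ∧ 0 < K₂ ∧ 0 < ε ∧
      ∀ (𝒟 : Finset BondPerc.Bond) (x : BondPerc.Site) (r : ℝ) (A B : Set BondPerc.Config),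
        K₁ * Real.log (𝒟.card : ℝ) < r →
        MeasurableSet A →
        BondPerc.OccursOnlyOn A (BondPerc.dualCluster x) →
        MeasurableSet[cylinderEvents (𝒟 : Set BondPerc.Bond)] B →
        P.real (BondPerc.atSeparation r A B) ≤
          (1 + K₂ * Real.exp (-ε * r)) * P.real A * P.real B := by
  have hdec : BondPerc.Decoupling P := hmix.elim BondPerc.RatioWeakMixing.decoupling fun h =>
    BondPerc.decoupling_of_weakMixing_of_nearMarkov hP.translation hP.dualDecay h.1 h.2
  obtain ⟨μ, hμ, hev⟩ := hdec.eventually_measureReal_atSeparation_le hP.translation hP.dualDecay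
  obtain ⟨M, hM⟩ := Filter.eventually_atTop.1 hev
  obtain ⟨p, hp, hp'⟩ := hP.boundedEnergy
  have hp1 : p ≤ 1 := by
    have := BondPerc.pow_card_le_measureReal_agreeOn hp.le hp' (fun _ => true) {((0, 0), true)}
    rw [Finset.card_singleton, pow_one] at this
    exact this.trans measureReal_le_one
  let r₀ : ℝ := 40 * (M + 1)
  let ε := μ / 40
  let J := ⌈Real.exp (ε * r₀)⌉₊
  have hε : 0 < ε := by positivity
  -- With this `K₁` the hypothesis on `r` says that `D` has at most exp(εr) bonds. In `K₂`, the 4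
  -- serves large `r` and the second summand serves `r < r₀`.
  refine ⟨40 / μ, 4 + (p ^ J)⁻¹ * Real.exp (ε * r₀), ε, by positivity, by positivity, hε, ?_⟩
  intro D x r A B hr _ hA hB
  have hB : BondPerc.DeterminedBy B D := .of_measurableSet hB
  have hPA : 0 ≤ P.real A := measureReal_nonneg
  have hPB : 0 ≤ P.real B := measureReal_nonneg
  have hDr : (D.card : ℝ) ≤ Real.exp (ε * r) := by
    rcases Nat.eq_zero_or_pos D.card with h0 | h0
    · rw [h0]; exact_mod_cast (Real.exp_pos _).le
    · have h0' : (0 : ℝ) < D.card := by exact_mod_cast h0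
      rw [← Real.log_le_iff_le_exp h0']
      rw [div_mul_eq_mul_div, div_lt_iff₀ hμ] at hr
      simp only [ε]
      linarith
  -- This includes the empty set, for which `Real.log 0 = 0`.
  have hr0 : 0 < r := lt_of_le_of_lt (mul_nonneg (by positivity) (Real.log_natCast_nonneg _)) hr
  rw [mul_assoc]
  rcases le_or_gt r₀ r with hrr | hrr
  · let m := ⌊r / 20⌋₊
    have hm1 : (m : ℝ) ≤ r / 20 := Nat.floor_le (by positivity)
    have hm2 : r / 20 < m + 1 := Nat.lt_floor_add_one _
    have hM0 : (0 : ℝ) ≤ M := Nat.cast_nonneg _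
    have hr40 : 40 * ((M : ℝ) + 1) ≤ r := hrr
    have hm3 : r / 40 ≤ m := by linarith
    have hMm : M ≤ m := by
      have : (M : ℝ) ≤ m := by linarith
      exact_mod_cast this
    have hεm : ε * r ≤ μ * m := by
      simp only [ε]
      nlinarith
    refine (hM m hMm D x r A B (hDr.trans (Real.exp_le_exp.2 hεm)) (by linarith) hA hB).trans ?_
    have h1 : Real.exp (-μ * m) ≤ Real.exp (-ε * r) := Real.exp_le_exp.2 (by linarith)
    have h2 : 0 ≤ (p ^ J)⁻¹ * Real.exp (ε * r₀) := by positivity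
    gcongr
    linarith
  · rcases B.eq_empty_or_nonempty with hBe | ⟨η, hη⟩
    · have : BondPerc.atSeparation r A B = ∅ := by
        refine Set.eq_empty_of_forall_notMem fun ω ⟨_, _, _, _, hE⟩ => ?_
        have := hE.mem
        rw [hBe] at this
        exact this
      rw [this, measureReal_empty]
      positivity
    have hDJ : D.card ≤ J := by
      have h1 : (D.card : ℝ) ≤ J :=
        (hDr.trans (Real.exp_le_exp.2 (by nlinarith))).trans (Nat.le_ceil _)
      exact_mod_cast h1
    -- For `r < r₀` the set `D` has at most `J` bonds, and a nonempty `B` contains a full pattern on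
    -- `D`.
    have hBp : p ^ J ≤ P.real B :=
      ((pow_le_pow_of_le_one hp.le hp1 hDJ).trans
        (BondPerc.pow_card_le_measureReal_agreeOn hp.le hp' η D)).trans
        (measureReal_mono fun ω hω => hB η ω (fun e he => (hω e he).symm) hη)
    have hpJ : 0 < p ^ J := by positivity
    have h1 : P.real (BondPerc.atSeparation r A B) ≤ P.real A :=
      measureReal_mono fun ω ⟨_, _, _, hC, _⟩ => hC.mem
    have h2 : 1 ≤ Real.exp (ε * r₀) * Real.exp (-ε * r) := by
      rw [← Real.exp_add]
      exact Real.one_le_exp (by nlinarith)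
    have h3 : 1 ≤ (p ^ J)⁻¹ * P.real B := by
      rw [inv_mul_eq_div]
      exact (one_le_div hpJ).2 hBp
    calc P.real (BondPerc.atSeparation r A B) ≤ P.real A := h1
      _ = 1 * 1 * P.real A := by ring
      _ ≤ ((p ^ J)⁻¹ * P.real B) * (Real.exp (ε * r₀) * Real.exp (-ε * r)) * P.real A := by gcongr
      _ = ((p ^ J)⁻¹ * Real.exp (ε * r₀) * Real.exp (-ε * r)) * (P.real A * P.real B) := by ring
      _ ≤ _ := by
          gcongr
          have := Real.exp_pos (-ε * r)
          linarith
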